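/- **Setting.** Let $\alpha, b, \nu, \rho > 0$ satisfy $$\alpha \in (0,2), \quad \nu = \tfrac1\alpha - b > 0, \quad 0 < \rho < \nu < \tfrac12, \quad \tfrac{1}{4-\alpha} < \nu < \tfrac{1}{4-2\alpha}, \quad \alpha\rho < (2-\alpha)\nu .$$ Let $Z$ be a real random variable with $\mathbb E[e^{\mathrm i tZ}] = \exp(-\sigma^\alpha |t|^\alpha)$ for all $t \in \mathbb R$, where $\sigma = \big( \pi / (2 \sin(\pi\alpha/2)\,\Gamma(\alpha)) \big)^{1/\alpha}$. Let $J$ be a symmetric random variable on the same probability space, not necessarily independent of $Z$, with $\mathbb E[J^2] < \infty$, such that $Z+J$ is symmetric and $C_1 (|t|+1)^{-\alpha} \le \mathbb P[|Z+J| \ge t] \le C_2 (|t|+1)^{-\alpha}$ for all $t \ge 0$ and some constants $C_1, C_2 > 0$. For a positive integer $N$ let $H$ denote a random variable with the law of $N^{-1/\alpha}(Z+J)$, and set $$t = \frac{N\, \mathbb E[H^2 \mathbf 1_{|H| < N^{-\nu}}]}{\mathbb P[|H| < N^{-\rho}]} .$$ For $1 \le i \le j \le N$ let $a_{ij}, b_{ij},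 c_{ij}, \psi_{ij}, \chi_{ij}, w_{ij}$ be mutually independent random variables (all families jointly independent), where $a_{ij}$, $b_{ij}$, $c_{ij}$ have the law of $H$ conditioned on $|H| < N^{-\nu}$, on $N^{-\nu} \le |H| < N^{-\rho}$, and on $|H| \ge N^{-\rho}$, respectively; $\psi_{ij}, \chi_{ij} \in \{0,1\}$ are Bernoulli with $$\mathbb P[\psi_{ij} = 1] = \mathbb P[|H| \ge N^{-\rho}], \qquad \mathbb P[\chi_{ij} = 1] = \frac{\mathbb P[N^{-\nu} \le |H| < N^{-\rho}]}{\mathbb P[|H| < N^{-\rho}]};$$ and $w_{ij}$ is a centered Gaussian with variance $\frac2N$ if $i = j$ and $\frac1N$ if $i \ne j$. (If one of the conditioning events is null, the corresponding variable is multiplied by a Bernoulli factor that vanishes almost surely, and is taken to be $0$.) Extend all of them to $1 \le i,j \le N$ by symmetry, and define the symmetric matrices $\mathbf A = \{(1-\psi_{ij})(1-\chi_{ij})a_{ij}\}$, $\mathbf B = \{(1-\psi_{ij})\chi_{ij} b_{ij}\}$, $\mathbf C = \{\psi_{ij} c_{ij}\}$, $\mathbf X = \mathbf B + \mathbf C$,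 $\mathbf W = \{w_{ij}\}$ and, for $\gamma \in [0,1]$ and $\operatorname{Im} z > 0$, $$\mathbf H^\gamma = \gamma \mathbf A + \mathbf X + (1-\gamma^2)^{1/2} t^{1/2} \mathbf W, \qquad \mathbf G^\gamma(z) = \{ G^\gamma_{ij}(z) \} = (\mathbf H^\gamma - z)^{-1} .$$ For a symmetric $0$–$1$ matrix $\Psi$ let $\mathbb P_\Psi, \mathbb E_\Psi$ denote probability and expectation conditional on the event $\{\psi_{ij}\} = \Psi$. **Theorem.** For every positive integer $m$ there exist $\varepsilon = \varepsilon(\alpha,\nu,\rho,m) > 0$, $\omega = \omega(\alpha,\nu,\rho,m) > 0$ and, for each $C_0 > 0$, a number $d_0 = d_0(\alpha,\nu,\rho,m,C_0)$, as well as a constant $C > 0$ depending only on $\alpha, \nu, \rho, m$ and the fixed law of $(Z,J)$, such that the following holds. Let $N \ge 1$, let $z_j = E_j + \mathrm i \eta_j$ with $E_j \in \mathbb R$ and $\eta_j > N^{-2}$ for $1 \le j \le m$, let $C_0 > 0$ and $d > 0$ be real numbers with $d > d_0(\alpha,\nu,\rho,m,C_0)$, and let $F : \mathbb R^m \to \mathbb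 R$ be of class $C^{\lfloor d \rfloor}$ with $$\sup_{\substack{0 \le |\mu| \le d \\ |x_j| \le 2N^\varepsilon}} |F^{(\mu)}(x_1,\ldots,x_m)| \le N^{C_0\varepsilon}, \qquad \sup_{\substack{0 \le |\mu| \le d \\ |x_j| \le 2N^2}} |F^{(\mu)}(x_1,\ldots,x_m)| \le N^{C_0},$$ where $\mu$ ranges over multi-indices in $\mathbb Z_{\ge 0}^m$, $|\mu| = \sum_j \mu_j$ and $F^{(\mu)} = \prod_j (\partial/\partial x_j)^{\mu_j} F$. Let $\Psi$ be a symmetric $N \times N$ $0$–$1$ matrix with at most $N^{1+\alpha\rho+\varepsilon}$ entries equal to $1$. For each $s \in \{1,\ldots,m\}$ let $\Theta_s : \mathbb C \to \mathbb R$ be either $\operatorname{Im}$ or $\operatorname{Re}$ (in particular, all of them may be $\operatorname{Im}$), and set $$\mathfrak J = \max_{0 \le |\mu| \le d}\ \sup_{\substack{1 \le i_s, j_s \le N \\ 0 \le \gamma \le 1}} \mathbb E_\Psi \Big[ \big| F^{(\mu)} \big( \Theta_1 G^\gamma_{i_1 j_1}(z_1), \ldots, \Theta_m G^\gamma_{i_m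 j_m}(z_m) \big) \big| \Big],$$ $$\Omega_0(z) = \Big\{ \sup_{\substack{1 \le i,j \le N \\ 0 \le \gamma \le 1}} |G^\gamma_{ij}(z)| \le N^\varepsilon \Big\}, \qquad Q_0 = \sum_{j=1}^m \big( 1 - \mathbb P_\Psi[\Omega_0(z_j)] \big) .$$ Then, for all indices $1 \le a_1, \ldots, a_m, b_1, \ldots, b_m \le N$, $$\sup_{0 \le \gamma \le 1} \Big| \mathbb E_\Psi \big[ F \big( \Theta_1 G^\gamma_{a_1 b_1}(z_1), \ldots, \Theta_m G^\gamma_{a_m b_m}(z_m) \big) \big] - \mathbb E_\Psi \big[ F \big( \Theta_1 G^0_{a_1 b_1}(z_1), \ldots, \Theta_m G^0_{a_m b_m}(z_m) \big) \big] \Big| < C N^{-\omega} (\mathfrak J + 1) + C Q_0 N^{C + C_0} .$$ -/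

import Mathlib

open MeasureTheory ProbabilityTheory

noncomputable section

namespace LevyComparison

/-- The admissible ranges of the exponents. -/
structure Admissible (α b ν ρ : ℝ) : Prop where
  alpha_pos : 0 < α
  alpha_lt_two : α < 2
  b_pos : 0 < b
  nu_eq : ν = 1 / α - b
  rho_pos : 0 < ρ
  rho_lt_nu : ρ < ν
  nu_lt_half : ν < 1 / 2
  nu_lower : 1 / (4 - α) < ν
  nu_upper : ν < 1 / (4 - 2 * α)
  alpha_rho : α * ρ < (2 - α) * ν

/-- The scale `σ = (π / (2 sin(πα/2) Γ(α)))^{1/α}`. -/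
def stableScale (α : ℝ) : ℝ :=
  (Real.pi / (2 * Real.sin (Real.pi * α / 2) * Real.Gamma α)) ^ (1 / α)

/-- `κ` is the joint law of a pair `(Z, J)`, not necessarily independent, where `Z` is a
`(0, σ)` `α`-stable law, `J` is symmetric with finite second moment, `Z + J` is symmetric, and
`P(|Z + J| ≥ t)` is comparable to `(t + 1)^{-α}`. -/
structure IsDeformedStable (α : ℝ) (κ : Measure (ℝ × ℝ)) : Prop where
  isProbabilityMeasure : IsProbabilityMeasure κ
  stable : ∀ t : ℝ, charFun (κ.map Prod.fst) t =
    Complex.exp ((-(stableScale α ^ α * |t| ^ α) : ℝ) : ℂ)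
  symm_J : κ.map (fun x => -x.2) = κ.map Prod.snd
  sq_integrable_J : Integrable (fun x => x.2 ^ 2) κ
  symm_sum : κ.map (fun x => -(x.1 + x.2)) = κ.map (fun x => x.1 + x.2)
  tail : ∃ C₁ C₂ : ℝ, 0 < C₁ ∧ 0 < C₂ ∧ ∀ t : ℝ, 0 ≤ t →
    C₁ / (|t| + 1) ^ α ≤ κ.real {x | t ≤ |x.1 + x.2|} ∧
      κ.real {x | t ≤ |x.1 + x.2|} ≤ C₂ / (|t| + 1) ^ α

/-- The law of the matrix entry `H_{ij}`, that is, of `N^{-1/α} (Z + J)`. -/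
def entryLaw (α : ℝ) (κ : Measure (ℝ × ℝ)) (N : ℕ) : Measure ℝ :=
  κ.map (fun x => (N : ℝ) ^ (-(1 / α)) * (x.1 + x.2))

/-- `|x| < N^{-ν}`. -/
def smallSet (ν : ℝ) (N : ℕ) : Set ℝ := {x | |x| < (N : ℝ) ^ (-ν)}

/-- `N^{-ν} ≤ |x| < N^{-ρ}`. -/
def middleSet (ν ρ : ℝ) (N : ℕ) : Set ℝ :=
  {x | (N : ℝ) ^ (-ν) ≤ |x| ∧ |x| < (N : ℝ) ^ (-ρ)}

/-- `N^{-ρ} ≤ |x|`. -/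
def largeSet (ρ : ℝ) (N : ℕ) : Set ℝ := {x | (N : ℝ) ^ (-ρ) ≤ |x|}

/-- The law `μ` conditioned on `s`. If `μ s = 0` the conditional law does not exist, and a point
mass at `0` stands in for it: the variable with this law is then multiplied by a Bernoulli
variable that vanishes almost surely, so that the choice is immaterial. -/
def condLaw (μ : Measure ℝ) (s : Set ℝ) : Measure ℝ :=
  open Classical in if μ s = 0 then Measure.dirac 0 else cond μ s

/-- The Bernoulli `0`-`1` law with `P(1) = p`, as a law on `ℝ`; it is used for `p ∈ [0, 1]`,
where the projection to the unit interval does nothing. -/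
def bernoulliLaw (p : ℝ) : Measure ℝ :=
  bernoulliMeasure 1 0 (Set.projIcc 0 1 zero_le_one p)

/-- `P(ψ = 1) = P(|H_{ij}| ≥ N^{-ρ})`. -/
def psiProb (α ρ : ℝ) (κ : Measure (ℝ × ℝ)) (N : ℕ) : ℝ :=
  (entryLaw α κ N).real (largeSet ρ N)

/-- `P(χ = 1) = P(|H_{ij}| ∈ [N^{-ν}, N^{-ρ})) / P(|H_{ij}| < N^{-ρ})`. -/
def chiProb (α ν ρ : ℝ) (κ : Measure (ℝ × ℝ)) (N : ℕ) : ℝ :=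
  (entryLaw α κ N).real (middleSet ν ρ N) / (entryLaw α κ N).real (smallSet ρ N)

/-- `t = N E[H_{11}² 1_{|H_{11}| < N^{-ν}}] / P(|H_{11}| < N^{-ρ})`. -/
def tParam (α ν ρ : ℝ) (κ : Measure (ℝ × ℝ)) (N : ℕ) : ℝ :=
  N * (∫ x in smallSet ν N, x ^ 2 ∂(entryLaw α κ N)) / (entryLaw α κ N).real (smallSet ρ N)

/-- The names of the independent random variables attached to a matrix entry. -/
inductive Var where
  | a | b | c | psi | chi | w
  deriving DecidableEq

instance : Fintype Var :=
  ⟨{Var.a, Var.b, Var.c, Var.psi, Var.chi, Var.w}, by intro x; cases x <;> simp⟩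

/-- The positions `(i, j)` with `i ≤ j`. -/
abbrev UpperIndex (N : ℕ) : Type := {p : Fin N × Fin N // p.1 ≤ p.2}

/-- The position on or above the diagonal that carries the `(i, j)` entry of a symmetric matrix. -/
def upper {N : ℕ} (i j : Fin N) : UpperIndex N := ⟨(min i j, max i j), min_le_max⟩

/-- A sample of all variables `a_{ij}, b_{ij}, c_{ij}, ψ_{ij}, χ_{ij}, w_{ij}`, `i ≤ j`. -/
abbrev Sample (N : ℕ) : Type := Var × UpperIndex N → ℝ

/-- The laws of the individual variables; the `w_{ij}` are the entries of a GOE matrix, with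
variance `2/N` on the diagonal and `1/N` off the diagonal. -/
def varLaw (α ν ρ : ℝ) (κ : Measure (ℝ × ℝ)) (N : ℕ) : Var × UpperIndex N → Measure ℝ
  | (Var.a, _) => condLaw (entryLaw α κ N) (smallSet ν N)
  | (Var.b, _) => condLaw (entryLaw α κ N) (middleSet ν ρ N)
  | (Var.c, _) => condLaw (entryLaw α κ N) (largeSet ρ N)
  | (Var.psi, _) => bernoulliLaw (psiProb α ρ κ N)
  | (Var.chi, _) => bernoulliLaw (chiProb α ν ρ κ N)
  | (Var.w, p) => gaussianReal 0 (if p.1.1 = p.1.2 then 2 / N else 1 / N)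

/-- The joint law: all the variables are mutually independent. -/
def jointLaw (α ν ρ : ℝ) (κ : Measure (ℝ × ℝ)) (N : ℕ) : Measure (Sample N) :=
  Measure.pi (varLaw α ν ρ κ N)

/-- The symmetric matrix of the variables of one kind. -/
def varMatrix {N : ℕ} (v : Var) (ω : Sample N) : Matrix (Fin N) (Fin N) ℝ :=
  Matrix.of fun i j => ω (v, upper i j)

/-- `P_Ψ`: the joint law conditioned on the label matrix `{ψ_{ij}}` being equal to `Ψ`. -/
def labelLaw (α ν ρ : ℝ) (κ : Measure (ℝ × ℝ)) (N : ℕ) (Ψ : Matrix (Fin N) (Fin N) ℝ) :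
    Measure (Sample N) :=
  cond (jointLaw α ν ρ κ N) {ω | varMatrix Var.psi ω = Ψ}

/-- `A_{ij} = (1 - ψ_{ij}) (1 - χ_{ij}) a_{ij}`. -/
def matA {N : ℕ} (ω : Sample N) : Matrix (Fin N) (Fin N) ℝ := Matrix.of fun i j =>
  (1 - varMatrix Var.psi ω i j) * (1 - varMatrix Var.chi ω i j) * varMatrix Var.a ω i j

/-- `B_{ij} = (1 - ψ_{ij}) χ_{ij} b_{ij}`. -/
def matB {N : ℕ} (ω : Sample N) : Matrix (Fin N) (Fin N) ℝ := Matrix.of fun i j =>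
  (1 - varMatrix Var.psi ω i j) * varMatrix Var.chi ω i j * varMatrix Var.b ω i j

/-- `C_{ij} = ψ_{ij} c_{ij}`. -/
def matC {N : ℕ} (ω : Sample N) : Matrix (Fin N) (Fin N) ℝ := Matrix.of fun i j =>
  varMatrix Var.psi ω i j * varMatrix Var.c ω i j

/-- The removal matrix `X = B + C`. -/
def matX {N : ℕ} (ω : Sample N) : Matrix (Fin N) (Fin N) ℝ := matB ω + matC ω

/-- `H^γ = γ A + X + (1 - γ²)^{1/2} t^{1/2} W`. -/
def matH {N : ℕ} (t γ : ℝ) (ω : Sample N) : Matrix (Fin N) (Fin N) ℝ :=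
  γ • matA ω + matX ω + (Real.sqrt (1 - γ ^ 2) * Real.sqrt t) • varMatrix Var.w ω

/-- `G^γ(z) = (H^γ - z)^{-1}`. -/
def matG {N : ℕ} (t γ : ℝ) (z : ℂ) (ω : Sample N) : Matrix (Fin N) (Fin N) ℂ :=
  ((matH t γ ω).map Complex.ofReal - z • (1 : Matrix (Fin N) (Fin N) ℂ))⁻¹

/-- The vector whose `s`-th coordinate is `Im G^γ_{i_s j_s}(z_s)` if `s ∉ S` and
`Re G^γ_{i_s j_s}(z_s)` if `s ∈ S`. -/
def entryVec {m N : ℕ} (t γ : ℝ) (z : Fin m → ℂ) (S : Finset (Fin m)) (i j : Fin m → Fin N)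
    (ω : Sample N) : Fin m → ℝ := fun s =>
  if s ∈ S then (matG t γ (z s) ω (i s) (j s)).re else (matG t γ (z s) ω (i s) (j s)).im

/-- The partial derivative `∂f/∂x_j`. -/
def partialDeriv {m : ℕ} (j : Fin m) (f : (Fin m → ℝ) → ℝ) : (Fin m → ℝ) → ℝ :=
  fun x => fderiv ℝ f x (Pi.single j 1)

/-- `F^{(μ)} = ∏_j (∂/∂x_j)^{μ_j} F`. -/
def multiDeriv {m : ℕ} (μ : Fin m → ℕ) (F : (Fin m → ℝ) → ℝ) : (Fin m → ℝ) → ℝ :=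
  (List.finRange m).foldr (fun j f => (partialDeriv j)^[μ j] f) F

/-- The multi-indices `μ` with `|μ| ≤ d`. -/
abbrev MultiIndex (m : ℕ) (d : ℝ) : Type := {μ : Fin m → ℕ // ((∑ j, μ j : ℕ) : ℝ) ≤ d}

/-- `𝔍(Ψ)`: the maximum over `|μ| ≤ d` and the supremum over the indices and `γ ∈ [0, 1]` of
`E_Ψ |F^{(μ)}|` at the resolvent entries selected by `S`. -/
def frakJ {m : ℕ} (α ν ρ : ℝ) (κ : Measure (ℝ × ℝ)) (N : ℕ) (z : Fin m → ℂ) (S : Finset (Fin m))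
    (d : ℝ) (F : (Fin m → ℝ) → ℝ) (Ψ : Matrix (Fin N) (Fin N) ℝ) : ℝ :=
  ⨆ q : MultiIndex m d × (Fin m → Fin N) × (Fin m → Fin N) × Set.Icc (0 : ℝ) 1,
    ∫ ω, |multiDeriv q.1.1 F (entryVec (tParam α ν ρ κ N) q.2.2.2.1 z S q.2.1 q.2.2.1 ω)|
      ∂(labelLaw α ν ρ κ N Ψ)

/-- `Ω₀(ε, z)`: all `|G^γ_{ij}(z)|`, `γ ∈ [0, 1]`, are at most `N^ε`. -/
def eventOmega (N : ℕ) (t ε : ℝ) (z : ℂ) : Set (Sample N) :=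
  {ω | ∀ γ ∈ Set.Icc (0 : ℝ) 1, ∀ i j : Fin N, ‖matG t γ z ω i j‖ ≤ (N : ℝ) ^ ε}

/-- `Q₀ = ∑_j (1 - P_Ψ[Ω₀(ε, z_j)])`. -/
def probQ {m : ℕ} (α ν ρ : ℝ) (κ : Measure (ℝ × ℝ)) (N : ℕ) (ε : ℝ) (z : Fin m → ℂ)
    (Ψ : Matrix (Fin N) (Fin N) ℝ) : ℝ :=
  ∑ j, (1 - (labelLaw α ν ρ κ N Ψ).real (eventOmega N (tParam α ν ρ κ N) ε (z j)))

end LevyComparison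

end

/-!
The two matrices are joined by the path `θ ↦ sin θ • A + X + cos θ • t^{1/2} W`, which is `H^γ` with
`γ = sin θ` and, unlike the parametrization by `γ`, is smooth up to the end. Conditioning on the
labels turns the law of all variables into a product law (`labelLaw_eq`), and the derivative of
`E_Ψ F` along the path is a sum over the positions `p = (i, j)` of
`E_Ψ [(cos θ A_p - sin θ t^{1/2} w_p) ∂_p f]`, where `f` is `F` of the resolvent entries as a function
of the matrix.

At each position, integration by parts replaces `w_p` by a second derivative (`integral_w_mul`). The
variables `a`, `b`, `χ` at `p` are then replaced by an independent copy, and `∂_p f`, `∂_p² f` are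
expanded around the matrix whose entry at `p` lacks the part `γ A_p + B_p`
(`abs_entry_contribution_le`). The odd moments vanish by symmetry, and `t` is such that `E A_p²` is
the variance of `t^{1/2} w_p` off the diagonal. What remains are the fourth moment of `A_p`, products
of second moments, the diagonal, and the positions with label one. Their total is `N^{-δ + ε}` with
`δ > 0` (`sum_entryError_le`); the conditions `1/(4-α) < ν` and `αρ < (2-α)ν` are exactly those for
the fourth moments and for the labels.

The error terms carry derivatives of `f` up to order four at matrices that differ in one entry from
the matrix of the path, and these have to be compared with `𝔍`, the expected derivatives of `F` at the
path itself. If all resolvent entries at the path are at most `Γ = N^ε`, the change of one entry by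
`2 N^{-ρ}` moves the resolvent entries by at most `Δ = 8 N^{-ρ} Γ²` (`green_perturb`), and a Taylor
expansion of the derivatives of `F` of length `n` around the path has a remainder `Δ^n N^{C₀ ε}` that
is at most one once `n` is of order `C₀ ε / ρ`; this is why `d₀` depends on `C₀`. Since `m Δ ≤ 1/2`,
the sum of the intermediate terms is geometric and its constant does not depend on `n`
(`abs_dirDeriv_iterate_perturb_le`, `integral_taylorSum_le`). Outside of this event the bound
`‖G‖ ≤ N²` gives a power of `N` times `Q₀` (`abs_integral_sub_le_of_large`).

For the finitely many `N` below a threshold the difference is at most `2 𝔍`.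
-/

noncomputable section

namespace LevyComparison

/-! ### Directional derivatives and multi-index derivatives -/

section Directional

variable {E : Type*} [NormedAddCommGroup E] [NormedSpace ℝ E]

/-- The derivative of `f` in the direction `v`. -/
def dirDeriv (v : E) (f : E → ℝ) : E → ℝ := fun x => fderiv ℝ f x v

lemma contDiff_dirDeriv {f : E → ℝ} {n : ℕ} (hf : ContDiff ℝ (n + 1 : ℕ) f) (v : E) :
    ContDiff ℝ n (dirDeriv v f) := by
  have h : ContDiff ℝ n (fderiv ℝ f) := hf.fderiv_right (by norm_cast)
  exact h.clm_apply contDiff_const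

lemma contDiff_iterate_dirDeriv {f : E → ℝ} {n k : ℕ} (hf : ContDiff ℝ (n + k : ℕ) f) (v : E) :
    ContDiff ℝ n ((dirDeriv v)^[k] f) := by
  induction k generalizing f with
  | zero => simpa using hf
  | succ k ih =>
    rw [Function.iterate_succ_apply]
    exact ih (contDiff_dirDeriv (by simpa [add_assoc] using hf) v)

lemma dirDeriv_comm {f : E → ℝ} (hf : ContDiff ℝ 2 f) (v w : E) :
    dirDeriv v (dirDeriv w f) = dirDeriv w (dirDeriv v f) := by
  have h : ContDiff ℝ 1 (fderiv ℝ f) := hf.fderiv_right (by norm_num)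
  funext x
  have hd : DifferentiableAt ℝ (fderiv ℝ f) x := h.differentiable (by norm_num) x
  have key : ∀ u u' : E, dirDeriv u (dirDeriv u' f) x = fderiv ℝ (fderiv ℝ f) x u u' := by
    intro u u'
    unfold dirDeriv
    rw [fderiv_clm_apply hd (differentiableAt_const u')]
    simp
  rw [key, key]
  exact (hf.contDiffAt.isSymmSndFDerivAt (by simp)).eq v w

lemma dirDeriv_iterate_comm {f : E → ℝ} {k : ℕ} (hf : ContDiff ℝ (k + 1 : ℕ) f) (v w : E) :
    dirDeriv v ((dirDeriv w)^[k] f) = (dirDeriv w)^[k] (dirDeriv v f) := by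
  induction k generalizing f with
  | zero => rfl
  | succ k ih =>
    rw [Function.iterate_succ_apply, Function.iterate_succ_apply,
      ih (contDiff_dirDeriv hf w), dirDeriv_comm (hf.of_le (by norm_cast; omega))]

lemma hasDerivAt_line {f : E → ℝ} (hf : Differentiable ℝ f) (h v : E) (x : ℝ) :
    HasDerivAt (fun y : ℝ => f (h + y • v)) (dirDeriv v f (h + x • v)) x := by
  have h1 : HasDerivAt (fun y : ℝ => h + y • v) v x := by
    simpa using ((hasDerivAt_id x).smul_const v).const_add h
  exact (hf _).hasFDerivAt.comp_hasDerivAt x h1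

lemma iteratedDeriv_line {f : E → ℝ} {k : ℕ} (hf : ContDiff ℝ k f) (h v : E) :
    iteratedDeriv k (fun y : ℝ => f (h + y • v)) =
      fun y => (dirDeriv v)^[k] f (h + y • v) := by
  induction k generalizing f with
  | zero => simp
  | succ k ih =>
    rw [iteratedDeriv_succ', Function.iterate_succ]
    have : deriv (fun y : ℝ => f (h + y • v)) = fun y => dirDeriv v f (h + y • v) := by
      funext x
      exact (hasDerivAt_line (hf.differentiable (by simp)) h v x).deriv
    rw [this, ih (contDiff_dirDeriv hf v)]
    rfl

end Directional

section MultiIndex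

variable {m : ℕ}

lemma partialDeriv_eq (j : Fin m) : partialDeriv j = dirDeriv (Pi.single j (1 : ℝ)) := rfl

lemma contDiff_foldr (μ : Fin m → ℕ) (l : List (Fin m)) {F : (Fin m → ℝ) → ℝ} {r : ℕ}
    (hF : ContDiff ℝ (r + (l.map μ).sum : ℕ) F) :
    ContDiff ℝ r (l.foldr (fun j f => (partialDeriv j)^[μ j] f) F) := by
  induction l generalizing r with
  | nil => simpa using hF
  | cons i l ih =>
    rw [List.foldr_cons, partialDeriv_eq]
    refine contDiff_iterate_dirDeriv (ih ?_) _
    simpa [add_assoc] using hF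

lemma foldr_congr (μ μ' : Fin m → ℕ) (l : List (Fin m)) (h : ∀ i ∈ l, μ i = μ' i)
    (F : (Fin m → ℝ) → ℝ) :
    l.foldr (fun j f => (partialDeriv j)^[μ j] f) F =
      l.foldr (fun j f => (partialDeriv j)^[μ' j] f) F := by
  induction l with
  | nil => rfl
  | cons i l ih =>
    rw [List.foldr_cons, List.foldr_cons, h i (by simp), ih fun k hk => h k (by simp [hk])]

/-- A partial derivative can be moved past the others to its place in an iterated derivative. -/
lemma partialDeriv_foldr (μ : Fin m → ℕ) (j : Fin m) (l : List (Fin m)) (hl : l.Nodup)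
    (hj : j ∈ l) {F : (Fin m → ℝ) → ℝ} (hF : ContDiff ℝ ((l.map μ).sum + 1 : ℕ) F) :
    partialDeriv j (l.foldr (fun j f => (partialDeriv j)^[μ j] f) F) =
      l.foldr (fun i f => (partialDeriv i)^[(μ + Pi.single j 1 : Fin m → ℕ) i] f) F := by
  induction l with
  | nil => simp at hj
  | cons i l ih =>
    rw [List.foldr_cons, List.foldr_cons]
    rw [List.nodup_cons] at hl
    by_cases hij : i = j
    · subst hij
      have : (μ + Pi.single i 1 : Fin m → ℕ) i = μ i + 1 := by simp
      rw [this, Function.iterate_succ_apply']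
      congr 2
      refine foldr_congr _ _ _ (fun k hk => ?_) _
      have : k ≠ i := fun h => hl.1 (h ▸ hk)
      simp [this]
    · have hj' : j ∈ l := by
        rcases List.mem_cons.1 hj with h | h
        · exact absurd h.symm hij
        · exact h
      have : (μ + Pi.single j 1 : Fin m → ℕ) i = μ i := by simp [hij]
      rw [this, ← ih hl.2 hj' (hF.of_le (by norm_cast; simp)), partialDeriv_eq, partialDeriv_eq]
      refine dirDeriv_iterate_comm (contDiff_foldr μ l (hF.of_le ?_)) _ _
      norm_cast
      simp; omega

lemma multiDeriv_zero (F : (Fin m → ℝ) → ℝ) : multiDeriv 0 F = F := by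
  unfold multiDeriv
  induction List.finRange m with
  | nil => rfl
  | cons a l ih => simp

lemma partialDeriv_multiDeriv (μ : Fin m → ℕ) (j : Fin m) {F : (Fin m → ℝ) → ℝ} {n : ℕ}
    (hF : ContDiff ℝ n F) (h : ∑ i, μ i + 1 ≤ n) :
    partialDeriv j (multiDeriv μ F) = multiDeriv (μ + Pi.single j 1) F := by
  refine partialDeriv_foldr μ j _ (List.nodup_finRange m) (List.mem_finRange j) (hF.of_le ?_)
  rw [Fin.sum_univ_def] at h
  exact_mod_cast h

lemma contDiff_multiDeriv (μ : Fin m → ℕ) {F : (Fin m → ℝ) → ℝ} {n r : ℕ}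
    (hF : ContDiff ℝ n F) (h : r + ∑ i, μ i ≤ n) : ContDiff ℝ r (multiDeriv μ F) := by
  refine contDiff_foldr μ _ (hF.of_le ?_)
  rw [Fin.sum_univ_def] at h
  exact_mod_cast h

/-- The multi-index that counts the letters of a word. -/
def wordCount {k : ℕ} (w : Fin k → Fin m) : Fin m → ℕ := ∑ l, Pi.single (w l) 1

lemma sum_wordCount {k : ℕ} (w : Fin k → Fin m) : ∑ j, wordCount w j = k := by
  simp only [wordCount, Finset.sum_apply]
  rw [Finset.sum_comm]
  simp

lemma iteratedFDeriv_word {k n : ℕ} {F : (Fin m → ℝ) → ℝ} (hF : ContDiff ℝ n F) (hk : k ≤ n)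
    (w : Fin k → Fin m) (y : Fin m → ℝ) :
    iteratedFDeriv ℝ k F y (fun l => Pi.single (w l) (1 : ℝ)) = multiDeriv (wordCount w) F y := by
  induction k generalizing y with
  | zero =>
    have : wordCount w = 0 := by simp [wordCount]
    simp [this, multiDeriv_zero]
  | succ k ih =>
    rw [iteratedFDeriv_succ_apply_left]
    have hd : DifferentiableAt ℝ (iteratedFDeriv ℝ k F) y :=
      (hF.differentiable_iteratedFDeriv (by exact_mod_cast hk)) y
    have h1 : (fderiv ℝ (iteratedFDeriv ℝ k F) y (Pi.single (w 0) (1 : ℝ)))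
        (fun l => Pi.single (Fin.tail w l) (1 : ℝ)) =
        fderiv ℝ (fun x => iteratedFDeriv ℝ k F x (fun l => Pi.single (Fin.tail w l) (1 : ℝ))) y
          (Pi.single (w 0) (1 : ℝ)) := by
      rw [fderiv_continuousMultilinear_apply_const_apply hd]
    refine h1.trans ?_
    have h2 : (fun x => iteratedFDeriv ℝ k F x (fun l => Pi.single (Fin.tail w l) (1 : ℝ))) =
        multiDeriv (wordCount (Fin.tail w)) F := by
      funext x
      exact ih (by omega) (Fin.tail w) x
    rw [h2]
    have h3 := partialDeriv_multiDeriv (wordCount (Fin.tail w)) (w 0) hF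
      (by rw [sum_wordCount]; omega)
    change partialDeriv (w 0) _ y = _
    rw [h3]
    congr 1
    unfold wordCount
    rw [Fin.sum_univ_succ, add_comm]
    rfl

/-- For the sup norm on `Fin m → ℝ`, the norm of the `k`-th derivative is at most the sum of the
absolute values of the partial derivatives over all words of length `k`. -/
lemma norm_iteratedFDeriv_le_sum {k n : ℕ} {F : (Fin m → ℝ) → ℝ} (hF : ContDiff ℝ n F)
    (hk : k ≤ n) (y : Fin m → ℝ) :
    ‖iteratedFDeriv ℝ k F y‖ ≤ ∑ w : Fin k → Fin m, |multiDeriv (wordCount w) F y| := by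
  refine ContinuousMultilinearMap.opNorm_le_bound (by positivity) fun v => ?_
  have hv : v = fun l => ∑ j, v l j • (Pi.single j (1 : ℝ) : Fin m → ℝ) := by
    funext l
    conv_lhs => rw [pi_eq_sum_univ' (v l)]
  conv_lhs => rw [hv]
  rw [← ContinuousMultilinearMap.coe_coe, MultilinearMap.map_sum]
  refine (norm_sum_le _ _).trans ?_
  rw [Finset.sum_mul]
  refine Finset.sum_le_sum fun w _ => ?_
  rw [MultilinearMap.map_smul_univ, norm_smul, ContinuousMultilinearMap.coe_coe,
    iteratedFDeriv_word hF hk, mul_comm, Real.norm_eq_abs]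
  refine mul_le_mul_of_nonneg_left ?_ (abs_nonneg _)
  rw [norm_prod]
  exact Finset.prod_le_prod (fun _ _ => norm_nonneg _) fun l _ => norm_le_pi_norm (v l) (w l)

end MultiIndex

/-! ### A geometric Taylor estimate -/

/-- Iterating the mean value inequality in a ball of radius `Δ` bounds a derivative anywhere in the
ball by the derivatives at the centre. -/
lemma norm_iteratedFDeriv_le_geometric {E : Type*} [NormedAddCommGroup E] [NormedSpace ℝ E]
    {F : E → ℝ} {n : ℕ} (k : ℕ) (hF : ContDiff ℝ (k + n : ℕ) F) (y : E) {Δ B : ℝ} (hΔ : 0 ≤ Δ)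
    (hB : ∀ x, ‖x - y‖ ≤ Δ → ‖iteratedFDeriv ℝ (k + n) F x‖ ≤ B) (x : E) (hx : ‖x - y‖ ≤ Δ) :
    ‖iteratedFDeriv ℝ k F x‖ ≤
      ∑ l ∈ Finset.range n, Δ ^ l * ‖iteratedFDeriv ℝ (k + l) F y‖ + Δ ^ n * B := by
  induction n generalizing k x with
  | zero => simpa using hB x hx
  | succ n ih =>
    have hkn : k + (n + 1) = k + 1 + n := by omega
    have h1 : ∀ x, ‖x - y‖ ≤ Δ → ‖iteratedFDeriv ℝ (k + 1) F x‖ ≤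
        ∑ l ∈ Finset.range n, Δ ^ l * ‖iteratedFDeriv ℝ (k + 1 + l) F y‖ + Δ ^ n * B := by
      intro x hx
      exact ih (k + 1) (hkn ▸ hF) (hkn ▸ hB) x hx
    have hd : ∀ x ∈ Metric.closedBall y Δ, DifferentiableAt ℝ (iteratedFDeriv ℝ k F) x := by
      intro x _
      exact (hF.differentiable_iteratedFDeriv (by norm_cast; omega)) x
    have h2 := (convex_closedBall y Δ).norm_image_sub_le_of_norm_fderiv_le hd
      (C := ∑ l ∈ Finset.range n, Δ ^ l * ‖iteratedFDeriv ℝ (k + 1 + l) F y‖ + Δ ^ n * B)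
      (fun x hx => by
        rw [norm_fderiv_iteratedFDeriv]
        exact h1 x (by simpa [dist_eq_norm] using hx))
      (Metric.mem_closedBall_self hΔ) (by simpa [dist_eq_norm] using hx : x ∈ _)
    have hC := (norm_nonneg _).trans (h1 x hx)
    have h3 := mul_le_mul_of_nonneg_left hx hC
    have h4 : ‖iteratedFDeriv ℝ k F x‖ ≤ ‖iteratedFDeriv ℝ k F y‖ +
        ‖iteratedFDeriv ℝ k F x - iteratedFDeriv ℝ k F y‖ := by
      have := norm_add_le (iteratedFDeriv ℝ k F y)
        (iteratedFDeriv ℝ k F x - iteratedFDeriv ℝ k F y)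
      simpa using this
    refine h4.trans ((add_le_add_right (h2.trans h3) _).trans (le_of_eq ?_))
    rw [Finset.sum_range_succ', add_mul, Finset.sum_mul]
    have : ∀ l, Δ ^ l * ‖iteratedFDeriv ℝ (k + 1 + l) F y‖ * Δ =
        Δ ^ (l + 1) * ‖iteratedFDeriv ℝ (k + (l + 1)) F y‖ := by
      intro l
      rw [show k + 1 + l = k + (l + 1) by omega]; ring
    simp only [this]
    rw [pow_zero, one_mul, add_zero]
    ring

/-- One step of the Taylor estimate on a symmetric interval. -/
lemma abs_le_mul_pow_succ_of_deriv {φ φ' : ℝ → ℝ} {r M : ℝ} {k : ℕ} (h0 : φ 0 = 0)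
    (hM : 0 ≤ M) (hφ : ∀ x, HasDerivAt φ (φ' x) x) (hb : ∀ x, |x| ≤ r → |φ' x| ≤ M * |x| ^ k) (x : ℝ)
    (hx : |x| ≤ r) : |φ x| ≤ M * |x| ^ (k + 1) := by
  have hc : Convex ℝ (Metric.closedBall (0 : ℝ) |x|) := convex_closedBall _ _
  have := hc.norm_image_sub_le_of_norm_hasDerivWithin_le (f := φ) (f' := φ') (C := M * |x| ^ k)
    (fun y _ => (hφ y).hasDerivWithinAt) (fun y hy => by
      have hy' : |y| ≤ |x| := by simpa using hy
      refine (hb y (hy'.trans hx)).trans ?_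
      gcongr)
    (Metric.mem_closedBall_self (abs_nonneg x)) (by simp : x ∈ Metric.closedBall (0 : ℝ) |x|)
  simpa [h0, pow_succ, mul_assoc] using this

/-! ### Resolvents of symmetric matrices -/

section Resolvent

variable {N : ℕ}

/-- The real-linear map that sends the entries on and above the diagonal to the symmetric matrix
with these entries, regarded as a complex matrix. -/
def symLin (N : ℕ) : (UpperIndex N → ℝ) →ₗ[ℝ] Matrix (Fin N) (Fin N) ℂ where
  toFun h := Matrix.of fun i j => ((h (upper i j) : ℝ) : ℂ)
  map_add' h h' := by ext i j; simp
  map_smul' c h := by ext i j; simp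

lemma symLin_apply (h : UpperIndex N → ℝ) (i j : Fin N) :
    symLin N h i j = ((h (upper i j) : ℝ) : ℂ) := rfl

lemma upper_comm (i j : Fin N) : upper i j = upper j i := by
  simp [upper, min_comm, max_comm]

lemma symLin_isHermitian (h : UpperIndex N → ℝ) : (symLin N h).IsHermitian := by
  ext i j
  simp [symLin_apply, upper_comm i j]

/-- The resolvent at `z` of the symmetric matrix with the given upper triangle. -/
def green (z : ℂ) (h : UpperIndex N → ℝ) : Matrix (Fin N) (Fin N) ℂ :=
  (symLin N h - z • (1 : Matrix (Fin N) (Fin N) ℂ))⁻¹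

lemma im_star_dotProduct_shift (z : ℂ) (h : UpperIndex N → ℝ) (v : Fin N → ℂ) :
    (star v ⬝ᵥ ((symLin N h - z • (1 : Matrix (Fin N) (Fin N) ℂ)).mulVec v)).im =
      -(z.im * ∑ i, ‖v i‖ ^ 2) := by
  have h1 : (star v ⬝ᵥ (symLin N h).mulVec v).im = 0 :=
    (symLin_isHermitian h).im_star_dotProduct_mulVec_self v
  have h2 : star v ⬝ᵥ v = ((∑ i, ‖v i‖ ^ 2 : ℝ) : ℂ) := by
    simp only [dotProduct, Pi.star_apply, RCLike.star_def, Complex.ofReal_sum]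
    refine Finset.sum_congr rfl fun i _ => ?_
    rw [← Complex.normSq_eq_conj_mul_self, Complex.normSq_eq_norm_sq]
  rw [Matrix.sub_mulVec, dotProduct_sub, Complex.sub_im, h1, Matrix.smul_mulVec,
    Matrix.one_mulVec, dotProduct_smul, h2, smul_eq_mul, Complex.im_mul_ofReal, zero_sub]

lemma isUnit_det_shift {z : ℂ} (hz : 0 < z.im) (h : UpperIndex N → ℝ) :
    IsUnit (symLin N h - z • (1 : Matrix (Fin N) (Fin N) ℂ)).det := by
  rw [isUnit_iff_ne_zero]
  intro h0
  obtain ⟨v, hv, hv0⟩ := Matrix.exists_mulVec_eq_zero_iff.2 h0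
  have h1 := im_star_dotProduct_shift z h v
  rw [hv0] at h1
  simp only [dotProduct_zero, Complex.zero_im] at h1
  have h2 : ∑ i, ‖v i‖ ^ 2 = 0 := by
    rcases mul_eq_zero.1 (neg_eq_zero.1 h1.symm) with h | h
    · exact absurd h hz.ne'
    · exact h
  rw [Finset.sum_eq_zero_iff_of_nonneg fun _ _ => by positivity] at h2
  exact hv (funext fun i => by simpa using h2 i (Finset.mem_univ i))

/-- The bound by the inverse distance of `z` to the real axis, from the imaginary part of the
quadratic form applied to a column of the resolvent. -/
lemma norm_green_le {z : ℂ} (hz : 0 < z.im) (h : UpperIndex N → ℝ) (i j : Fin N) :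
    ‖green z h i j‖ ≤ z.im⁻¹ := by
  set M := symLin N h - z • (1 : Matrix (Fin N) (Fin N) ℂ) with hM
  set v : Fin N → ℂ := fun k => green z h k j with hv
  have hMv : M.mulVec v = Pi.single j 1 := by
    have h1 : M * green z h = 1 := Matrix.mul_nonsing_inv M (isUnit_det_shift hz h)
    funext k
    have := congrFun (congrFun h1 k) j
    rw [Matrix.mul_apply] at this
    rw [Matrix.mulVec, dotProduct, this, Matrix.one_apply, Pi.single_apply]
  have h1 := im_star_dotProduct_shift z h v
  rw [← hM, hMv, dotProduct_single_one] at h1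
  have h2 : z.im * ∑ k, ‖v k‖ ^ 2 ≤ ‖v j‖ := by
    have h3 : -(star v j).im ≤ ‖v j‖ := by
      have := (neg_le_abs (star v j).im).trans (Complex.abs_im_le_norm _)
      simpa using this
    linarith
  have h3 : ∀ k, z.im * ‖v k‖ ^ 2 ≤ ‖v j‖ := fun k =>
    (mul_le_mul_of_nonneg_left (Finset.single_le_sum (f := fun k => ‖v k‖ ^ 2)
      (fun _ _ => by positivity) (Finset.mem_univ k)) hz.le).trans h2
  have h4 : ‖v j‖ ≤ z.im⁻¹ := by
    by_contra hc
    push Not at hc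
    have h5 : 1 < z.im * ‖v j‖ := by
      have := mul_lt_mul_of_pos_left hc hz
      rwa [mul_inv_cancel₀ hz.ne'] at this
    have h6 : 0 < ‖v j‖ := (inv_pos.2 hz).trans hc
    nlinarith [h3 j]
  change ‖v i‖ ≤ _
  have h5 : ‖v i‖ ^ 2 ≤ z.im⁻¹ ^ 2 := by
    have h6 := (h3 i).trans h4
    calc ‖v i‖ ^ 2 = z.im⁻¹ * (z.im * ‖v i‖ ^ 2) := by field_simp
      _ ≤ z.im⁻¹ * z.im⁻¹ := mul_le_mul_of_nonneg_left h6 (inv_pos.2 hz).le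
      _ = _ := by ring
  exact (pow_le_pow_iff_left₀ (norm_nonneg _) (inv_pos.2 hz).le two_ne_zero).1 h5

lemma green_sub_green {z : ℂ} (hz : 0 < z.im) (h h' : UpperIndex N → ℝ) :
    green z h - green z h' = green z h * symLin N (h' - h) * green z h' := by
  unfold green
  rw [Matrix.inv_sub_inv]
  · simp [map_sub]
  · simp only [Matrix.isUnit_iff_isUnit_det, isUnit_det_shift hz]

/-- An off-diagonal position occurs twice in a symmetric matrix. -/
lemma sum_norm_symLin_single_le (p : UpperIndex N) :
    ∑ k, ∑ l, ‖symLin N (Pi.single p 1) k l‖ ≤ 2 := by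
  have h1 : ∀ k l, ‖symLin N (Pi.single p 1) k l‖ ≤
      (if k = p.1.1 then 1 else 0) * (if l = p.1.2 then 1 else 0) +
      (if k = p.1.2 then 1 else 0) * (if l = p.1.1 then 1 else 0) := by
    intro k l
    rw [symLin_apply, Pi.single_apply]
    have h0 : 0 ≤ (if k = p.1.1 then (1 : ℝ) else 0) * (if l = p.1.2 then 1 else 0) := by
      positivity
    have h0' : 0 ≤ (if k = p.1.2 then (1 : ℝ) else 0) * (if l = p.1.1 then 1 else 0) := by
      positivity
    by_cases h : upper k l = p
    · rw [if_pos h]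
      subst h
      rcases le_total k l with hkl | hkl
      · simp only [upper, min_eq_left hkl, max_eq_right hkl, if_true] at h0' ⊢
        simpa using h0'
      · simp only [upper, min_eq_right hkl, max_eq_left hkl, if_true] at h0 ⊢
        simpa using h0
    · rw [if_neg h]
      simpa using add_nonneg h0 h0'
  refine (Finset.sum_le_sum fun k _ => Finset.sum_le_sum fun l _ => h1 k l).trans ?_
  simp [Finset.sum_add_distrib]
  norm_num

lemma norm_mul_symLin_single_mul_le {P Q : Matrix (Fin N) (Fin N) ℂ} {a b : ℝ}
    (hP : ∀ i j, ‖P i j‖ ≤ a) (hQ : ∀ i j, ‖Q i j‖ ≤ b) (p : UpperIndex N) (i j : Fin N) :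
    ‖(P * symLin N (Pi.single p 1) * Q) i j‖ ≤ 2 * (a * b) := by
  have ha : 0 ≤ a := (norm_nonneg _).trans (hP i j)
  have hb : 0 ≤ b := (norm_nonneg _).trans (hQ i j)
  have h1 : (P * symLin N (Pi.single p 1) * Q) i j =
      ∑ l, ∑ k, P i k * symLin N (Pi.single p 1) k l * Q l j := by
    simp_rw [Matrix.mul_apply, Finset.sum_mul]
  rw [h1, Finset.sum_comm]
  have h2 : ∀ k l, ‖P i k * symLin N (Pi.single p 1) k l * Q l j‖ ≤
      a * b * ‖symLin N (Pi.single p 1) k l‖ := by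
    intro k l
    rw [norm_mul, norm_mul]
    calc ‖P i k‖ * ‖symLin N (Pi.single p 1) k l‖ * ‖Q l j‖
        ≤ a * ‖symLin N (Pi.single p 1) k l‖ * b := by
          gcongr
          · exact hP i k
          · exact hQ l j
      _ = _ := by ring
  calc ‖∑ k, ∑ l, P i k * symLin N (Pi.single p 1) k l * Q l j‖
      ≤ ∑ k, ∑ l, a * b * ‖symLin N (Pi.single p 1) k l‖ :=
        (norm_sum_le _ _).trans (Finset.sum_le_sum fun k _ =>
          (norm_sum_le _ _).trans (Finset.sum_le_sum fun l _ => h2 k l))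
    _ = a * b * ∑ k, ∑ l, ‖symLin N (Pi.single p 1) k l‖ := by simp_rw [Finset.mul_sum]
    _ ≤ a * b * 2 := mul_le_mul_of_nonneg_left (sum_norm_symLin_single_le p) (by positivity)
    _ = _ := by ring

/-- If the resolvent entries are at most `Γ`, changing one entry of the matrix by much less than
`1 / Γ` does not change this bound much. -/
lemma green_perturb {z : ℂ} (hz : 0 < z.im) (h : UpperIndex N → ℝ) {Γ x : ℝ}
    (hΓ : ∀ i j, ‖green z h i j‖ ≤ Γ) (hx : 4 * (|x| * Γ) ≤ 1) (p : UpperIndex N) (i j : Fin N) :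
    ‖green z (h + x • Pi.single p 1) i j‖ ≤ 2 * Γ ∧
      ‖green z (h + x • Pi.single p 1) i j - green z h i j‖ ≤ 4 * |x| * Γ ^ 2 := by
  set h' := h + x • (Pi.single p 1 : UpperIndex N → ℝ) with hh'
  have hΓ0 : 0 ≤ Γ := (norm_nonneg _).trans (hΓ i j)
  have key : ∀ M : ℝ, (∀ i j, ‖green z h' i j‖ ≤ M) → ∀ i j,
      ‖green z h' i j - green z h i j‖ ≤ 2 * |x| * (M * Γ) := by
    intro M hM i j
    have h1 : green z h' - green z h =
        (-x) • (green z h' * symLin N (Pi.single p 1) * green z h) := by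
      rw [green_sub_green hz, show h - h' = (-x) • (Pi.single p 1 : UpperIndex N → ℝ) by
        rw [hh']; simp, map_smul, Matrix.mul_smul, Matrix.smul_mul]
    rw [← Matrix.sub_apply, h1, Matrix.smul_apply, norm_smul, Real.norm_eq_abs, abs_neg]
    have := mul_le_mul_of_nonneg_left (norm_mul_symLin_single_mul_le hM hΓ p i j) (abs_nonneg x)
    linarith
  -- The identity bounds the largest perturbed entry by `Γ` plus half of itself.
  obtain ⟨q, -, hq⟩ := Finset.exists_max_image (Finset.univ : Finset (Fin N × Fin N))
    (fun q => ‖green z h' q.1 q.2‖) ⟨(i, j), Finset.mem_univ _⟩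
  have hmax : ∀ i j, ‖green z h' i j‖ ≤ ‖green z h' q.1 q.2‖ := fun i j =>
    hq (i, j) (Finset.mem_univ _)
  have h2 : ‖green z h' q.1 q.2‖ ≤ 2 * Γ := by
    have h3 := key _ hmax q.1 q.2
    have h4 := norm_sub_norm_le (green z h' q.1 q.2) (green z h q.1 q.2)
    have h5 := hΓ q.1 q.2
    nlinarith [norm_nonneg (green z h' q.1 q.2)]
  refine ⟨(hmax i j).trans h2, (key _ (fun i j => (hmax i j).trans h2) i j).trans (le_of_eq ?_)⟩
  ring

end Resolvent

/-- The product rule for `G (V G) ^ (k + 1)` when `G' = -G V G`. -/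
lemma smul_mul_pow_identity {A : Type*} [Ring A] [Algebra ℝ A] (G V : A) (k : ℕ) :
    (-(k + 1 : ℝ) • (G * (V * G) ^ (k + 1))) * (V * G) + G * (V * G) ^ k * (V * -(G * V * G)) =
      -((k + 1 : ℕ) + 1 : ℝ) • (G * (V * G) ^ (k + 1 + 1)) := by
  have e1 : G * (V * G) ^ (k + 1) * (V * G) = G * (V * G) ^ (k + 1 + 1) := by
    simp [pow_succ, mul_assoc]
  have e2 : G * (V * G) ^ k * (V * -(G * V * G)) = -(G * (V * G) ^ (k + 1 + 1)) := by
    simp [pow_succ, mul_assoc]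
  rw [smul_mul_assoc, e1, e2, neg_smul, neg_smul, add_smul ((k + 1 : ℕ) : ℝ), one_smul, neg_add]
  push_cast
  rfl

section ResolventDeriv

open scoped Matrix.Norms.Operator

variable {N : ℕ}

lemma isUnit_shift {z : ℂ} (hz : 0 < z.im) (h : UpperIndex N → ℝ) :
    IsUnit (symLin N h - z • (1 : Matrix (Fin N) (Fin N) ℂ)) :=
  (Matrix.isUnit_iff_isUnit_det _).2 (isUnit_det_shift hz h)

lemma contDiff_green_apply {z : ℂ} (hz : 0 < z.im) {n : ℕ} (i j : Fin N) :
    ContDiff ℝ n fun h : UpperIndex N → ℝ => green z h i j := by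
  have h1 : ContDiff ℝ n fun h : UpperIndex N → ℝ =>
      symLin N h - z • (1 : Matrix (Fin N) (Fin N) ℂ) :=
    (LinearMap.toContinuousLinearMap (symLin N)).contDiff.sub contDiff_const
  have h2 : ContDiff ℝ n fun h : UpperIndex N → ℝ => green z h := by
    rw [contDiff_iff_contDiffAt]
    intro h
    obtain ⟨u, hu⟩ := isUnit_shift hz h
    have h3 : ContDiffAt ℝ n Ring.inverse (symLin N h - z • (1 : Matrix (Fin N) (Fin N) ℂ)) := by
      rw [← hu]; exact contDiffAt_ringInverse ℝ u
    have h4 := h3.comp h h1.contDiffAt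
    refine h4.congr_of_eventuallyEq (Filter.Eventually.of_forall fun h' => ?_)
    simp [green, Matrix.nonsing_inv_eq_ringInverse]
  exact (LinearMap.toContinuousLinearMap
    (Matrix.entryLinearMap ℝ ℂ i j)).contDiff.comp h2

lemma hasDerivAt_green_line {z : ℂ} (hz : 0 < z.im) (h v : UpperIndex N → ℝ) (x : ℝ) :
    HasDerivAt (fun y : ℝ => green z (h + y • v))
      (-(green z (h + x • v) * symLin N v * green z (h + x • v))) x := by
  obtain ⟨u, hu⟩ := isUnit_shift hz (h + x • v)
  have h1 : HasDerivAt (fun y : ℝ => symLin N (h + y • v) -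
      z • (1 : Matrix (Fin N) (Fin N) ℂ)) (symLin N v) x := by
    have : HasDerivAt (fun y : ℝ => symLin N h + y • symLin N v -
        z • (1 : Matrix (Fin N) (Fin N) ℂ)) (symLin N v) x := by
      have h0 := (((hasDerivAt_id x).smul_const (symLin N v)).const_add (symLin N h)).sub_const
        (z • (1 : Matrix (Fin N) (Fin N) ℂ))
      rwa [one_smul] at h0
    refine this.congr_of_eventuallyEq (Filter.Eventually.of_forall fun y => ?_)
    simp
  have h2 := hasFDerivAt_ringInverse (𝕜 := ℝ) u
  rw [hu] at h2
  have h3 := h2.comp_hasDerivAt x h1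
  have h4 : green z (h + x • v) = ↑u⁻¹ := by
    rw [green, Matrix.nonsing_inv_eq_ringInverse, ← hu, Ring.inverse_unit]
  rw [h4]
  refine (h3.congr_of_eventuallyEq (Filter.Eventually.of_forall fun y => ?_)).congr_deriv ?_
  · simp only [green, Matrix.nonsing_inv_eq_ringInverse, Function.comp_apply]
  · simp only [neg_apply, ContinuousLinearMap.mulLeftRight_apply]

lemma hasDerivAt_green_pow {z : ℂ} (hz : 0 < z.im) (h v : UpperIndex N → ℝ) (k : ℕ) (x : ℝ) :
    HasDerivAt (fun y : ℝ => green z (h + y • v) * (symLin N v * green z (h + y • v)) ^ k)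
      (-(k + 1 : ℝ) • (green z (h + x • v) * (symLin N v * green z (h + x • v)) ^ (k + 1))) x := by
  induction k with
  | zero => simpa [mul_assoc] using hasDerivAt_green_line hz h v x
  | succ k ih =>
    have h1 := ih.mul (((hasDerivAt_green_line hz h v x).const_mul (symLin N v)))
    refine (h1.congr_of_eventuallyEq (Filter.Eventually.of_forall fun y => ?_)).congr_deriv ?_
    · simp [pow_succ, mul_assoc]
    · exact smul_mul_pow_identity _ _ k

lemma hasDerivAt_green_pow_apply {z : ℂ} (hz : 0 < z.im) (h v : UpperIndex N → ℝ) (k : ℕ) (x : ℝ)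
    (θ : ℂ →L[ℝ] ℝ) (i j : Fin N) :
    HasDerivAt
      (fun y : ℝ => θ ((green z (h + y • v) * (symLin N v * green z (h + y • v)) ^ k) i j))
      (-(k + 1 : ℝ) *
        θ ((green z (h + x • v) * (symLin N v * green z (h + x • v)) ^ (k + 1)) i j)) x := by
  have h2 := (θ.comp (LinearMap.toContinuousLinearMap
    (Matrix.entryLinearMap ℝ ℂ i j))).hasFDerivAt.comp_hasDerivAt x (hasDerivAt_green_pow hz h v k x)
  refine h2.congr_deriv ?_
  change θ (-(k + 1 : ℝ) • _) = _
  rw [map_smul]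
  rfl

end ResolventDeriv

lemma norm_green_pow_le {N : ℕ} {z : ℂ} {h : UpperIndex N → ℝ} {Γ : ℝ}
    (hΓ : ∀ i j, ‖green z h i j‖ ≤ Γ) (p : UpperIndex N) (k : ℕ) (i j : Fin N) :
    ‖(green z h * (symLin N (Pi.single p 1) * green z h) ^ k) i j‖ ≤ 2 ^ k * Γ ^ (k + 1) := by
  induction k generalizing i j with
  | zero => simpa using hΓ i j
  | succ k ih =>
    have e1 : green z h * (symLin N (Pi.single p 1) * green z h) ^ (k + 1) =
      green z h * (symLin N (Pi.single p 1) * green z h) ^ k * symLin N (Pi.single p 1) *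
        green z h := by
      simp [pow_succ, mul_assoc]
    rw [e1]
    refine (norm_mul_symLin_single_mul_le ih hΓ p i j).trans (le_of_eq ?_)
    ring

/-! ### Functions of resolvent entries -/

section Observable

variable {m N : ℕ}

/-- The real part for `s ∈ S` and the imaginary part for `s ∉ S`. -/
def reIm (S : Finset (Fin m)) (s : Fin m) : ℂ →L[ℝ] ℝ :=
  if s ∈ S then Complex.reCLM else Complex.imCLM

lemma abs_reIm_le (S : Finset (Fin m)) (s : Fin m) (w : ℂ) : |reIm S s w| ≤ ‖w‖ := by
  unfold reIm
  split_ifs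
  · exact Complex.abs_re_le_norm w
  · exact Complex.abs_im_le_norm w

/-- The vector of real or imaginary parts of resolvent entries, as a function of the upper
triangle of the matrix. -/
def obs (z : Fin m → ℂ) (S : Finset (Fin m)) (i j : Fin m → Fin N) (h : UpperIndex N → ℝ) :
    Fin m → ℝ :=
  fun s => reIm S s (green (z s) h (i s) (j s))

variable {z : Fin m → ℂ} (hz : ∀ s, 0 < (z s).im) (S : Finset (Fin m)) (i j : Fin m → Fin N)

include hz in
lemma contDiff_obs (n : ℕ) : ContDiff ℝ n (obs z S i j) := by
  rw [contDiff_pi]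
  intro s
  exact (reIm S s).contDiff.comp (contDiff_green_apply (hz s) (i s) (j s))

lemma norm_obs_le {h : UpperIndex N → ℝ} {Γ : ℝ} (hΓ0 : 0 ≤ Γ)
    (hΓ : ∀ s a b, ‖green (z s) h a b‖ ≤ Γ) : ‖obs z S i j h‖ ≤ Γ := by
  rw [pi_norm_le_iff_of_nonneg hΓ0]
  intro s
  exact (abs_reIm_le S s _).trans (hΓ s _ _)

include hz in
lemma iteratedDeriv_obs_line (h : UpperIndex N → ℝ) (v : UpperIndex N → ℝ) (k : ℕ) :
    iteratedDeriv k (fun x : ℝ => obs z S i j (h + x • v)) = fun x s =>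
      (-1 : ℝ) ^ k * (k.factorial : ℝ) * reIm S s ((green (z s) (h + x • v) *
        (symLin N v * green (z s) (h + x • v)) ^ k) (i s) (j s)) := by
  induction k with
  | zero =>
    funext x s
    simp [obs]
  | succ k ih =>
    rw [iteratedDeriv_succ, ih]
    funext x
    refine HasDerivAt.deriv ?_
    rw [hasDerivAt_pi]
    intro s
    have h3 := (hasDerivAt_green_pow_apply (hz s) h v k x (reIm S s) (i s) (j s)).const_mul
      ((-1 : ℝ) ^ k * (k.factorial : ℝ))
    refine h3.congr_deriv ?_
    rw [Nat.factorial_succ, pow_succ]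
    push_cast
    ring

include hz in
lemma norm_iteratedDeriv_obs_line_le {h : UpperIndex N → ℝ} {Γ : ℝ} (hΓ1 : 1 ≤ Γ)
    (hΓ : ∀ s a b, ‖green (z s) h a b‖ ≤ Γ) (p : UpperIndex N) {k : ℕ} (hk1 : 1 ≤ k)
    (hk4 : k ≤ 4) :
    ‖iteratedDeriv k (fun x : ℝ => obs z S i j (h + x • Pi.single p 1)) 0‖ ≤
      (48 * Γ ^ 2) ^ k := by
  rw [iteratedDeriv_obs_line hz, pi_norm_le_iff_of_nonneg (by positivity)]
  intro s
  beta_reduce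
  rw [zero_smul, add_zero, norm_mul, norm_mul, norm_pow, norm_neg, norm_one, one_pow, one_mul]
  have h1 := (abs_reIm_le S s _).trans (norm_green_pow_le (hΓ s) p k (i s) (j s))
  have h2 : (k.factorial : ℝ) ≤ 24 ^ k := by
    interval_cases k <;> norm_num [Nat.factorial]
  have h3 : Γ ^ (k + 1) ≤ (Γ ^ 2) ^ k := by
    rw [← pow_mul]
    exact pow_le_pow_right₀ hΓ1 (by omega)
  rw [Real.norm_eq_abs, Real.norm_eq_abs, abs_of_nonneg (Nat.cast_nonneg _)]
  calc (k.factorial : ℝ) * _ ≤ 24 ^ k * (2 ^ k * (Γ ^ 2) ^ k) :=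
        mul_le_mul h2 (h1.trans (mul_le_mul_of_nonneg_left h3 (by positivity)))
          (abs_nonneg _) (by positivity)
    _ = _ := by rw [← mul_pow, ← mul_pow, ← mul_assoc]; norm_num

include hz in
/-- The derivatives of a function of resolvent entries with respect to one matrix entry. -/
lemma abs_dirDeriv_iterate_le {F : (Fin m → ℝ) → ℝ} (hF : ContDiff ℝ 4 F)
    {h : UpperIndex N → ℝ} {Γ C : ℝ} (hΓ1 : 1 ≤ Γ) (hΓ : ∀ s a b, ‖green (z s) h a b‖ ≤ Γ)
    (p : UpperIndex N) (hC : ∀ r ≤ 4, ‖iteratedFDeriv ℝ r F (obs z S i j h)‖ ≤ C) {k : ℕ}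
    (hk4 : k ≤ 4) :
    |(dirDeriv (Pi.single p 1))^[k] (fun h => F (obs z S i j h)) h| ≤
      24 * C * (48 * Γ ^ 2) ^ 4 := by
  have hC0 : 0 ≤ C := (norm_nonneg _).trans (hC 0 (by norm_num))
  have hcd : ContDiff ℝ (4 : ℕ) fun h => F (obs z S i j h) :=
    (show ContDiff ℝ (4 : ℕ) F by exact_mod_cast hF).comp (contDiff_obs hz S i j 4)
  have h1 := congrFun (iteratedDeriv_line (hcd.of_le (by exact_mod_cast hk4) :
    ContDiff ℝ k _) h (Pi.single p (1 : ℝ))) 0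
  rw [zero_smul, add_zero] at h1
  rw [← h1]
  have hg : ContDiff ℝ 4 fun x : ℝ => obs z S i j (h + x • Pi.single p 1) :=
    (show ContDiff ℝ 4 (obs z S i j) by exact_mod_cast contDiff_obs hz S i j 4).comp
      (contDiff_const.add (contDiff_id.smul contDiff_const))
  have h2 := norm_iteratedFDeriv_comp_le (n := k) hF hg (by exact_mod_cast hk4) (0 : ℝ)
    (C := C) (D := 48 * Γ ^ 2)
    (fun r hr => by
      rw [zero_smul, add_zero]
      exact hC r (hr.trans hk4))
    (fun r hr1 hr => by
      rw [norm_iteratedFDeriv_eq_norm_iteratedDeriv]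
      exact norm_iteratedDeriv_obs_line_le hz S i j hΓ1 hΓ p hr1 (hr.trans hk4))
  rw [norm_iteratedFDeriv_eq_norm_iteratedDeriv] at h2
  refine h2.trans ?_
  have h3 : (k.factorial : ℝ) ≤ 24 := by
    interval_cases k <;> norm_num [Nat.factorial]
  have h4 : (48 * Γ ^ 2) ^ k ≤ (48 * Γ ^ 2) ^ 4 :=
    pow_le_pow_right₀ (by nlinarith) hk4
  gcongr

/-- The sum of the absolute values of the partial derivatives of `F` of orders up to `n + 3`,
those of higher order being damped by powers of `Δ`. -/
def taylorSum (F : (Fin m → ℝ) → ℝ) (Δ : ℝ) (n : ℕ) (y : Fin m → ℝ) : ℝ :=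
  ∑ r ∈ Finset.range 5, ∑ l ∈ Finset.range n, Δ ^ l *
    ∑ w : Fin (r + l) → Fin m, |multiDeriv (wordCount w) F y|

lemma taylorSum_nonneg (F : (Fin m → ℝ) → ℝ) {Δ : ℝ} (hΔ : 0 ≤ Δ) (n : ℕ) (y : Fin m → ℝ) :
    0 ≤ taylorSum F Δ n y := by
  unfold taylorSum
  positivity

lemma norm_iteratedFDeriv_le_pow {F : (Fin m → ℝ) → ℝ} {k n : ℕ} (hF : ContDiff ℝ n F)
    (hk : k ≤ n) {y : Fin m → ℝ} {B : ℝ}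
    (hB : ∀ w : Fin k → Fin m, |multiDeriv (wordCount w) F y| ≤ B) :
    ‖iteratedFDeriv ℝ k F y‖ ≤ (m : ℝ) ^ k * B := by
  refine (norm_iteratedFDeriv_le_sum hF hk y).trans ?_
  refine (Finset.sum_le_sum fun w _ => hB w).trans (le_of_eq ?_)
  simp

include hz in
/-- If the resolvent entries at `h` are at most `Γ`, then the derivatives at all matrices obtained
from `h` by a small change of one entry are controlled by the derivatives of `F` at `h` itself. -/
lemma abs_dirDeriv_iterate_perturb_le {F : (Fin m → ℝ) → ℝ} {n : ℕ}
    (hF : ContDiff ℝ (4 + n : ℕ) F) (hm : 0 < m)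
    {h : UpperIndex N → ℝ} {Γ B r : ℝ} (hΓ1 : 1 ≤ Γ) (hΓ : ∀ s a b, ‖green (z s) h a b‖ ≤ Γ)
    (hB : ∀ k ≤ 4 + n, ∀ w : Fin k → Fin m, ∀ y : Fin m → ℝ, (∀ s, |y s| ≤ 2 * Γ) →
      |multiDeriv (wordCount w) F y| ≤ B)
    (hr : 4 * (r * Γ) ≤ 1) (hrem : (m * (4 * r * Γ ^ 2)) ^ n * B ≤ 1)
    (p : UpperIndex N) {x : ℝ} (hx : |x| ≤ r) {k : ℕ} (hk4 : k ≤ 4) :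
    |(dirDeriv (Pi.single p 1))^[k] (fun h => F (obs z S i j h)) (h + x • Pi.single p 1)| ≤
      24 * (48 * (2 * Γ) ^ 2) ^ 4 *
        (taylorSum F (4 * r * Γ ^ 2) n (obs z S i j h) + (m : ℝ) ^ 4) := by
  have hr0 : 0 ≤ r := (abs_nonneg x).trans hx
  have hm1 : (1 : ℝ) ≤ m := by exact_mod_cast hm
  set Δ := 4 * r * Γ ^ 2 with hΔdef
  have hΔ0 : 0 ≤ Δ := by positivity
  have hΔΓ : Δ ≤ Γ := by nlinarith
  have hxΓ : 4 * (|x| * Γ) ≤ 1 := by nlinarith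
  set y := obs z S i j h
  set y' := obs z S i j (h + x • Pi.single p 1)
  have hy : ‖y‖ ≤ Γ := norm_obs_le S i j (by linarith) hΓ
  have hyy : ‖y' - y‖ ≤ Δ := by
    rw [pi_norm_le_iff_of_nonneg hΔ0]
    intro s
    rw [Pi.sub_apply]
    change |reIm S s _ - reIm S s _| ≤ _
    rw [← map_sub]
    refine (abs_reIm_le S s _).trans ?_
    refine ((green_perturb (hz s) h (hΓ s) hxΓ p (i s) (j s)).2).trans ?_
    rw [hΔdef]
    gcongr
  have hB0 : 0 ≤ B := (abs_nonneg _).trans (hB 0 (by omega) Fin.elim0 0 (fun s => by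
    simp; linarith))
  have hC : ∀ q ≤ 4, ‖iteratedFDeriv ℝ q F y'‖ ≤ taylorSum F Δ n y + (m : ℝ) ^ 4 := by
    intro q hq
    have h1 := norm_iteratedFDeriv_le_geometric (n := n) q (hF.of_le (by norm_cast; omega)) y hΔ0
      (B := (m : ℝ) ^ (q + n) * B) (fun x hx => by
        refine norm_iteratedFDeriv_le_pow hF (by omega) fun w => hB _ (by omega) w x fun s => ?_
        have h2 : ‖x‖ ≤ ‖x - y‖ + ‖y‖ := by simpa using norm_add_le (x - y) y
        have h3 := norm_le_pi_norm x s
        rw [Real.norm_eq_abs] at h3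
        linarith) y' hyy
    refine h1.trans (add_le_add ?_ ?_)
    · have h2 : ∑ l ∈ Finset.range n, Δ ^ l * ‖iteratedFDeriv ℝ (q + l) F y‖ ≤
          ∑ l ∈ Finset.range n, Δ ^ l *
            ∑ w : Fin (q + l) → Fin m, |multiDeriv (wordCount w) F y| := by
        refine Finset.sum_le_sum fun l hl => ?_
        have hl' := Finset.mem_range.1 hl
        exact mul_le_mul_of_nonneg_left (norm_iteratedFDeriv_le_sum hF (by omega) y)
          (by positivity)
      refine h2.trans ?_
      exact Finset.single_le_sum (f := fun q => ∑ l ∈ Finset.range n, Δ ^ l *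
            ∑ w : Fin (q + l) → Fin m, |multiDeriv (wordCount w) F y|)
        (fun _ _ => by positivity) (Finset.mem_range.2 (by omega))
    · calc Δ ^ n * ((m : ℝ) ^ (q + n) * B) = (m : ℝ) ^ q * ((m * Δ) ^ n * B) := by
            rw [pow_add, mul_pow]; ring
        _ ≤ (m : ℝ) ^ 4 * 1 := by
            refine mul_le_mul (pow_le_pow_right₀ hm1 hq) hrem (by positivity) (by positivity)
        _ = _ := mul_one _
  have h4 := abs_dirDeriv_iterate_le hz S i j (hF.of_le (by norm_cast; omega))
    (show 1 ≤ 2 * Γ by linarith)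
    (fun s a b => (green_perturb (hz s) h (hΓ s) hxΓ p a b).1) p hC hk4
  refine h4.trans (le_of_eq ?_)
  ring

end Observable

/-! ### Product measures -/

section Product

variable {ι : Type*} [Fintype ι] (μ : ι → Measure ℝ)
  [∀ q, IsProbabilityMeasure (μ q)]

/-- Replacing the coordinates in `T` by those of an independent copy preserves a product law. -/
lemma measurePreserving_piecewise [DecidableEq ι] (T : Finset ι) :
    MeasurePreserving (fun x : (ι → ℝ) × (ι → ℝ) => T.piecewise x.2 x.1)
      ((Measure.pi μ).prod (Measure.pi μ)) (Measure.pi μ) := by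
  have hmeas : Measurable (fun x : (ι → ℝ) × (ι → ℝ) => T.piecewise x.2 x.1) := by
    refine measurable_pi_lambda _ fun q => ?_
    by_cases hq : q ∈ T
    · simp only [Finset.piecewise, hq, if_true]; fun_prop
    · simp only [Finset.piecewise, hq, if_false]; fun_prop
  refine ⟨hmeas, (Measure.pi_eq fun s hs => ?_).symm⟩
  rw [Measure.map_apply hmeas (MeasurableSet.univ_pi hs)]
  have h1 : (fun x : (ι → ℝ) × (ι → ℝ) => T.piecewise x.2 x.1) ⁻¹' (Set.univ.pi s) =
      (Set.univ.pi fun q => if q ∈ T then Set.univ else s q) ×ˢ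
        (Set.univ.pi fun q => if q ∈ T then s q else Set.univ) := by
    ext x
    simp only [Set.mem_preimage, Set.mem_pi, Set.mem_univ, true_implies, Set.mem_prod]
    rw [← forall_and]
    refine forall_congr' fun q => ?_
    by_cases hq : q ∈ T <;> simp [hq]
  rw [h1, Measure.prod_prod, Measure.pi_pi, Measure.pi_pi, ← Finset.prod_mul_distrib]
  refine Finset.prod_congr rfl fun q _ => ?_
  by_cases hq : q ∈ T <;> simp [hq]

lemma integral_eq_integral_piecewise [DecidableEq ι] (T : Finset ι) {Φ : (ι → ℝ) → ℝ}
    (hΦ : Integrable Φ (Measure.pi μ)) :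
    ∫ x, Φ x ∂(Measure.pi μ) =
      ∫ x, ∫ y, Φ (T.piecewise y x) ∂(Measure.pi μ) ∂(Measure.pi μ) := by
  have h := measurePreserving_piecewise μ T
  rw [← h.map_eq] at hΦ
  have h1 := hΦ.comp_measurable h.measurable
  rw [← integral_prod (fun x : (ι → ℝ) × (ι → ℝ) => Φ (T.piecewise x.2 x.1)) h1]
  conv_lhs => rw [← h.map_eq]
  exact integral_map h.measurable.aemeasurable hΦ.aestronglyMeasurable

lemma integral_eval_comp (q : ι) {f : ℝ → ℝ} (hf : AEStronglyMeasurable f (μ q)) :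
    ∫ x, f (x q) ∂(Measure.pi μ) = ∫ y, f y ∂(μ q) := by
  have h := measurePreserving_eval μ q
  rw [← h.map_eq] at hf ⊢
  rw [integral_map h.measurable.aemeasurable hf]

lemma integrable_eval_comp (q : ι) {f : ℝ → ℝ} (hf : Integrable f (μ q)) :
    Integrable (fun x => f (x q)) (Measure.pi μ) := by
  have h := measurePreserving_eval μ q
  rw [← h.map_eq] at hf
  exact hf.comp_measurable h.measurable

lemma integral_eval_mul_eval {q q' : ι} (hq : q ≠ q') {f g : ℝ → ℝ} (hf : Measurable f)
    (hg : Measurable g) :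
    ∫ x, f (x q) * g (x q') ∂(Measure.pi μ) = (∫ y, f y ∂(μ q)) * ∫ y, g y ∂(μ q') := by
  have h1 : IndepFun (fun x : ι → ℝ => x q) (fun x => x q') (Measure.pi μ) :=
    (iIndepFun_pi (X := fun _ y => y) (μ := μ) fun _ => aemeasurable_id).indepFun hq
  have h2 := h1.comp hf hg
  have h3 := h2.integral_fun_mul_eq_mul_integral
    (hf.comp (measurable_pi_apply q)).aestronglyMeasurable
    (hg.comp (measurable_pi_apply q')).aestronglyMeasurable
  rw [← integral_eval_comp μ q hf.aestronglyMeasurable,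
    ← integral_eval_comp μ q' hg.aestronglyMeasurable]
  exact h3

lemma ae_eval {q : ι} {p : ℝ → Prop} (hp : ∀ᵐ y ∂(μ q), p y) : ∀ᵐ x ∂(Measure.pi μ), p (x q) :=
  (measurePreserving_eval μ q).quasiMeasurePreserving.ae hp

/-- Conditioning a product law on a box amounts to conditioning the factors. -/
lemma cond_pi (s : ι → Set ℝ) (hs : ∀ q, MeasurableSet (s q)) :
    cond (Measure.pi μ) (Set.univ.pi s) = 0 ∨
      ((∀ q, μ q (s q) ≠ 0) ∧
        cond (Measure.pi μ) (Set.univ.pi s) = Measure.pi fun q => cond (μ q) (s q)) := by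
  by_cases h : ∀ q, μ q (s q) ≠ 0
  · refine Or.inr ⟨h, ?_⟩
    have : ∀ q, IsProbabilityMeasure (cond (μ q) (s q)) := fun q =>
      cond_isProbabilityMeasure (h q)
    refine (Measure.pi_eq fun t ht => ?_).symm
    rw [cond_apply (MeasurableSet.univ_pi hs), ← Set.pi_inter_distrib, Measure.pi_pi,
      Measure.pi_pi, ENNReal.prod_inv_distrib fun a _ b _ _ => Or.inl (h a),
      ← Finset.prod_mul_distrib]
    refine Finset.prod_congr rfl fun q _ => ?_
    rw [cond_apply (hs q)]
  · left
    push Not at h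
    obtain ⟨q, hq⟩ := h
    refine cond_eq_zero_of_meas_eq_zero ?_
    rw [Measure.pi_pi]
    exact Finset.prod_eq_zero (Finset.mem_univ q) hq

end Product

/-! ### Gaussian integration by parts -/

lemma integral_id_mul_gaussianReal {v : NNReal} (hv : v ≠ 0) {φ φ' : ℝ → ℝ}
    (hφ : ∀ x, HasDerivAt φ (φ' x) x) (hφ' : Continuous φ') {C : ℝ} (hC : ∀ x, |φ x| ≤ C)
    (hC' : ∀ x, |φ' x| ≤ C) :
    ∫ x, x * φ x ∂(gaussianReal 0 v) = v * ∫ x, φ' x ∂(gaussianReal 0 v) := by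
  have hv' : (0 : ℝ) < v := by positivity
  set p := gaussianPDFReal 0 v with hp
  have hpd : ∀ x, HasDerivAt p (-(x / v) * p x) x := by
    intro x
    have h1 : HasDerivAt (fun x : ℝ => -(x - 0) ^ 2 / (2 * v)) (-(x / v)) x := by
      have := (((hasDerivAt_id x).sub_const 0).pow 2).neg.div_const (2 * (v : ℝ))
      refine this.congr_deriv ?_
      simp
      field_simp
    have h2 := (h1.exp).const_mul ((Real.sqrt (2 * Real.pi * v))⁻¹)
    rw [hp, gaussianPDFReal_def]
    refine h2.congr_deriv ?_
    ring
  have hpc : Continuous p := continuous_iff_continuousAt.2 fun x => (hpd x).continuousAt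
  have hpi : Integrable p := integrable_gaussianPDFReal 0 v
  have hxp : Integrable fun x => x * p x := by
    have h1 := (integrable_mul_exp_neg_mul_sq (b := 1 / (2 * (v : ℝ))) (by positivity)).const_mul
      ((Real.sqrt (2 * Real.pi * v))⁻¹)
    refine h1.congr (Filter.Eventually.of_forall fun x => ?_)
    simp only [hp, gaussianPDFReal_def]
    rw [show -(x - 0) ^ 2 / (2 * (v : ℝ)) = -(1 / (2 * (v : ℝ))) * x ^ 2 by ring]
    ring
  have hφc : Continuous φ := continuous_iff_continuousAt.2 fun x => (hφ x).continuousAt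
  have hb : ∀ {f g : ℝ → ℝ}, Continuous f → (∀ x, |f x| ≤ C) → Integrable g →
      Integrable (f * g) := fun {f g} hf hfC hg =>
    hg.bdd_mul hf.aestronglyMeasurable (Filter.Eventually.of_forall hfC)
  have key := integral_mul_deriv_eq_deriv_mul_of_integrable (u := φ) (v := p) (u' := φ')
    (v' := fun x => -(x / v) * p x) (fun x _ => hφ x) (fun x _ => hpd x)
    (hb hφc hC ((hxp.const_mul (-(v : ℝ)⁻¹)).congr (Filter.Eventually.of_forall fun x => by
      change _ = -(x / v) * p x
      ring)))
    (hb hφ' hC' hpi) (hb hφc hC hpi)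
  rw [integral_gaussianReal_eq_integral_smul hv, integral_gaussianReal_eq_integral_smul hv]
  simp only [smul_eq_mul]
  have h1 : ∫ x, p x * φ' x = ∫ x, φ' x * p x := by simp only [mul_comm]
  have h2 : ∫ x, p x * (x * φ x) = -(v * ∫ x, φ x * (-(x / v) * p x)) := by
    rw [← integral_const_mul, ← integral_neg]
    refine integral_congr_ae (Filter.Eventually.of_forall fun x => ?_)
    simp only
    field_simp
  rw [h2, key, h1]
  ring

/-! ### Truncated moments of a heavy-tailed law -/

/-- The layer cake formula applied to the law restricted to `|x| < r`. -/
lemma lintegral_sq_truncated_le {μ : Measure ℝ} [IsFiniteMeasure μ] {α K : ℝ} (hα : α < 2)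
    (hK : 0 ≤ K) (htail : ∀ s : ℝ, 0 < s → μ.real {x | s ≤ |x|} ≤ K * s ^ (-α)) {r : ℝ}
    (hr : 0 < r) :
    ∫⁻ x in {x | |x| < r}, ENNReal.ofReal (x ^ 2) ∂μ ≤
      ENNReal.ofReal (2 * K / (2 - α) * r ^ (2 - α)) := by
  have hs : MeasurableSet {x : ℝ | |x| < r} := measurableSet_lt measurable_norm measurable_const
  have h1 := lintegral_rpow_eq_lintegral_meas_le_mul (μ := μ.restrict {x | |x| < r})
    (f := fun x => |x|) (Filter.Eventually.of_forall fun x => abs_nonneg x)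
    measurable_norm.aemeasurable (p := 2) two_pos
  simp only [Real.rpow_ofNat, sq_abs] at h1
  rw [h1]
  have h2 : ∫⁻ t in Set.Ioi (0 : ℝ), (μ.restrict {x | |x| < r}) {a | t ≤ |a|} *
      ENNReal.ofReal (t ^ ((2 : ℝ) - 1)) ≤
      ∫⁻ t in Set.Ioi (0 : ℝ), (Set.Ioc (0 : ℝ) r).indicator
        (fun t => ENNReal.ofReal (K * t ^ (1 - α))) t := by
    refine setLIntegral_mono' measurableSet_Ioi fun t ht => ?_
    have ht' : (0 : ℝ) < t := ht
    by_cases htr : t ≤ r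
    · rw [Set.indicator_of_mem (show t ∈ Set.Ioc 0 r from ⟨ht', htr⟩)]
      have h3 : (μ.restrict {x | |x| < r}) {a | t ≤ |a|} ≤ ENNReal.ofReal (K * t ^ (-α)) := by
        refine (Measure.restrict_apply_le _ _).trans ?_
        rw [← ofReal_measureReal]
        exact ENNReal.ofReal_le_ofReal (htail t ht')
      refine (mul_le_mul_left h3 _).trans (le_of_eq ?_)
      rw [← ENNReal.ofReal_mul (by positivity), mul_assoc, ← Real.rpow_add ht']
      congr 3
      ring
    · have h3 : (μ.restrict {x | |x| < r}) {a | t ≤ |a|} = 0 := by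
        rw [Measure.restrict_apply (show MeasurableSet {a : ℝ | t ≤ |a|} from
          measurableSet_le measurable_const measurable_norm)]
        have : {a : ℝ | t ≤ |a|} ∩ {x | |x| < r} = ∅ := by
          ext a
          simp only [Set.mem_inter_iff, Set.mem_ofPred_eq, Set.mem_empty_iff_false, iff_false,
            not_and]
          intro h4 h5
          linarith
        rw [this, measure_empty]
      rw [h3, zero_mul]
      exact zero_le
  have h4 : ∫⁻ t in Set.Ioi (0 : ℝ), (Set.Ioc (0 : ℝ) r).indicator
        (fun t => ENNReal.ofReal (K * t ^ (1 - α))) t =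
      ENNReal.ofReal (K * (r ^ (2 - α) / (2 - α))) := by
    rw [setLIntegral_indicator measurableSet_Ioc,
      Set.inter_eq_left.2 (Set.Ioc_subset_Ioi_self)]
    have hint : IntervalIntegrable (fun t : ℝ => K * t ^ (1 - α)) volume 0 r :=
      (intervalIntegral.intervalIntegrable_rpow' (by linarith)).const_mul K
    rw [← ofReal_integral_eq_lintegral_ofReal
      ((intervalIntegrable_iff_integrableOn_Ioc_of_le hr.le).1 hint)
      ((ae_restrict_iff' measurableSet_Ioc).2 (Filter.Eventually.of_forall fun t ht => by
        have := ht.1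
        simp only [Pi.zero_apply]
        positivity)),
      ← intervalIntegral.integral_of_le hr.le, intervalIntegral.integral_const_mul,
      integral_rpow (Or.inl (by linarith))]
    rw [show 1 - α + 1 = 2 - α by ring, Real.zero_rpow (by linarith), sub_zero]
  refine (mul_le_mul_right (h2.trans h4.le) _).trans (le_of_eq ?_)
  rw [← ENNReal.ofReal_mul two_pos.le]
  congr 1
  ring

lemma setIntegral_sq_truncated_le {μ : Measure ℝ} [IsFiniteMeasure μ] {α K : ℝ} (hα : α < 2)
    (hK : 0 ≤ K) (htail : ∀ s : ℝ, 0 < s → μ.real {x | s ≤ |x|} ≤ K * s ^ (-α)) {r : ℝ}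
    (hr : 0 < r) :
    ∫ x in {x | |x| < r}, x ^ 2 ∂μ ≤ 2 * K / (2 - α) * r ^ (2 - α) := by
  rw [integral_eq_lintegral_of_nonneg_ae (Filter.Eventually.of_forall fun x => sq_nonneg x)
    (by fun_prop)]
  refine ENNReal.toReal_le_of_le_ofReal ?_ (lintegral_sq_truncated_le hα hK htail hr)
  have : 0 < 2 - α := by linarith
  positivity

/-! ### The laws of the matrix variables -/

section Laws

lemma isProbabilityMeasure_condLaw (μ : Measure ℝ) [IsFiniteMeasure μ] (s : Set ℝ) :
    IsProbabilityMeasure (condLaw μ s) := by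
  unfold condLaw
  split_ifs with h
  · infer_instance
  · exact cond_isProbabilityMeasure h

lemma measureReal_mul_integral_condLaw (μ : Measure ℝ) [IsFiniteMeasure μ] (s : Set ℝ)
    (f : ℝ → ℝ) : μ.real s * ∫ x, f x ∂(condLaw μ s) = ∫ x in s, f x ∂μ := by
  unfold condLaw
  split_ifs with h
  · rw [Measure.restrict_eq_zero.2 h, measureReal_def, h]
    simp
  · have h1 : μ.real s ≠ 0 := (measureReal_ne_zero_iff (by finiteness)).2 h
    rw [ProbabilityTheory.cond, integral_smul_measure, ENNReal.toReal_inv, smul_eq_mul, ← measureReal_def,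
      mul_inv_cancel_left₀ h1]

lemma ae_condLaw {μ : Measure ℝ} {s : Set ℝ} (hs : MeasurableSet s) {P : ℝ → Prop} (h0 : P 0)
    (h : ∀ x ∈ s, P x) : ∀ᵐ x ∂(condLaw μ s), P x := by
  unfold condLaw
  split_ifs
  · rw [ae_dirac_eq]
    exact h0
  · filter_upwards [ae_cond_mem hs] with x hx using h x hx

lemma condLaw_map_neg {μ : Measure ℝ} (hμ : μ.map (fun x => -x) = μ) {s : Set ℝ}
    (hs : MeasurableSet s) (hsn : ∀ x, -x ∈ s ↔ x ∈ s) :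
    (condLaw μ s).map (fun x => -x) = condLaw μ s := by
  unfold condLaw
  split_ifs
  · rw [Measure.map_dirac' (by fun_prop), neg_zero]
  · ext t ht
    have hpre : s ∩ (fun x => -x) ⁻¹' t = (fun x => -x) ⁻¹' (s ∩ t) := by
      ext x
      simp [hsn]
    rw [Measure.map_apply measurable_neg ht, cond_apply hs, cond_apply hs, hpre,
      ← Measure.map_apply measurable_neg (hs.inter ht), hμ]

lemma integral_odd_eq_zero {μ : Measure ℝ} (hμ : μ.map (fun x => -x) = μ) {f : ℝ → ℝ}
    (hf : Measurable f) (hodd : ∀ x, f (-x) = -f x) : ∫ x, f x ∂μ = 0 := by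
  have h1 : ∫ x, f x ∂μ = ∫ x, f (-x) ∂μ := by
    conv_lhs => rw [← hμ]
    exact integral_map measurable_neg.aemeasurable hf.aestronglyMeasurable
  simp only [hodd, integral_neg] at h1
  linarith

lemma isProbabilityMeasure_bernoulliLaw (p : ℝ) : IsProbabilityMeasure (bernoulliLaw p) := by
  unfold bernoulliLaw
  infer_instance

lemma integral_bernoulliLaw {p : ℝ} (hp : p ∈ Set.Icc (0 : ℝ) 1) (f : ℝ → ℝ) :
    ∫ x, f x ∂(bernoulliLaw p) = p * f 1 + (1 - p) * f 0 := by
  unfold bernoulliLaw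
  rw [integral_bernoulliMeasure, Set.projIcc_of_mem _ hp]
  simp

lemma ae_bernoulliLaw (p : ℝ) : ∀ᵐ x ∂(bernoulliLaw p), x = 0 ∨ x = 1 := by
  have hs : MeasurableSet {x : ℝ | x = 0 ∨ x = 1} := by
    have : {x : ℝ | x = 0 ∨ x = 1} = {0, 1} := by ext; simp
    rw [this]; measurability
  unfold bernoulliLaw
  rw [ae_iff, show {a : ℝ | ¬(a = 0 ∨ a = 1)} = {x : ℝ | x = 0 ∨ x = 1}ᶜ from rfl]
  rw [bernoulliMeasure_apply_of_notMem_of_notMem _ hs.compl] <;> simp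

variable {α ν ρ : ℝ} {κ : Measure (ℝ × ℝ)} (hκ : IsDeformedStable α κ) (N : ℕ)

include hκ in
lemma isProbabilityMeasure_entryLaw : IsProbabilityMeasure (entryLaw α κ N) := by
  have := hκ.isProbabilityMeasure
  exact Measure.isProbabilityMeasure_map (by fun_prop)

include hκ in
lemma entryLaw_map_neg : (entryLaw α κ N).map (fun x => -x) = entryLaw α κ N := by
  unfold entryLaw
  rw [Measure.map_map (by fun_prop) (by fun_prop)]
  have h1 : ((fun x : ℝ => -x) ∘ fun x : ℝ × ℝ => (N : ℝ) ^ (-(1 / α)) * (x.1 + x.2)) =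
      (fun y : ℝ => (N : ℝ) ^ (-(1 / α)) * y) ∘ fun x : ℝ × ℝ => -(x.1 + x.2) := by
    funext x
    simp only [Function.comp_apply]
    ring
  rw [h1, ← Measure.map_map (by fun_prop) (by fun_prop), hκ.symm_sum,
    Measure.map_map (by fun_prop) (by fun_prop)]
  rfl

lemma measurableSet_smallSet : MeasurableSet (smallSet ν N) :=
  measurableSet_lt measurable_norm measurable_const

lemma measurableSet_middleSet : MeasurableSet (middleSet ν ρ N) :=
  (measurableSet_le measurable_const measurable_norm).inter
    (measurableSet_lt measurable_norm measurable_const)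

include hκ in
/-- The tail of the entries of the matrix is at most `K / (N s ^ α)`. -/
lemma entryLaw_tail (hα : 0 < α) : ∃ K > 0, ∀ N : ℕ, 0 < N → ∀ s : ℝ, 0 < s →
    (entryLaw α κ N).real {x | s ≤ |x|} ≤ K / N * s ^ (-α) := by
  obtain ⟨C₁, C₂, -, hC₂, h⟩ := hκ.tail
  have := hκ.isProbabilityMeasure
  refine ⟨C₂, hC₂, fun N hN s hs => ?_⟩
  have hN' : (0 : ℝ) < N := by exact_mod_cast hN
  have hpos : 0 < (N : ℝ) ^ (1 / α) * s := by positivity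
  have h1 := (h _ hpos.le).2
  have hms : MeasurableSet {x : ℝ | s ≤ |x|} := measurableSet_le measurable_const measurable_norm
  have h2 : (entryLaw α κ N).real {x | s ≤ |x|} =
      κ.real {x | (N : ℝ) ^ (1 / α) * s ≤ |x.1 + x.2|} := by
    unfold entryLaw
    rw [map_measureReal_apply (by fun_prop) hms]
    congr 1
    ext x
    simp only [Set.mem_preimage, Set.mem_ofPred_eq, abs_mul, Real.rpow_neg hN'.le]
    rw [abs_of_pos (by positivity), inv_mul_eq_div, le_div_iff₀ (by positivity), mul_comm]
  rw [h2]
  refine h1.trans ?_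
  rw [abs_of_pos hpos]
  have h3 : (N : ℝ) * s ^ α ≤ ((N : ℝ) ^ (1 / α) * s + 1) ^ α := by
    calc (N : ℝ) * s ^ α = ((N : ℝ) ^ (1 / α) * s) ^ α := by
          rw [Real.mul_rpow (by positivity) hs.le, ← Real.rpow_mul hN'.le, one_div,
            inv_mul_cancel₀ hα.ne', Real.rpow_one]
      _ ≤ _ := Real.rpow_le_rpow hpos.le (by linarith) hα.le
  calc C₂ / ((N : ℝ) ^ (1 / α) * s + 1) ^ α ≤ C₂ / (N * s ^ α) :=
        div_le_div_of_nonneg_left hC₂.le (by positivity) h3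
    _ = C₂ / N * s ^ (-α) := by rw [Real.rpow_neg hs.le]; field_simp

include hκ in
/-- Size of the parameters for large `N`: the truncation level `N^{-ρ}` is rarely exceeded, the
variance parameter is of order `N^{-ν(2-α)}`, and the second moment of the entries below the
truncation level is of order at most `1/N`. -/
lemma exists_moment_bounds (hα : 0 < α) (hα2 : α < 2) (hρ : 0 < ρ) (hαρ : α * ρ < 1) :
    ∃ K > 0, ∃ N₀ : ℕ, ∀ N : ℕ, N₀ ≤ N → 0 < N →
      0 < (entryLaw α κ N).real (smallSet ρ N) ∧
      tParam α ν ρ κ N ≤ K * (N : ℝ) ^ (-(ν * (2 - α))) ∧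
      (∫ x in smallSet ρ N, x ^ 2 ∂(entryLaw α κ N)) / (entryLaw α κ N).real (smallSet ρ N) ≤
        K / N := by
  obtain ⟨K, hK, htail⟩ := entryLaw_tail hκ hα
  have h2α : 0 < 2 - α := by linarith
  have hlim : Filter.Tendsto (fun N : ℕ => K * (N : ℝ) ^ (-(1 - α * ρ))) Filter.atTop (nhds 0) := by
    have h1 := (tendsto_rpow_neg_atTop (show 0 < 1 - α * ρ by linarith)).comp
      tendsto_natCast_atTop_atTop
    simpa using h1.const_mul K
  obtain ⟨N₀, hN₀⟩ := Filter.eventually_atTop.1 (hlim.eventually (ge_mem_nhds (by norm_num :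
    (0 : ℝ) < 1 / 2)))
  refine ⟨2 * (2 * K / (2 - α)), by positivity, N₀, fun N hN hN0 => ?_⟩
  have hN' : (0 : ℝ) < N := by exact_mod_cast hN0
  have hN1 : (1 : ℝ) ≤ N := by exact_mod_cast hN0
  have := isProbabilityMeasure_entryLaw hκ N
  set μ := entryLaw α κ N
  have hq : 1 / 2 ≤ μ.real (smallSet ρ N) := by
    have h1 := htail N hN0 ((N : ℝ) ^ (-ρ)) (by positivity)
    have h2 : {x : ℝ | (N : ℝ) ^ (-ρ) ≤ |x|} = (smallSet ρ N)ᶜ := by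
      ext x
      simp [smallSet]
    rw [h2, probReal_compl_eq_one_sub (measurableSet_smallSet N)] at h1
    have h3 : K / N * ((N : ℝ) ^ (-ρ)) ^ (-α) = K * (N : ℝ) ^ (-(1 - α * ρ)) := by
      rw [← Real.rpow_mul hN'.le, show -(1 - α * ρ) = -1 + -ρ * -α by ring, Real.rpow_add hN',
        Real.rpow_neg_one]
      field_simp
    have h4 := hN₀ N hN
    linarith
  have hV : ∀ r : ℝ, 0 < r → ∫ x in {x | |x| < r}, x ^ 2 ∂μ ≤ 2 * (K / N) / (2 - α) * r ^ (2 - α) :=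
    fun r hr => setIntegral_sq_truncated_le hα2 (by positivity) (htail N hN0) hr
  refine ⟨by linarith, ?_, ?_⟩
  · have h1 := hV ((N : ℝ) ^ (-ν)) (by positivity)
    change N * (∫ x in {x | |x| < (N : ℝ) ^ (-ν)}, x ^ 2 ∂μ) / μ.real (smallSet ρ N) ≤ _
    rw [div_le_iff₀ (by linarith)]
    rw [← Real.rpow_mul hN'.le, neg_mul] at h1
    calc N * (∫ x in {x | |x| < (N : ℝ) ^ (-ν)}, x ^ 2 ∂μ)
        ≤ N * (2 * (K / N) / (2 - α) * (N : ℝ) ^ (-(ν * (2 - α)))) :=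
          mul_le_mul_of_nonneg_left h1 hN'.le
      _ = 2 * (2 * K / (2 - α)) * (N : ℝ) ^ (-(ν * (2 - α))) * (1 / 2) := by field_simp
      _ ≤ _ := by gcongr
  · have h1 := hV ((N : ℝ) ^ (-ρ)) (by positivity)
    rw [div_le_iff₀ (by linarith)]
    have h2 : ((N : ℝ) ^ (-ρ)) ^ (2 - α) ≤ 1 :=
      Real.rpow_le_one (by positivity) (Real.rpow_le_one_of_one_le_of_nonpos hN1 (by linarith))
        h2α.le
    calc ∫ x in smallSet ρ N, x ^ 2 ∂μ ≤ 2 * (K / N) / (2 - α) * ((N : ℝ) ^ (-ρ)) ^ (2 - α) := h1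
      _ ≤ 2 * (K / N) / (2 - α) * 1 := by gcongr
      _ = 2 * (2 * K / (2 - α)) / N * (1 / 2) := by field_simp
      _ ≤ _ := by gcongr

include hκ in
lemma isProbabilityMeasure_varLaw (q : Var × UpperIndex N) :
    IsProbabilityMeasure (varLaw α ν ρ κ N q) := by
  have := isProbabilityMeasure_entryLaw hκ N
  obtain ⟨v, p⟩ := q
  cases v
  all_goals unfold varLaw
  · exact isProbabilityMeasure_condLaw _ _
  · exact isProbabilityMeasure_condLaw _ _
  · exact isProbabilityMeasure_condLaw _ _
  · exact isProbabilityMeasure_bernoulliLaw _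
  · exact isProbabilityMeasure_bernoulliLaw _
  · infer_instance

end Laws

/-! ### The law conditioned on the labels -/

section Label

/-- The laws of the individual variables given the label matrix: the labels become
deterministic and the other variables keep their laws. -/
def labelVarLaw (α ν ρ : ℝ) (κ : Measure (ℝ × ℝ)) (N : ℕ) (Ψ : Matrix (Fin N) (Fin N) ℝ) :
    Var × UpperIndex N → Measure ℝ
  | (Var.psi, p) => Measure.dirac (Ψ p.1.1 p.1.2)
  | q => varLaw α ν ρ κ N q

variable {α ν ρ : ℝ} {κ : Measure (ℝ × ℝ)} (hκ : IsDeformedStable α κ) {N : ℕ}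
  (Ψ : Matrix (Fin N) (Fin N) ℝ)

include hκ in
lemma isProbabilityMeasure_labelVarLaw (q : Var × UpperIndex N) :
    IsProbabilityMeasure (labelVarLaw α ν ρ κ N Ψ q) := by
  have h := isProbabilityMeasure_varLaw (ν := ν) (ρ := ρ) hκ N q
  obtain ⟨v, p⟩ := q
  cases v
  all_goals first | exact h | (unfold labelVarLaw; infer_instance)

lemma cond_singleton_eq_dirac {μ : Measure ℝ} [IsFiniteMeasure μ] {x : ℝ} (h : μ {x} ≠ 0) :
    cond μ {x} = Measure.dirac x := by
  rw [ProbabilityTheory.cond, Measure.restrict_singleton, smul_smul, ENNReal.inv_mul_cancel h (by finiteness),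
    one_smul]

include hκ in
/-- Conditioning on the labels gives a product law, or the zero measure if the label matrix has
probability zero. -/
lemma labelLaw_eq (hΨ : Ψ.IsSymm) : labelLaw α ν ρ κ N Ψ = 0 ∨
    labelLaw α ν ρ κ N Ψ = Measure.pi (labelVarLaw α ν ρ κ N Ψ) := by
  have := isProbabilityMeasure_varLaw (ν := ν) (ρ := ρ) hκ N
  let s : Var × UpperIndex N → Set ℝ := fun q =>
    if q.1 = Var.psi then {Ψ q.2.1.1 q.2.1.2} else Set.univ
  have hs : ∀ q, MeasurableSet (s q) := by
    intro q
    by_cases hq : q.1 = Var.psi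
    · simp only [s, hq, if_true]; exact measurableSet_singleton _
    · simp only [s, hq, if_false]; exact MeasurableSet.univ
  have hset : {ω : Sample N | varMatrix Var.psi ω = Ψ} = Set.univ.pi s := by
    ext ω
    simp only [Set.mem_ofPred_eq, Set.mem_pi, Set.mem_univ, true_implies, s]
    constructor
    · rintro h ⟨v, p⟩
      by_cases hv : v = Var.psi
      · subst hv
        simp only [if_true, Set.mem_singleton_iff]
        rw [← h]
        have : upper p.1.1 p.1.2 = p := by
          simp [upper, min_eq_left p.2, max_eq_right p.2]
        simp [varMatrix, this]
      · simp [hv]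
    · intro h
      ext i j
      have h1 := h (Var.psi, upper i j)
      simp only [if_true, Set.mem_singleton_iff] at h1
      rw [varMatrix, Matrix.of_apply, h1]
      unfold upper
      rcases le_total i j with hij | hij
      · simp [hij]
      · simp only [hij, min_eq_right, max_eq_left]
        exact hΨ.apply i j
  unfold labelLaw jointLaw
  rw [hset]
  rcases cond_pi (varLaw α ν ρ κ N) s hs with h | ⟨h0, h⟩
  · exact Or.inl h
  · refine Or.inr (h.trans ?_)
    congr 1
    funext q
    obtain ⟨v, p⟩ := q
    by_cases hv : v = Var.psi
    · subst hv
      have h1 : s (Var.psi, p) = {Ψ p.1.1 p.1.2} := by simp [s]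
      have h2 := h0 (Var.psi, p)
      rw [h1] at h2 ⊢
      exact cond_singleton_eq_dirac h2
    · have h1 : s (v, p) = Set.univ := by simp [s, hv]
      rw [h1, cond_univ]
      cases v <;> first | rfl | exact absurd rfl hv

end Label

/-! ### Comparison of moments for one matrix entry -/

section Expansion

/-- Taylor expansion of `ℓ 2` at `0`; here and below `ℓ k` stands for the `k`-th derivative of one
function. -/
lemma taylor_two {ℓ : ℕ → ℝ → ℝ} {r M : ℝ} (hM : 0 ≤ M)
    (hℓ : ∀ k ∈ Set.Icc 1 3, ∀ x, HasDerivAt (ℓ k) (ℓ (k + 1) x) x)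
    (h4 : ∀ x, |x| ≤ r → |ℓ 4 x| ≤ M) (x : ℝ) (hx : |x| ≤ r) :
    |ℓ 2 x - ℓ 2 0 - x * ℓ 3 0| ≤ M * |x| ^ 2 := by
  have h3 := abs_le_mul_pow_succ_of_deriv (φ := fun x => ℓ 3 x - ℓ 3 0) (k := 0) (r := r)
    (by simp) hM (fun x => (hℓ 3 (by simp) x).sub_const _)
    (fun x hx => by simpa using h4 x hx)
  refine abs_le_mul_pow_succ_of_deriv (φ := fun x => ℓ 2 x - ℓ 2 0 - x * ℓ 3 0) (k := 1)
    (by simp) hM (fun x => ?_) (by simpa using h3) x hx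
  refine (((hℓ 2 (by simp) x).sub_const _).sub ((hasDerivAt_id x).mul_const (ℓ 3 0))).congr_deriv ?_
  rw [one_mul]

lemma taylor_three {ℓ : ℕ → ℝ → ℝ} {r M : ℝ} (hM : 0 ≤ M)
    (hℓ : ∀ k ∈ Set.Icc 1 3, ∀ x, HasDerivAt (ℓ k) (ℓ (k + 1) x) x)
    (h4 : ∀ x, |x| ≤ r → |ℓ 4 x| ≤ M) (x : ℝ) (hx : |x| ≤ r) :
    |ℓ 1 x - ℓ 1 0 - x * ℓ 2 0 - x ^ 2 / 2 * ℓ 3 0| ≤ M * |x| ^ 3 := by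
  refine abs_le_mul_pow_succ_of_deriv
    (φ := fun x => ℓ 1 x - ℓ 1 0 - x * ℓ 2 0 - x ^ 2 / 2 * ℓ 3 0) (k := 2)
    (by simp) hM (fun x => ?_) (taylor_two hM hℓ h4) x hx
  have h2 : HasDerivAt (fun x : ℝ => x ^ 2 / 2) x x := by
    refine ((hasDerivAt_pow 2 x).div_const 2).congr_deriv ?_
    simp
  refine ((((hℓ 1 (by simp) x).sub_const _).sub ((hasDerivAt_id x).mul_const (ℓ 2 0))).sub
    (h2.mul_const (ℓ 3 0))).congr_deriv ?_
  rw [one_mul]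

variable {Ω : Type*} [MeasurableSpace Ω] {Q : Measure Ω} [IsProbabilityMeasure Q] {A V : Ω → ℝ}

lemma integrable_pow_of_ae_bounded (hA : Measurable A) {r : ℝ} (hAr : ∀ᵐ x ∂Q, |A x| ≤ r) (k : ℕ) :
    Integrable (fun x => A x ^ k) Q := by
  refine Integrable.of_bound (hA.pow_const k).aestronglyMeasurable (r ^ k) ?_
  filter_upwards [hAr] with x hx
  rw [norm_pow]
  exact pow_le_pow_left₀ (norm_nonneg _) hx k

/-- The contribution of one matrix entry to the derivative along the interpolation. The entry is
`s A + V`, where `A` is the part that is being replaced by a Gaussian of variance `τ` and `V` is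
the part that stays; at most one of them is nonzero. Vanishing odd moments leave fourth moments,
products of second moments, and the mismatch between the variance of `A` and `τ`. -/
lemma abs_entry_contribution_le (hA : Measurable A) (hV : Measurable V) {r M c s τ : ℝ}
    (hAr : ∀ᵐ x ∂Q, |A x| ≤ r) (hVr : ∀ᵐ x ∂Q, |V x| ≤ r) (hAV : ∀ᵐ x ∂Q, A x = 0 ∨ V x = 0)
    (hA1 : ∫ x, A x ∂Q = 0) (hA3 : ∫ x, A x ^ 3 ∂Q = 0) (hV1 : ∫ x, V x ∂Q = 0)
    (hc : |c| ≤ 1) (hs : |s| ≤ 1) {ℓ : ℕ → ℝ → ℝ}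
    (hℓ : ∀ k ∈ Set.Icc 1 3, ∀ x, HasDerivAt (ℓ k) (ℓ (k + 1) x) x)
    (h4 : ∀ x, |x| ≤ r → |ℓ 4 x| ≤ M) (h2 : |ℓ 2 0| ≤ M) :
    |c * ∫ x, A x * ℓ 1 (s * A x + V x) ∂Q - s * c * τ * ∫ x, ℓ 2 (s * A x + V x) ∂Q| ≤
      M * (∫ x, A x ^ 4 ∂Q + |∫ x, A x ^ 2 ∂Q - τ| +
        |τ| * (∫ x, A x ^ 2 ∂Q + ∫ x, V x ^ 2 ∂Q)) := by
  have hM : 0 ≤ M := (abs_nonneg _).trans h2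
  have hcont : ∀ k ∈ Set.Icc 1 3, Continuous (ℓ k) := fun k hk =>
    continuous_iff_continuousAt.2 fun x => (hℓ k hk x).continuousAt
  have iA := integrable_pow_of_ae_bounded hA hAr
  have iV := integrable_pow_of_ae_bounded hV hVr
  have iA1 : Integrable A Q := by simpa using iA 1
  have iV1 : Integrable V Q := by simpa using iV 1
  have hmsum : Measurable fun x => s * A x + V x := (hA.const_mul s).add hV
  have hsA : ∀ a : ℝ, |s * a| ≤ |a| := fun a => by
    rw [abs_mul]
    nlinarith [abs_nonneg a]
  -- Expansion of `ℓ 1` to third order: only the second moment of `A` survives.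
  have e1 : |∫ x, A x * ℓ 1 (s * A x + V x) ∂Q - s * ℓ 2 0 * ∫ x, A x ^ 2 ∂Q| ≤
      M * ∫ x, A x ^ 4 ∂Q := by
    set g : Ω → ℝ := fun x => ℓ 1 0 * A x + s * ℓ 2 0 * A x ^ 2 + s ^ 2 / 2 * ℓ 3 0 * A x ^ 3
      with hg
    have i12 : Integrable (fun x => ℓ 1 0 * A x + s * ℓ 2 0 * A x ^ 2) Q :=
      (iA1.const_mul _).add ((iA 2).const_mul _)
    have ig : Integrable g Q := i12.add ((iA 3).const_mul _)
    have Ig : ∫ x, g x ∂Q = s * ℓ 2 0 * ∫ x, A x ^ 2 ∂Q := by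
      rw [hg, integral_add i12 ((iA 3).const_mul _),
        integral_add (iA1.const_mul _) ((iA 2).const_mul _), integral_const_mul,
        integral_const_mul, integral_const_mul, hA1, hA3]
      ring
    have hb : ∀ᵐ x ∂Q, ‖A x * ℓ 1 (s * A x + V x) - g x‖ ≤ M * A x ^ 4 := by
      filter_upwards [hAr, hAV] with x hx hx'
      rcases hx' with h0 | h0
      · simp [hg, h0]
      · have ht := taylor_three hM hℓ h4 (s * A x) ((hsA _).trans hx)
        have h5 : A x * ℓ 1 (s * A x + V x) - g x = A x *
            (ℓ 1 (s * A x) - ℓ 1 0 - s * A x * ℓ 2 0 - (s * A x) ^ 2 / 2 * ℓ 3 0) := by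
          rw [h0, add_zero, hg]; ring
        rw [h5, norm_mul, Real.norm_eq_abs, Real.norm_eq_abs]
        calc |A x| * _ ≤ |A x| * (M * |A x| ^ 3) := by
              refine mul_le_mul_of_nonneg_left (ht.trans ?_) (abs_nonneg _)
              exact mul_le_mul_of_nonneg_left (pow_le_pow_left₀ (abs_nonneg _) (hsA _) 3) hM
          _ = M * |A x| ^ 4 := by ring
          _ = M * A x ^ 4 := by rw [Even.pow_abs (by decide)]
    have hmf : Measurable fun x => A x * ℓ 1 (s * A x + V x) :=
      hA.mul ((hcont 1 (by simp)).measurable.comp hmsum)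
    have id' : Integrable (fun x => A x * ℓ 1 (s * A x + V x) - g x) Q :=
      ((iA 4).const_mul M).mono' (hmf.aestronglyMeasurable.sub ig.aestronglyMeasurable) hb
    have h6 : ∫ x, A x * ℓ 1 (s * A x + V x) ∂Q - s * ℓ 2 0 * ∫ x, A x ^ 2 ∂Q =
        ∫ x, (A x * ℓ 1 (s * A x + V x) - g x) ∂Q := by
      rw [← Ig, ← integral_sub _ ig]
      refine (id'.add ig).congr (Filter.Eventually.of_forall fun x => ?_)
      simp
    rw [h6, ← Real.norm_eq_abs, ← integral_const_mul]
    exact norm_integral_le_of_norm_le ((iA 4).const_mul M) hb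
  -- Expansion of `ℓ 2` to second order: the linear term is centered.
  have e2 : |∫ x, ℓ 2 (s * A x + V x) ∂Q - ℓ 2 0| ≤
      M * (∫ x, A x ^ 2 ∂Q + ∫ x, V x ^ 2 ∂Q) := by
    set g : Ω → ℝ := fun x => ℓ 2 0 + (s * A x + V x) * ℓ 3 0 with hg
    have isum : Integrable (fun x => s * A x + V x) Q := (iA1.const_mul s).add iV1
    have ig : Integrable g Q := (integrable_const _).add (isum.mul_const _)
    have Ig : ∫ x, g x ∂Q = ℓ 2 0 := by
      rw [hg, integral_add (integrable_const _) (isum.mul_const _), integral_mul_const,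
        integral_add (iA1.const_mul s) iV1, integral_const_mul, hA1, hV1]
      simp
    have hb : ∀ᵐ x ∂Q, ‖ℓ 2 (s * A x + V x) - g x‖ ≤ M * (A x ^ 2 + V x ^ 2) := by
      filter_upwards [hAr, hVr, hAV] with x hx hx2 hx'
      have h7 : |s * A x + V x| ≤ r ∧ |s * A x + V x| ^ 2 ≤ A x ^ 2 + V x ^ 2 := by
        rcases hx' with h0 | h0
        · rw [h0]
          simpa using hx2
        · rw [h0, add_zero]
          refine ⟨(hsA _).trans hx, ?_⟩
          have := pow_le_pow_left₀ (abs_nonneg _) (hsA (A x)) 2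
          rw [sq_abs (A x)] at this
          simpa using this
      have ht := taylor_two hM hℓ h4 _ h7.1
      have h5 : ℓ 2 (s * A x + V x) - g x =
          ℓ 2 (s * A x + V x) - ℓ 2 0 - (s * A x + V x) * ℓ 3 0 := by
        rw [hg]; ring
      rw [h5]
      exact ht.trans (mul_le_mul_of_nonneg_left h7.2 hM)
    have ib : Integrable (fun x => M * (A x ^ 2 + V x ^ 2)) Q := ((iA 2).add (iV 2)).const_mul M
    have hmf : Measurable fun x => ℓ 2 (s * A x + V x) :=
      (hcont 2 (by simp)).measurable.comp hmsum
    have id' : Integrable (fun x => ℓ 2 (s * A x + V x) - g x) Q :=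
      ib.mono' (hmf.aestronglyMeasurable.sub ig.aestronglyMeasurable) hb
    have h6 : ∫ x, ℓ 2 (s * A x + V x) ∂Q - ℓ 2 0 = ∫ x, (ℓ 2 (s * A x + V x) - g x) ∂Q := by
      conv_lhs => rw [← Ig]
      rw [← integral_sub _ ig]
      refine (id'.add ig).congr (Filter.Eventually.of_forall fun x => ?_)
      simp
    rw [h6, ← Real.norm_eq_abs]
    refine (norm_integral_le_of_norm_le ib hb).trans (le_of_eq ?_)
    rw [integral_const_mul, integral_add (iA 2) (iV 2)]
  set I1 := ∫ x, A x * ℓ 1 (s * A x + V x) ∂Q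
  set I2 := ∫ x, ℓ 2 (s * A x + V x) ∂Q
  set a2 := ∫ x, A x ^ 2 ∂Q
  have h8 : c * I1 - s * c * τ * I2 = c * (I1 - s * ℓ 2 0 * a2) + s * c * (ℓ 2 0 * (a2 - τ)) +
      s * c * (τ * (ℓ 2 0 - I2)) := by ring
  have hsc : |s * c| ≤ 1 := by
    rw [abs_mul]; exact mul_le_one₀ hs (abs_nonneg _) hc
  have h9 : ∀ u v : ℝ, |u| ≤ 1 → |u * v| ≤ |v| := fun u v hu => by
    rw [abs_mul]
    nlinarith [abs_nonneg v]
  rw [h8]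
  refine (abs_add_three _ _ _).trans ?_
  have t1 := (h9 c (I1 - s * ℓ 2 0 * a2) hc).trans e1
  have t2 : |s * c * (ℓ 2 0 * (a2 - τ))| ≤ M * |a2 - τ| := by
    refine (h9 _ _ hsc).trans ?_
    rw [abs_mul]
    exact mul_le_mul_of_nonneg_right h2 (abs_nonneg _)
  have t3 : |s * c * (τ * (ℓ 2 0 - I2))| ≤ |τ| * (M * (a2 + ∫ x, V x ^ 2 ∂Q)) := by
    refine (h9 _ _ hsc).trans ?_
    rw [abs_mul, abs_sub_comm]
    exact mul_le_mul_of_nonneg_left e2 (abs_nonneg _)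
  linarith

end Expansion

/-! ### Moments of one matrix entry -/

section Entry

variable {α ν ρ : ℝ} {κ : Measure (ℝ × ℝ)} (hκ : IsDeformedStable α κ) {N : ℕ} (hN : 0 < N)
  (hρν : ρ < ν) (hq : 0 < (entryLaw α κ N).real (smallSet ρ N))
  (Ψ : Matrix (Fin N) (Fin N) ℝ) (p : UpperIndex N)

/-- The part `(1 - χ) a` of the entry at `p` that is replaced by a Gaussian. -/
def smallPart (p : UpperIndex N) (ω : Sample N) : ℝ := (1 - ω (Var.chi, p)) * ω (Var.a, p)

/-- The part `χ b` of the entry at `p`. -/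
def middlePart (p : UpperIndex N) (ω : Sample N) : ℝ := ω (Var.chi, p) * ω (Var.b, p)

lemma measurable_smallPart : Measurable (smallPart p) := by
  unfold smallPart
  fun_prop

lemma measurable_middlePart : Measurable (middlePart p) := by
  unfold middlePart
  fun_prop

include hκ hN hρν in
lemma measureReal_smallSet_eq : (entryLaw α κ N).real (smallSet ρ N) =
    (entryLaw α κ N).real (smallSet ν N) + (entryLaw α κ N).real (middleSet ν ρ N) := by
  have := isProbabilityMeasure_entryLaw hκ N
  have hN1 : (1 : ℝ) ≤ N := by exact_mod_cast hN
  have h1 : (N : ℝ) ^ (-ν) ≤ (N : ℝ) ^ (-ρ) := Real.rpow_le_rpow_of_exponent_le hN1 (by linarith)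
  have h2 : smallSet ρ N = smallSet ν N ∪ middleSet ν ρ N := by
    ext x
    simp only [smallSet, middleSet, Set.mem_union, Set.mem_ofPred_eq]
    constructor
    · intro h
      by_cases h3 : |x| < (N : ℝ) ^ (-ν)
      · exact Or.inl h3
      · exact Or.inr ⟨not_lt.1 h3, h⟩
    · rintro (h | h)
      · exact h.trans_le h1
      · exact h.2
  rw [h2, measureReal_union _ (measurableSet_middleSet N)]
  rw [Set.disjoint_left]
  intro x hx hx'
  exact absurd hx (not_lt.2 hx'.1)

include hκ hN hρν hq in
lemma chiProb_mem : chiProb α ν ρ κ N ∈ Set.Icc (0 : ℝ) 1 := by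
  unfold chiProb
  rw [measureReal_smallSet_eq hκ hN hρν] at hq ⊢
  refine ⟨by positivity, (div_le_one hq).2 ?_⟩
  linarith [measureReal_nonneg (μ := entryLaw α κ N) (s := smallSet ν N)]

include hκ hN hρν hq in
lemma one_sub_chiProb : 1 - chiProb α ν ρ κ N =
    (entryLaw α κ N).real (smallSet ν N) / (entryLaw α κ N).real (smallSet ρ N) := by
  unfold chiProb
  have h := measureReal_smallSet_eq hκ hN hρν
  rw [eq_div_iff hq.ne', sub_mul, div_mul_cancel₀ _ hq.ne']
  linarith

/-- The joint law of all variables given the labels. -/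
abbrev labelPi (α ν ρ : ℝ) (κ : Measure (ℝ × ℝ)) (N : ℕ) (Ψ : Matrix (Fin N) (Fin N) ℝ) :
    Measure (Sample N) :=
  Measure.pi (labelVarLaw α ν ρ κ N Ψ)

include hκ in
lemma isProbabilityMeasure_labelPi : IsProbabilityMeasure (labelPi α ν ρ κ N Ψ) := by
  have := isProbabilityMeasure_labelVarLaw (ν := ν) (ρ := ρ) hκ Ψ
  infer_instance

include hκ in
lemma ae_psi : ∀ᵐ ω ∂(labelPi α ν ρ κ N Ψ), ω (Var.psi, p) = Ψ p.1.1 p.1.2 := by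
  have := isProbabilityMeasure_labelVarLaw (ν := ν) (ρ := ρ) hκ Ψ
  refine ae_eval (labelVarLaw α ν ρ κ N Ψ) (q := (Var.psi, p)) (p := fun y => y = Ψ p.1.1 p.1.2) ?_
  change ∀ᵐ y ∂(Measure.dirac _), _
  rw [ae_dirac_eq]
  rfl

include hκ in
lemma ae_chi : ∀ᵐ ω ∂(labelPi α ν ρ κ N Ψ), ω (Var.chi, p) = 0 ∨ ω (Var.chi, p) = 1 := by
  have := isProbabilityMeasure_labelVarLaw (ν := ν) (ρ := ρ) hκ Ψ
  exact ae_eval (labelVarLaw α ν ρ κ N Ψ) (q := (Var.chi, p)) (p := fun y => y = 0 ∨ y = 1)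
    (ae_bernoulliLaw _)

include hκ in
lemma ae_smallPart_eq_zero_or :
    ∀ᵐ ω ∂(labelPi α ν ρ κ N Ψ), smallPart p ω = 0 ∨ middlePart p ω = 0 := by
  filter_upwards [ae_chi hκ Ψ p] with ω hω
  rcases hω with h | h
  · right; simp [middlePart, h]
  · left; simp [smallPart, h]

include hκ hN in
lemma ae_abs_smallPart_le :
    ∀ᵐ ω ∂(labelPi α ν ρ κ N Ψ), |smallPart p ω| ≤ (N : ℝ) ^ (-ν) := by
  have := isProbabilityMeasure_labelVarLaw (ν := ν) (ρ := ρ) hκ Ψ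
  have h0 : (0 : ℝ) < (N : ℝ) ^ (-ν) := by
    have : (0 : ℝ) < N := by exact_mod_cast hN
    positivity
  have h1 := ae_eval (labelVarLaw α ν ρ κ N Ψ) (q := (Var.a, p))
    (p := fun y => |y| ≤ (N : ℝ) ^ (-ν))
    (ae_condLaw (measurableSet_smallSet N) (by simpa using h0.le) fun x hx => le_of_lt hx)
  filter_upwards [ae_chi hκ Ψ p, h1] with ω hω hω'
  rcases hω with h | h
  · simpa [smallPart, h] using hω'
  · simpa [smallPart, h] using h0.le

include hκ hN in
lemma ae_abs_middlePart_le :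
    ∀ᵐ ω ∂(labelPi α ν ρ κ N Ψ), |middlePart p ω| ≤ (N : ℝ) ^ (-ρ) := by
  have := isProbabilityMeasure_labelVarLaw (ν := ν) (ρ := ρ) hκ Ψ
  have h0 : (0 : ℝ) < (N : ℝ) ^ (-ρ) := by
    have : (0 : ℝ) < N := by exact_mod_cast hN
    positivity
  have h1 := ae_eval (labelVarLaw α ν ρ κ N Ψ) (q := (Var.b, p))
    (p := fun y => |y| ≤ (N : ℝ) ^ (-ρ))
    (ae_condLaw (measurableSet_middleSet N) (by simpa using h0.le) fun x hx => le_of_lt hx.2)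
  filter_upwards [ae_chi hκ Ψ p, h1] with ω hω hω'
  rcases hω with h | h
  · simpa [middlePart, h] using h0.le
  · simpa [middlePart, h] using hω'

include hκ in
lemma integral_smallPart_pow (k : ℕ) : ∫ ω, smallPart p ω ^ k ∂(labelPi α ν ρ κ N Ψ) =
    (∫ y, (1 - y) ^ k ∂(bernoulliLaw (chiProb α ν ρ κ N))) *
      ∫ y, y ^ k ∂(condLaw (entryLaw α κ N) (smallSet ν N)) := by
  have := isProbabilityMeasure_labelVarLaw (ν := ν) (ρ := ρ) hκ Ψ
  simp only [smallPart, mul_pow]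
  exact integral_eval_mul_eval (labelVarLaw α ν ρ κ N Ψ) (q := (Var.chi, p)) (q' := (Var.a, p))
    (by simp) (f := fun y => (1 - y) ^ k) (g := fun y => y ^ k) (by fun_prop) (by fun_prop)

include hκ in
lemma integral_middlePart_pow (k : ℕ) : ∫ ω, middlePart p ω ^ k ∂(labelPi α ν ρ κ N Ψ) =
    (∫ y, y ^ k ∂(bernoulliLaw (chiProb α ν ρ κ N))) *
      ∫ y, y ^ k ∂(condLaw (entryLaw α κ N) (middleSet ν ρ N)) := by
  have := isProbabilityMeasure_labelVarLaw (ν := ν) (ρ := ρ) hκ Ψ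
  simp only [middlePart, mul_pow]
  exact integral_eval_mul_eval (labelVarLaw α ν ρ κ N Ψ) (q := (Var.chi, p)) (q' := (Var.b, p))
    (by simp) (f := fun y => y ^ k) (g := fun y => y ^ k) (by fun_prop) (by fun_prop)

include hκ in
lemma integral_smallPart_odd {k : ℕ} (hk : Odd k) :
    ∫ ω, smallPart p ω ^ k ∂(labelPi α ν ρ κ N Ψ) = 0 := by
  rw [integral_smallPart_pow hκ, integral_odd_eq_zero (f := fun y => y ^ k)
    (condLaw_map_neg (entryLaw_map_neg hκ N) (measurableSet_smallSet N) (by simp [smallSet]))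
    (by fun_prop) (fun x => hk.neg_pow x), mul_zero]

include hκ in
lemma integral_middlePart : ∫ ω, middlePart p ω ∂(labelPi α ν ρ κ N Ψ) = 0 := by
  have h := integral_middlePart_pow (ν := ν) (ρ := ρ) hκ Ψ p 1
  rw [integral_odd_eq_zero (f := fun y => y ^ 1)
    (condLaw_map_neg (entryLaw_map_neg hκ N) (measurableSet_middleSet N) (by simp [middleSet]))
    (by fun_prop) (fun x => odd_one.neg_pow x), mul_zero] at h
  simpa using h

include hκ hN hρν hq in
/-- The parameter `t` is chosen so that this variance is that of the off-diagonal Gaussian. -/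
lemma integral_smallPart_sq :
    ∫ ω, smallPart p ω ^ 2 ∂(labelPi α ν ρ κ N Ψ) = tParam α ν ρ κ N / N := by
  have := isProbabilityMeasure_entryLaw hκ N
  have hN' : (0 : ℝ) < N := by exact_mod_cast hN
  rw [integral_smallPart_pow hκ, integral_bernoulliLaw (chiProb_mem hκ hN hρν hq)]
  norm_num
  rw [one_sub_chiProb hκ hN hρν hq, div_mul_eq_mul_div, measureReal_mul_integral_condLaw, tParam]
  field_simp

include hκ hN hρν hq in
lemma integral_smallPart_four_le : ∫ ω, smallPart p ω ^ 4 ∂(labelPi α ν ρ κ N Ψ) ≤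
    (N : ℝ) ^ (-(2 * ν)) * (tParam α ν ρ κ N / N) := by
  have := isProbabilityMeasure_labelPi (ν := ν) (ρ := ρ) hκ Ψ
  have hb := ae_abs_smallPart_le (ν := ν) (ρ := ρ) hκ hN Ψ p
  have hi := integrable_pow_of_ae_bounded (measurable_smallPart p) hb
  rw [← integral_smallPart_sq hκ hN hρν hq Ψ p, ← integral_const_mul]
  refine integral_mono_ae (hi 4) ((hi 2).const_mul _) ?_
  filter_upwards [hb] with ω hω
  have h1 : smallPart p ω ^ 2 ≤ (N : ℝ) ^ (-(2 * ν)) := by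
    rw [← sq_abs, show -(2 * ν) = -ν * (2 : ℕ) by push_cast; ring,
      Real.rpow_mul_natCast (by positivity)]
    exact pow_le_pow_left₀ (abs_nonneg _) hω 2
  nlinarith [sq_nonneg (smallPart p ω)]

include hκ hN hρν hq in
lemma integral_middlePart_sq_le : ∫ ω, middlePart p ω ^ 2 ∂(labelPi α ν ρ κ N Ψ) ≤
    (∫ x in smallSet ρ N, x ^ 2 ∂(entryLaw α κ N)) / (entryLaw α κ N).real (smallSet ρ N) := by
  have := isProbabilityMeasure_entryLaw hκ N
  rw [integral_middlePart_pow hκ, integral_bernoulliLaw (chiProb_mem hκ hN hρν hq)]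
  norm_num
  rw [chiProb, div_mul_eq_mul_div, measureReal_mul_integral_condLaw]
  refine div_le_div_of_nonneg_right ?_ hq.le
  refine setIntegral_mono_set ?_ (Filter.Eventually.of_forall fun x => sq_nonneg x)
    (Filter.Eventually.of_forall fun x hx => hx.2)
  refine Integrable.of_bound (by fun_prop) (((N : ℝ) ^ (-ρ)) ^ 2) ?_
  refine (ae_restrict_iff' (measurableSet_smallSet N)).2 (Filter.Eventually.of_forall fun x hx => ?_)
  rw [norm_pow]
  exact pow_le_pow_left₀ (norm_nonneg _) (le_of_lt hx) 2

end Entry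

/-! ### The interpolating matrices -/

section Interpolation

variable {N : ℕ}

/-- The entry of the matrix `A` at `p`. -/
def entryA (p : UpperIndex N) (ω : Sample N) : ℝ :=
  (1 - ω (Var.psi, p)) * (1 - ω (Var.chi, p)) * ω (Var.a, p)

/-- The upper triangle of `s A + X + c t^{1/2} W`. -/
def entries (t c s : ℝ) (ω : Sample N) : UpperIndex N → ℝ := fun p =>
  s * entryA p ω + ((1 - ω (Var.psi, p)) * ω (Var.chi, p) * ω (Var.b, p) +
    ω (Var.psi, p) * ω (Var.c, p)) + c * Real.sqrt t * ω (Var.w, p)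

lemma measurable_entryA (p : UpperIndex N) : Measurable (entryA p) := by
  unfold entryA
  fun_prop

lemma measurable_entries (t c s : ℝ) : Measurable (entries (N := N) t c s) := by
  unfold entries entryA
  fun_prop

lemma matG_eq_green (t γ : ℝ) (z : ℂ) (ω : Sample N) :
    matG t γ z ω = green z (entries t (Real.sqrt (1 - γ ^ 2)) γ ω) := by
  unfold matG green
  congr 2

lemma entryVec_eq_obs {m : ℕ} (t γ : ℝ) (z : Fin m → ℂ) (S : Finset (Fin m)) (i j : Fin m → Fin N)
    (ω : Sample N) :
    entryVec t γ z S i j ω = obs z S i j (entries t (Real.sqrt (1 - γ ^ 2)) γ ω) := by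
  funext s
  simp only [entryVec, obs, reIm, matG_eq_green]
  split_ifs <;> rfl

lemma entries_eq_of_psi_eq_zero {t c s : ℝ} {ω : Sample N} {p : UpperIndex N}
    (h : ω (Var.psi, p) = 0) : entries t c s ω p =
      s * smallPart p ω + middlePart p ω + c * Real.sqrt t * ω (Var.w, p) := by
  simp [entries, entryA, smallPart, middlePart, h]

/-- Resampling the variables `a`, `b`, `χ` at `p` changes the matrix at `p` only. -/
lemma entries_piecewise {t c s : ℝ} {ω : Sample N} (ω' : Sample N) {p : UpperIndex N}
    (h : ω (Var.psi, p) = 0) :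
    entries t c s (({(Var.a, p), (Var.b, p), (Var.chi, p)} :
      Finset (Var × UpperIndex N)).piecewise ω' ω) =
      entries t c s ω + ((s * smallPart p ω' + middlePart p ω') -
        (s * smallPart p ω + middlePart p ω)) • (Pi.single p 1 : UpperIndex N → ℝ) := by
  funext q
  by_cases hq : q = p
  · subst hq
    simp only [Pi.add_apply, Pi.smul_apply, Pi.single_eq_same, smul_eq_mul, mul_one]
    rw [entries_eq_of_psi_eq_zero h, entries_eq_of_psi_eq_zero (by simp [Finset.piecewise, h])]
    simp [smallPart, middlePart, Finset.piecewise]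
    ring
  · simp [entries, entryA, Finset.piecewise, hq]

lemma entries_piecewise_w {t c s : ℝ} {ω : Sample N} (ω' : Sample N) {p : UpperIndex N} :
    entries t c s (({(Var.w, p)} : Finset (Var × UpperIndex N)).piecewise ω' ω) =
      (entries t c s ω - (c * Real.sqrt t * ω (Var.w, p)) • Pi.single p 1) +
        (c * Real.sqrt t * ω' (Var.w, p)) • (Pi.single p 1 : UpperIndex N → ℝ) := by
  funext q
  by_cases hq : q = p
  · subst hq
    simp [entries, entryA, Finset.piecewise]
  · simp [entries, entryA, Finset.piecewise, hq]

end Interpolation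

/-! ### The derivative along the interpolation -/

section Derivative

variable {α ν ρ : ℝ} {κ : Measure (ℝ × ℝ)} (hκ : IsDeformedStable α κ) {N : ℕ} (hN : 0 < N)
  (hρν : ρ < ν) (hq : 0 < (entryLaw α κ N).real (smallSet ρ N))
  (Ψ : Matrix (Fin N) (Fin N) ℝ) (p : UpperIndex N)
  {f : (UpperIndex N → ℝ) → ℝ} (hf : ContDiff ℝ 4 f) {D : ℝ}
  (hD : ∀ k ≤ 4, ∀ p h, |(dirDeriv (Pi.single p (1 : ℝ)))^[k] f h| ≤ D)
  {t c s : ℝ}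

include hf in
lemma contDiff_dirDeriv_iterate {k n : ℕ} (hk : n + k ≤ 4) :
    ContDiff ℝ n ((dirDeriv (Pi.single p (1 : ℝ)))^[k] f) :=
  contDiff_iterate_dirDeriv (hf.of_le (by exact_mod_cast hk)) _

include hf in
lemma hasDerivAt_dirDeriv_iterate {k : ℕ} (hk : k ≤ 3) (h : UpperIndex N → ℝ) (x : ℝ) :
    HasDerivAt (fun y : ℝ => (dirDeriv (Pi.single p (1 : ℝ)))^[k] f (h + y • Pi.single p 1))
      ((dirDeriv (Pi.single p (1 : ℝ)))^[k + 1] f (h + x • Pi.single p 1)) x := by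
  rw [Function.iterate_succ_apply']
  exact hasDerivAt_line ((contDiff_dirDeriv_iterate p hf (n := 1) (by omega)).differentiable
    (by simp)) h _ x

include hf in
lemma measurable_dirDeriv_entries {k : ℕ} (hk : k ≤ 4) :
    Measurable fun ω : Sample N =>
      (dirDeriv (Pi.single p (1 : ℝ)))^[k] f (entries t c s ω) :=
  (contDiff_dirDeriv_iterate p hf (n := 0) (by omega)).continuous.measurable.comp
    (measurable_entries t c s)

include hκ hf hD in
lemma integrable_dirDeriv_entries {k : ℕ} (hk : k ≤ 4) :
    Integrable (fun ω : Sample N => (dirDeriv (Pi.single p (1 : ℝ)))^[k] f (entries t c s ω))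
      (labelPi α ν ρ κ N Ψ) := by
  have := isProbabilityMeasure_labelPi (ν := ν) (ρ := ρ) hκ Ψ
  exact Integrable.of_bound (measurable_dirDeriv_entries p hf hk).aestronglyMeasurable D
    (Filter.Eventually.of_forall fun ω => hD k hk p _)

/-- The variance of the Gaussian variable at `p`. -/
def gaussVar (p : UpperIndex N) : NNReal := if p.1.1 = p.1.2 then 2 / N else 1 / N

include hN in
lemma gaussVar_ne_zero : gaussVar p ≠ 0 := by
  have : (N : NNReal) ≠ 0 := by exact_mod_cast hN.ne'
  unfold gaussVar
  split_ifs <;> simp [this]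

include hκ in
lemma integrable_w : Integrable (fun ω : Sample N => ω (Var.w, p)) (labelPi α ν ρ κ N Ψ) := by
  have := isProbabilityMeasure_labelVarLaw (ν := ν) (ρ := ρ) hκ Ψ
  refine integrable_eval_comp (labelVarLaw α ν ρ κ N Ψ) (Var.w, p) (f := fun y => y) ?_
  exact (memLp_id_gaussianReal (μ := 0) (v := gaussVar p) 1).integrable (by norm_num)

include hκ hN hf hD in
/-- Gaussian integration by parts in the variable `w` at `p`. -/
lemma integral_w_mul :
    ∫ ω, ω (Var.w, p) * dirDeriv (Pi.single p (1 : ℝ)) f (entries t c s ω)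
        ∂(labelPi α ν ρ κ N Ψ) =
      gaussVar p * (c * Real.sqrt t) *
        ∫ ω, (dirDeriv (Pi.single p (1 : ℝ)))^[2] f (entries t c s ω) ∂(labelPi α ν ρ κ N Ψ) := by
  have := isProbabilityMeasure_labelVarLaw (ν := ν) (ρ := ρ) hκ Ψ
  have hi1 : Integrable (fun ω : Sample N => ω (Var.w, p) *
      dirDeriv (Pi.single p (1 : ℝ)) f (entries t c s ω)) (labelPi α ν ρ κ N Ψ) :=
    (integrable_w hκ Ψ p).mul_bdd
      (measurable_dirDeriv_entries p hf (k := 1) (by omega)).aestronglyMeasurable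
      (Filter.Eventually.of_forall fun ω => hD 1 (by omega) p _)
  rw [integral_eq_integral_piecewise _ {(Var.w, p)} hi1, integral_eq_integral_piecewise _
    {(Var.w, p)} (integrable_dirDeriv_entries hκ Ψ p hf hD (k := 2) (by omega)),
    ← integral_const_mul]
  refine integral_congr_ae (Filter.Eventually.of_forall fun ω => ?_)
  simp only [entries_piecewise_w]
  set h0 := entries t c s ω - (c * Real.sqrt t * ω (Var.w, p)) • (Pi.single p 1 : UpperIndex N → ℝ)
  set φ : ℝ → ℝ := fun y => dirDeriv (Pi.single p (1 : ℝ)) f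
    (h0 + (c * Real.sqrt t * y) • Pi.single p 1) with hφ
  set φ' : ℝ → ℝ := fun y => (dirDeriv (Pi.single p (1 : ℝ)))^[2] f
    (h0 + (c * Real.sqrt t * y) • Pi.single p 1) with hφ'
  have hlin : Continuous fun y : ℝ => h0 + (c * Real.sqrt t * y) •
      (Pi.single p 1 : UpperIndex N → ℝ) := by fun_prop
  have c1 : Continuous φ :=
    (contDiff_dirDeriv_iterate p hf (n := 0) (k := 1) (by omega)).continuous.comp hlin
  have c2 : Continuous φ' :=
    (contDiff_dirDeriv_iterate p hf (n := 0) (k := 2) (by omega)).continuous.comp hlin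
  have e1 := integral_eval_comp (labelVarLaw α ν ρ κ N Ψ) (Var.w, p) (f := fun y => y * φ y)
    (by fun_prop)
  have e2 := integral_eval_comp (labelVarLaw α ν ρ κ N Ψ) (Var.w, p) (f := φ') (by fun_prop)
  have e3 : ∀ y, HasDerivAt φ (c * Real.sqrt t * φ' y) y := by
    intro y
    have h1 := (hasDerivAt_dirDeriv_iterate p hf (k := 1) (by omega) h0 (c * Real.sqrt t * y)).comp
      y ((hasDerivAt_id y).const_mul (c * Real.sqrt t))
    refine h1.congr_deriv ?_
    rw [hφ']
    ring
  have hD0 : 0 ≤ D := (abs_nonneg _).trans (hD 0 (by omega) p 0)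
  have e4 := integral_id_mul_gaussianReal (gaussVar_ne_zero hN p) e3 (by fun_prop)
    (C := max D (|c * Real.sqrt t| * D)) (fun x => (hD 1 (by omega) p _).trans (le_max_left _ _))
    (fun x => by
      rw [abs_mul]
      exact (mul_le_mul_of_nonneg_left (hD 2 (by omega) p _) (abs_nonneg _)).trans
        (le_max_right _ _))
  have e5 : labelVarLaw α ν ρ κ N Ψ (Var.w, p) = gaussianReal 0 (gaussVar p) := rfl
  rw [e5] at e1 e2
  have e6 : ∀ ω' : Sample N, (({(Var.w, p)} : Finset (Var × UpperIndex N)).piecewise ω' ω)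
      (Var.w, p) = ω' (Var.w, p) := fun ω' => by simp [Finset.piecewise]
  simp only [e6]
  rw [integral_const_mul] at e4
  calc _ = ∫ y, y * φ y ∂(gaussianReal 0 (gaussVar p)) := e1
    _ = gaussVar p * (c * Real.sqrt t * ∫ y, φ' y ∂(gaussianReal 0 (gaussVar p))) := e4
    _ = _ := by rw [← e2]; ring

include hκ in
lemma ae_entryA_eq : ∀ᵐ ω ∂(labelPi α ν ρ κ N Ψ),
    entryA p ω = (1 - Ψ p.1.1 p.1.2) * smallPart p ω := by
  filter_upwards [ae_psi hκ Ψ p] with ω hω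
  simp [entryA, smallPart, hω, mul_assoc]

/-- The bound for the contribution of the position `p` to the derivative along the interpolation,
relative to a bound for the derivatives in direction `p` up to order four. -/
def entryError (α ν ρ : ℝ) (κ : Measure (ℝ × ℝ)) (N : ℕ) (Ψ : Matrix (Fin N) (Fin N) ℝ)
    (p : UpperIndex N) : ℝ :=
  if Ψ p.1.1 p.1.2 = 0 then
    ∫ ω, smallPart p ω ^ 4 ∂(labelPi α ν ρ κ N Ψ) +
      |∫ ω, smallPart p ω ^ 2 ∂(labelPi α ν ρ κ N Ψ) - tParam α ν ρ κ N * gaussVar p| +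
      |tParam α ν ρ κ N * gaussVar p| * (∫ ω, smallPart p ω ^ 2 ∂(labelPi α ν ρ κ N Ψ) +
        ∫ ω, middlePart p ω ^ 2 ∂(labelPi α ν ρ κ N Ψ))
  else |tParam α ν ρ κ N * gaussVar p|

lemma tParam_nonneg : 0 ≤ tParam α ν ρ κ N := by
  unfold tParam
  have : 0 ≤ ∫ x in smallSet ν N, x ^ 2 ∂(entryLaw α κ N) :=
    integral_nonneg fun x => sq_nonneg x
  positivity

include hκ hN in
lemma integrable_entryA_mul_bdd {g : Sample N → ℝ} (hg : Measurable g) {D : ℝ}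
    (hD : ∀ ω, |g ω| ≤ D) :
    Integrable (fun ω => entryA p ω * g ω) (labelPi α ν ρ κ N Ψ) := by
  have := isProbabilityMeasure_labelPi (ν := ν) (ρ := ρ) hκ Ψ
  have h1 : Integrable (entryA p) (labelPi α ν ρ κ N Ψ) := by
    have h2 := integrable_pow_of_ae_bounded (measurable_smallPart p)
      (ae_abs_smallPart_le (ν := ν) (ρ := ρ) hκ hN Ψ p) 1
    refine (h2.const_mul (1 - Ψ p.1.1 p.1.2)).congr ?_
    filter_upwards [ae_entryA_eq (ν := ν) (ρ := ρ) hκ Ψ p] with ω hω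
    rw [hω, pow_one]
  exact h1.mul_bdd hg.aestronglyMeasurable (Filter.Eventually.of_forall hD)

include hκ hN hf hD in
/-- Integration by parts turns the Gaussian part of the derivative into a second derivative. -/
lemma integral_entry_eq (hτ : t = tParam α ν ρ κ N) :
    ∫ ω, (c * entryA p ω - s * (Real.sqrt t * ω (Var.w, p))) *
        dirDeriv (Pi.single p (1 : ℝ)) f (entries t c s ω) ∂(labelPi α ν ρ κ N Ψ) =
      ∫ ω, (c * (entryA p ω * dirDeriv (Pi.single p (1 : ℝ)) f (entries t c s ω)) -
        s * c * (t * gaussVar p) * (dirDeriv (Pi.single p (1 : ℝ)))^[2] f (entries t c s ω))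
          ∂(labelPi α ν ρ κ N Ψ) := by
  have hmeas : Measurable fun ω : Sample N =>
      dirDeriv (Pi.single p (1 : ℝ)) f (entries t c s ω) :=
    measurable_dirDeriv_entries p hf (k := 1) (by omega)
  have i1 := integrable_entryA_mul_bdd (ν := ν) (ρ := ρ) hκ hN Ψ p hmeas
    (fun ω => hD 1 (by omega) p _)
  have i2 : Integrable (fun ω : Sample N => ω (Var.w, p) *
      dirDeriv (Pi.single p (1 : ℝ)) f (entries t c s ω)) (labelPi α ν ρ κ N Ψ) :=
    (integrable_w hκ Ψ p).mul_bdd hmeas.aestronglyMeasurable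
      (Filter.Eventually.of_forall fun ω => hD 1 (by omega) p _)
  have i3 := integrable_dirDeriv_entries (ν := ν) (ρ := ρ) hκ Ψ p hf hD (k := 2) (t := t) (c := c)
    (s := s) (by omega)
  have e1 : ∀ ω : Sample N, (c * entryA p ω - s * (Real.sqrt t * ω (Var.w, p))) *
        dirDeriv (Pi.single p (1 : ℝ)) f (entries t c s ω) =
      c * (entryA p ω * dirDeriv (Pi.single p (1 : ℝ)) f (entries t c s ω)) -
        s * Real.sqrt t * (ω (Var.w, p) *
          dirDeriv (Pi.single p (1 : ℝ)) f (entries t c s ω)) := fun ω => by ring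
  simp only [e1]
  rw [integral_sub (Integrable.const_mul i1 c) (i2.const_mul _),
    integral_sub (Integrable.const_mul i1 c) (i3.const_mul _), integral_const_mul (s * Real.sqrt t),
    integral_w_mul hκ hN Ψ p hf hD, integral_const_mul (s * c * (t * gaussVar p))]
  congr 1
  have ht : Real.sqrt t * Real.sqrt t = t := Real.mul_self_sqrt (hτ ▸ tParam_nonneg)
  linear_combination (s * c * gaussVar p * ∫ ω, (dirDeriv (Pi.single p (1 : ℝ)))^[2] f
    (entries t c s ω) ∂(labelPi α ν ρ κ N Ψ)) * ht

include hκ hN hρν hf hD in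
/-- The contribution of one matrix position to the derivative along the interpolation. -/
lemma abs_integral_entry_le (hτ : t = tParam α ν ρ κ N) (hc : |c| ≤ 1) (hs : |s| ≤ 1)
    {M : Sample N → ℝ} (hMi : Integrable M (labelPi α ν ρ κ N Ψ))
    (hM : ∀ ω : Sample N, ∀ k ≤ 4, ∀ x : ℝ, |x| ≤ 2 * (N : ℝ) ^ (-ρ) →
      |(dirDeriv (Pi.single p (1 : ℝ)))^[k] f (entries t c s ω + x • Pi.single p 1)| ≤ M ω)
    (hΨ : Ψ p.1.1 p.1.2 = 0 ∨ Ψ p.1.1 p.1.2 = 1) :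
    |∫ ω, (c * entryA p ω - s * (Real.sqrt t * ω (Var.w, p))) *
        dirDeriv (Pi.single p (1 : ℝ)) f (entries t c s ω) ∂(labelPi α ν ρ κ N Ψ)| ≤
      entryError α ν ρ κ N Ψ p * ∫ ω, M ω ∂(labelPi α ν ρ κ N Ψ) := by
  have := isProbabilityMeasure_labelVarLaw (ν := ν) (ρ := ρ) hκ Ψ
  have hP := isProbabilityMeasure_labelPi (ν := ν) (ρ := ρ) hκ Ψ
  rw [integral_entry_eq hκ hN Ψ p hf hD hτ]
  have hN1 : (1 : ℝ) ≤ N := by exact_mod_cast hN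
  have hsc : |s * c| ≤ 1 := by
    rw [abs_mul]; exact mul_le_one₀ hs (abs_nonneg _) hc
  have hmeas : Measurable fun ω : Sample N =>
      dirDeriv (Pi.single p (1 : ℝ)) f (entries t c s ω) :=
    measurable_dirDeriv_entries p hf (k := 1) (by omega)
  have i1 := integrable_entryA_mul_bdd (ν := ν) (ρ := ρ) hκ hN Ψ p hmeas
    (fun ω => hD 1 (by omega) p _)
  have i3 := integrable_dirDeriv_entries (ν := ν) (ρ := ρ) hκ Ψ p hf hD (k := 2) (t := t) (c := c)
    (s := s) (by omega)
  unfold entryError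
  rcases hΨ with h0 | h1
  · rw [if_pos h0, ← hτ]
    have hi : Integrable (fun ω => c * (entryA p ω *
        dirDeriv (Pi.single p (1 : ℝ)) f (entries t c s ω)) -
        s * c * (t * gaussVar p) * (dirDeriv (Pi.single p (1 : ℝ)))^[2] f (entries t c s ω))
        (labelPi α ν ρ κ N Ψ) := (Integrable.const_mul i1 c).sub (i3.const_mul _)
    -- Resampling `a`, `b`, `χ` at `p` makes the expansion point independent of the entry; it is
    -- reached from the original matrix by a change of size at most `2 N^{-ρ}`.
    rw [integral_eq_integral_piecewise _ {(Var.a, p), (Var.b, p), (Var.chi, p)} hi,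
      ← integral_const_mul, ← Real.norm_eq_abs]
    refine norm_integral_le_of_norm_le (hMi.const_mul _) ?_
    have hbA := ae_abs_smallPart_le (ν := ν) (ρ := ρ) hκ hN Ψ p
    have hbV := ae_abs_middlePart_le (ν := ν) (ρ := ρ) hκ hN Ψ p
    have hAV := ae_smallPart_eq_zero_or (ν := ν) (ρ := ρ) hκ Ψ p
    have hνρ : (N : ℝ) ^ (-ν) ≤ (N : ℝ) ^ (-ρ) :=
      Real.rpow_le_rpow_of_exponent_le hN1 (by linarith)
    have hbA' : ∀ᵐ ω ∂(labelPi α ν ρ κ N Ψ), |smallPart p ω| ≤ (N : ℝ) ^ (-ρ) := by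
      filter_upwards [hbA] with ω hω using hω.trans hνρ
    filter_upwards [ae_psi hκ Ψ p, hbA', hbV, hAV] with ω hψ hA hV hAVω
    rw [h0] at hψ
    have e1 : ∀ ω' : Sample N, entryA p (({(Var.a, p), (Var.b, p), (Var.chi, p)} :
        Finset (Var × UpperIndex N)).piecewise ω' ω) = smallPart p ω' := by
      intro ω'
      simp [entryA, smallPart, Finset.piecewise, hψ]
    simp only [e1, entries_piecewise _ hψ]
    set x₀ := s * smallPart p ω + middlePart p ω with hx₀
    have hx₀b : |x₀| ≤ (N : ℝ) ^ (-ρ) := by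
      rcases hAVω with h | h
      · rw [hx₀, h]; simpa using hV
      · rw [hx₀, h, add_zero, abs_mul]
        nlinarith [abs_nonneg (smallPart p ω)]
    set ℓ : ℕ → ℝ → ℝ := fun k x => (dirDeriv (Pi.single p (1 : ℝ)))^[k] f
      (entries t c s ω + (x - x₀) • Pi.single p 1) with hℓ
    have hℓd : ∀ k ∈ Set.Icc 1 3, ∀ x, HasDerivAt (ℓ k) (ℓ (k + 1) x) x := by
      intro k hk x
      have h2 := (hasDerivAt_dirDeriv_iterate p hf (k := k) hk.2 (entries t c s ω) (x - x₀)).comp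
        x ((hasDerivAt_id x).sub_const x₀)
      exact h2.congr_deriv (mul_one _)
    have hℓM : ∀ k ≤ 4, ∀ x, |x| ≤ (N : ℝ) ^ (-ρ) → |ℓ k x| ≤ M ω := by
      intro k hk x hx
      refine hM ω k hk (x - x₀) ?_
      have := abs_sub x x₀
      linarith
    have key := abs_entry_contribution_le (Q := labelPi α ν ρ κ N Ψ) (τ := t * gaussVar p)
      (measurable_smallPart p) (measurable_middlePart p)
      hbA' hbV hAV (by simpa using integral_smallPart_odd hκ Ψ p (k := 1) (by decide))
      (integral_smallPart_odd hκ Ψ p (k := 3) (by decide)) (integral_middlePart hκ Ψ p) hc hs hℓd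
      (hℓM 4 le_rfl) (hℓM 2 (by omega) 0 (by simp; positivity))
    have hℓc : ∀ k ∈ Set.Icc 1 3, Measurable fun ω' : Sample N =>
        ℓ k (s * smallPart p ω' + middlePart p ω') := by
      intro k hk
      have hc' : Continuous (ℓ k) := continuous_iff_continuousAt.2 fun x => (hℓd k hk x).continuousAt
      exact hc'.measurable.comp
        (((measurable_smallPart p).const_mul s).add (measurable_middlePart p))
    have j1 : Integrable (fun ω' => smallPart p ω' *
        ℓ 1 (s * smallPart p ω' + middlePart p ω')) (labelPi α ν ρ κ N Ψ) := by
      have h3 : Integrable (smallPart p) (labelPi α ν ρ κ N Ψ) := by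
        simpa using integrable_pow_of_ae_bounded (measurable_smallPart p) hbA 1
      exact h3.mul_bdd (hℓc 1 (by simp)).aestronglyMeasurable
        (Filter.Eventually.of_forall fun ω' => hD 1 (by omega) p _)
    have j2 : Integrable (fun ω' => ℓ 2 (s * smallPart p ω' + middlePart p ω'))
        (labelPi α ν ρ κ N Ψ) :=
      Integrable.of_bound (hℓc 2 (by simp)).aestronglyMeasurable D
        (Filter.Eventually.of_forall fun ω' => hD 2 (by omega) p _)
    have e2 : ∫ ω', (c * (smallPart p ω' * ℓ 1 (s * smallPart p ω' + middlePart p ω')) -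
        s * c * (t * gaussVar p) * ℓ 2 (s * smallPart p ω' + middlePart p ω'))
        ∂(labelPi α ν ρ κ N Ψ) =
        c * ∫ ω', smallPart p ω' * ℓ 1 (s * smallPart p ω' + middlePart p ω')
          ∂(labelPi α ν ρ κ N Ψ) - s * c * (t * gaussVar p) *
        ∫ ω', ℓ 2 (s * smallPart p ω' + middlePart p ω') ∂(labelPi α ν ρ κ N Ψ) := by
      rw [integral_sub (j1.const_mul c) (j2.const_mul _), integral_const_mul, integral_const_mul]
    rw [Real.norm_eq_abs, mul_comm _ (M ω)]
    change |∫ ω', (c * (smallPart p ω' * ℓ 1 (s * smallPart p ω' + middlePart p ω')) -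
        s * c * (t * gaussVar p) * ℓ 2 (s * smallPart p ω' + middlePart p ω'))
        ∂(labelPi α ν ρ κ N Ψ)| ≤ _
    rw [e2]
    exact key
  · have hne : Ψ p.1.1 p.1.2 ≠ 0 := by rw [h1]; norm_num
    rw [if_neg hne, ← hτ, ← integral_const_mul, ← Real.norm_eq_abs]
    refine norm_integral_le_of_norm_le (hMi.const_mul _) ?_
    filter_upwards [ae_entryA_eq (ν := ν) (ρ := ρ) hκ Ψ p] with ω hω
    rw [hω, h1, sub_self, zero_mul, zero_mul, mul_zero, zero_sub, norm_neg, norm_mul, norm_mul,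
      Real.norm_eq_abs, Real.norm_eq_abs, Real.norm_eq_abs]
    have h2 := hM ω 2 (by omega) 0 (by simp; positivity)
    rw [zero_smul, add_zero] at h2
    refine mul_le_mul ?_ h2 (abs_nonneg _) (abs_nonneg _)
    calc |s * c| * |t * gaussVar p| ≤ 1 * |t * gaussVar p| :=
          mul_le_mul_of_nonneg_right hsc (abs_nonneg _)
      _ = _ := one_mul _

end Derivative

/-! ### Integrating the derivative along the interpolation -/

section Integrate

variable {α ν ρ : ℝ} {κ : Measure (ℝ × ℝ)} (hκ : IsDeformedStable α κ) {N : ℕ} (hN : 0 < N)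
  (hρν : ρ < ν)
  (Ψ : Matrix (Fin N) (Fin N) ℝ)
  {f : (UpperIndex N → ℝ) → ℝ} (hf : ContDiff ℝ 4 f) {D : ℝ}
  (hD : ∀ k ≤ 4, ∀ p h, |(dirDeriv (Pi.single p (1 : ℝ)))^[k] f h| ≤ D)
  {t : ℝ}

lemma hasDerivAt_entries (ω : Sample N) (θ : ℝ) :
    HasDerivAt (fun θ : ℝ => entries t (Real.cos θ) (Real.sin θ) ω)
      (fun p => Real.cos θ * entryA p ω - Real.sin θ * (Real.sqrt t * ω (Var.w, p))) θ := by
  rw [hasDerivAt_pi]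
  intro p
  have h1 := ((Real.hasDerivAt_sin θ).mul_const (entryA p ω)).add_const
    ((1 - ω (Var.psi, p)) * ω (Var.chi, p) * ω (Var.b, p) + ω (Var.psi, p) * ω (Var.c, p))
  have h2 := ((Real.hasDerivAt_cos θ).mul_const (Real.sqrt t)).mul_const (ω (Var.w, p))
  refine (h1.add h2).congr_deriv ?_
  ring

include hf in
lemma hasDerivAt_comp_entries (ω : Sample N) (θ : ℝ) :
    HasDerivAt (fun θ : ℝ => f (entries t (Real.cos θ) (Real.sin θ) ω))
      (∑ p, (Real.cos θ * entryA p ω - Real.sin θ * (Real.sqrt t * ω (Var.w, p))) *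
        dirDeriv (Pi.single p (1 : ℝ)) f (entries t (Real.cos θ) (Real.sin θ) ω)) θ := by
  have h1 := ((hf.differentiable (by norm_num)) _).hasFDerivAt.comp_hasDerivAt θ
    (hasDerivAt_entries (t := t) ω θ)
  refine h1.congr_deriv ?_
  conv_lhs => rw [pi_eq_sum_univ' (fun p => Real.cos θ * entryA p ω -
    Real.sin θ * (Real.sqrt t * ω (Var.w, p))), map_sum]
  refine Finset.sum_congr rfl fun p _ => ?_
  rw [map_smul, smul_eq_mul]
  rfl

include hκ hN hf hD in
lemma hasDerivAt_integral_entries (θ : ℝ) :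
    HasDerivAt (fun θ : ℝ => ∫ ω, f (entries t (Real.cos θ) (Real.sin θ) ω)
        ∂(labelPi α ν ρ κ N Ψ))
      (∑ p, ∫ ω, (Real.cos θ * entryA p ω - Real.sin θ * (Real.sqrt t * ω (Var.w, p))) *
        dirDeriv (Pi.single p (1 : ℝ)) f (entries t (Real.cos θ) (Real.sin θ) ω)
          ∂(labelPi α ν ρ κ N Ψ)) θ := by
  have hP := isProbabilityMeasure_labelPi (ν := ν) (ρ := ρ) hκ Ψ
  have hmeas : ∀ (p : UpperIndex N) (θ : ℝ), Measurable fun ω : Sample N =>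
      (Real.cos θ * entryA p ω - Real.sin θ * (Real.sqrt t * ω (Var.w, p))) *
        dirDeriv (Pi.single p (1 : ℝ)) f (entries t (Real.cos θ) (Real.sin θ) ω) := by
    intro p θ
    have h1 : Measurable fun ω : Sample N =>
        dirDeriv (Pi.single p (1 : ℝ)) f (entries t (Real.cos θ) (Real.sin θ) ω) :=
      measurable_dirDeriv_entries p hf (k := 1) (by omega)
    have h2 := measurable_entryA (N := N) p
    fun_prop
  have iA : ∀ p, Integrable (entryA p) (labelPi α ν ρ κ N Ψ) := fun p => by
    simpa using integrable_entryA_mul_bdd (ν := ν) (ρ := ρ) hκ hN Ψ p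
      (g := fun _ => 1) measurable_const (D := 1) (by simp)
  have ib : ∀ p, Integrable (fun ω : Sample N =>
      (|entryA p ω| + |Real.sqrt t| * |ω (Var.w, p)|) * D) (labelPi α ν ρ κ N Ψ) := fun p =>
    ((iA p).abs.add ((integrable_w hκ Ψ p).abs.const_mul _)).mul_const D
  have hb : ∀ (p : UpperIndex N) (θ : ℝ) (ω : Sample N),
      ‖(Real.cos θ * entryA p ω - Real.sin θ * (Real.sqrt t * ω (Var.w, p))) *
        dirDeriv (Pi.single p (1 : ℝ)) f (entries t (Real.cos θ) (Real.sin θ) ω)‖ ≤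
      (|entryA p ω| + |Real.sqrt t| * |ω (Var.w, p)|) * D := by
    intro p θ ω
    rw [norm_mul]
    refine mul_le_mul ?_ (hD 1 (by omega) p _) (norm_nonneg _) (by positivity)
    refine (norm_sub_le _ _).trans (add_le_add ?_ ?_)
    · rw [norm_mul]
      exact mul_le_of_le_one_left (norm_nonneg _) (Real.abs_cos_le_one θ)
    · rw [norm_mul, norm_mul]
      exact mul_le_of_le_one_left (by positivity) (Real.abs_sin_le_one θ)
  have hfm : ∀ θ, Measurable fun ω : Sample N => f (entries t (Real.cos θ) (Real.sin θ) ω) :=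
    fun θ => hf.continuous.measurable.comp (measurable_entries _ _ _)
  rw [← integral_finsetSum _ fun p _ => (ib p).mono' (hmeas p θ).aestronglyMeasurable
    (Filter.Eventually.of_forall (hb p θ))]
  by_cases hne : Nonempty (UpperIndex N)
  · obtain ⟨p₀⟩ := hne
    exact (hasDerivAt_integral_of_dominated_loc_of_deriv_le (s := Set.univ) Filter.univ_mem
      (F := fun θ ω => f (entries t (Real.cos θ) (Real.sin θ) ω))
      (Filter.Eventually.of_forall fun θ => (hfm θ).aestronglyMeasurable)
      (Integrable.of_bound (hfm θ).aestronglyMeasurable D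
        (Filter.Eventually.of_forall fun ω => hD 0 (by omega) p₀ _))
      (F' := fun θ ω => ∑ p,
        (Real.cos θ * entryA p ω - Real.sin θ * (Real.sqrt t * ω (Var.w, p))) *
        dirDeriv (Pi.single p (1 : ℝ)) f (entries t (Real.cos θ) (Real.sin θ) ω))
      (Finset.measurable_sum _ fun p _ => hmeas p θ).aestronglyMeasurable
      (bound := fun ω => ∑ p, (|entryA p ω| + |Real.sqrt t| * |ω (Var.w, p)|) * D)
      (Filter.Eventually.of_forall fun ω θ _ =>
        (norm_sum_le _ _).trans (Finset.sum_le_sum fun p _ => hb p θ ω))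
      (integrable_finsetSum _ fun p _ => ib p)
      (Filter.Eventually.of_forall fun ω θ _ => hasDerivAt_comp_entries hf ω θ)).2
  · exact absurd ⟨⟨(⟨0, hN⟩, ⟨0, hN⟩), le_rfl⟩⟩ hne

lemma entryError_nonneg (p : UpperIndex N) : 0 ≤ entryError α ν ρ κ N Ψ p := by
  unfold entryError
  split_ifs
  · have h1 : 0 ≤ ∫ ω, smallPart p ω ^ 4 ∂(labelPi α ν ρ κ N Ψ) :=
      integral_nonneg fun _ => by positivity
    have h2 : 0 ≤ ∫ ω, smallPart p ω ^ 2 ∂(labelPi α ν ρ κ N Ψ) :=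
      integral_nonneg fun _ => by positivity
    have h3 : 0 ≤ ∫ ω, middlePart p ω ^ 2 ∂(labelPi α ν ρ κ N Ψ) :=
      integral_nonneg fun _ => by positivity
    positivity
  · positivity

include hκ hN hρν hf hD in
/-- Along the path `(cos θ, sin θ)`, the expectation of `f` changes by at most the total error of
the entries times a bound for the expected size of the derivatives. -/
lemma abs_integral_sub_le (hτ : t = tParam α ν ρ κ N)
    (hΨ : ∀ i j, Ψ i j = 0 ∨ Ψ i j = 1) {B : ℝ}
    (hM : ∀ θ ∈ Set.Icc 0 (Real.pi / 2), ∃ M : Sample N → ℝ,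
      Integrable M (labelPi α ν ρ κ N Ψ) ∧
      (∀ ω : Sample N, ∀ p, ∀ k ≤ 4, ∀ x : ℝ, |x| ≤ 2 * (N : ℝ) ^ (-ρ) →
        |(dirDeriv (Pi.single p (1 : ℝ)))^[k] f
          (entries t (Real.cos θ) (Real.sin θ) ω + x • Pi.single p 1)| ≤ M ω) ∧
      ∫ ω, M ω ∂(labelPi α ν ρ κ N Ψ) ≤ B)
    {θ : ℝ} (hθ : θ ∈ Set.Icc 0 (Real.pi / 2)) :
    |∫ ω, f (entries t (Real.cos θ) (Real.sin θ) ω) ∂(labelPi α ν ρ κ N Ψ) -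
      ∫ ω, f (entries t 1 0 ω) ∂(labelPi α ν ρ κ N Ψ)| ≤
      2 * ((∑ p, entryError α ν ρ κ N Ψ p) * B) := by
  have hbound : ∀ φ ∈ Set.Icc 0 (Real.pi / 2),
      ‖∑ p, ∫ ω, (Real.cos φ * entryA p ω - Real.sin φ * (Real.sqrt t * ω (Var.w, p))) *
        dirDeriv (Pi.single p (1 : ℝ)) f (entries t (Real.cos φ) (Real.sin φ) ω)
          ∂(labelPi α ν ρ κ N Ψ)‖ ≤ (∑ p, entryError α ν ρ κ N Ψ p) * B := by
    intro φ hφ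
    obtain ⟨M, hMi, hMb, hMB⟩ := hM φ hφ
    rw [Finset.sum_mul]
    refine (norm_sum_le _ _).trans (Finset.sum_le_sum fun p _ => ?_)
    exact (abs_integral_entry_le hκ hN hρν Ψ p hf hD hτ (Real.abs_cos_le_one φ)
      (Real.abs_sin_le_one φ) hMi (fun ω k hk x hx => hMb ω p k hk x hx) (hΨ _ _)).trans
      (mul_le_mul_of_nonneg_left hMB (entryError_nonneg Ψ p))
  have h0 : (0 : ℝ) ∈ Set.Icc 0 (Real.pi / 2) := ⟨le_rfl, by positivity⟩
  have key := (convex_Icc (0 : ℝ) (Real.pi / 2)).norm_image_sub_le_of_norm_hasDerivWithin_le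
    (fun φ _ => (hasDerivAt_integral_entries (t := t) hκ hN Ψ hf hD φ).hasDerivWithinAt) hbound h0 hθ
  rw [Real.cos_zero, Real.sin_zero] at key
  refine key.trans ?_
  rw [sub_zero, Real.norm_eq_abs, abs_of_nonneg hθ.1, mul_comm]
  have h2 : θ ≤ 2 := hθ.2.trans (by linarith [Real.pi_le_four])
  exact mul_le_mul_of_nonneg_right h2 ((norm_nonneg _).trans (hbound 0 h0))

end Integrate

/-! ### The total error of the entries -/

section TotalError

variable {α ν ρ : ℝ} {κ : Measure (ℝ × ℝ)} (hκ : IsDeformedStable α κ) {N : ℕ} (hN : 0 < N)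
  (hρν : ρ < ν) (hq : 0 < (entryLaw α κ N).real (smallSet ρ N))
  (Ψ : Matrix (Fin N) (Fin N) ℝ)

include hκ hN hρν hq in
lemma entryError_le (hΨ : ∀ i j, Ψ i j = 0 ∨ Ψ i j = 1) {K : ℝ} (hK : 0 ≤ K)
    (hV : (∫ x in smallSet ρ N, x ^ 2 ∂(entryLaw α κ N)) / (entryLaw α κ N).real (smallSet ρ N) ≤
      K / N) (p : UpperIndex N) :
    entryError α ν ρ κ N Ψ p ≤
      (N : ℝ) ^ (-(2 * ν)) * (tParam α ν ρ κ N / N) +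
      2 * tParam α ν ρ κ N / N * ((tParam α ν ρ κ N + K) / N) +
      (if p.1.1 = p.1.2 then tParam α ν ρ κ N / N else 0) +
      (if Ψ p.1.1 p.1.2 = 1 then 2 * tParam α ν ρ κ N / N else 0) := by
  have ht : 0 ≤ tParam α ν ρ κ N := tParam_nonneg
  set t := tParam α ν ρ κ N with ht_def
  have hN' : (0 : ℝ) < N := by exact_mod_cast hN
  have hg : (gaussVar p : ℝ) = if p.1.1 = p.1.2 then 2 / (N : ℝ) else 1 / N := by
    unfold gaussVar
    split_ifs <;> simp
  have hg2 : t * (gaussVar p : ℝ) ≤ 2 * t / N := by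
    rw [hg, show 2 * t / N = t * (2 / N) by ring]
    refine mul_le_mul_of_nonneg_left ?_ ht
    split_ifs
    · exact le_rfl
    · gcongr
      norm_num
  have hg0 : 0 ≤ t * (gaussVar p : ℝ) := by positivity
  have hd0 : 0 ≤ (if p.1.1 = p.1.2 then t / N else 0) := by
    split_ifs <;> positivity
  unfold entryError
  rw [← ht_def]
  rcases hΨ p.1.1 p.1.2 with h0 | h1
  · rw [if_pos h0, abs_of_nonneg hg0]
    have e1 := integral_smallPart_four_le hκ hN hρν hq Ψ p
    have e2 := integral_smallPart_sq hκ hN hρν hq Ψ p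
    have e3 := (integral_middlePart_sq_le hκ hN hρν hq Ψ p).trans hV
    have e4 : |t / N - t * gaussVar p| = if p.1.1 = p.1.2 then t / N else 0 := by
      rw [hg]
      split_ifs
      · rw [show t / N - t * (2 / N) = -(t / N) by ring, abs_neg, abs_of_nonneg (by positivity)]
      · rw [mul_one_div, sub_self, abs_zero]
    rw [e2, ← ht_def, e4]
    have e5 : t * (gaussVar p : ℝ) * (t / N + ∫ ω, middlePart p ω ^ 2 ∂(labelPi α ν ρ κ N Ψ)) ≤
        2 * t / N * ((t + K) / N) := by
      refine mul_le_mul hg2 ?_ ?_ (by positivity)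
      · rw [add_div]; linarith
      · have : 0 ≤ ∫ ω, middlePart p ω ^ 2 ∂(labelPi α ν ρ κ N Ψ) :=
          integral_nonneg fun _ => by positivity
        positivity
    have h1 : Ψ p.1.1 p.1.2 ≠ 1 := by rw [h0]; norm_num
    rw [if_neg h1]
    linarith
  · have hne : Ψ p.1.1 p.1.2 ≠ 0 := by rw [h1]; norm_num
    rw [if_neg hne, if_pos h1, abs_of_nonneg hg0]
    have : 0 ≤ (N : ℝ) ^ (-(2 * ν)) * (t / N) + 2 * t / N * ((t + K) / N) := by positivity
    linarith

lemma card_upperIndex_le (N : ℕ) : (Fintype.card (UpperIndex N) : ℝ) ≤ (N : ℝ) ^ 2 := by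
  have h := Fintype.card_subtype_le fun p : Fin N × Fin N => p.1 ≤ p.2
  rw [Fintype.card_prod, Fintype.card_fin] at h
  rw [sq]
  exact_mod_cast h

lemma card_diagonal_le (N : ℕ) :
    (((Finset.univ : Finset (UpperIndex N)).filter fun p => p.1.1 = p.1.2).card : ℝ) ≤ N := by
  have h := Finset.card_le_card_of_injOn (s := (Finset.univ : Finset (UpperIndex N)).filter
    fun p => p.1.1 = p.1.2) (t := (Finset.univ : Finset (Fin N))) (fun p => p.1.1) (by simp) (by
      intro p hp q hq hpq
      have hp' : p.1.1 = p.1.2 := by simpa using hp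
      have hq' : q.1.1 = q.1.2 := by simpa using hq
      have hpq' : p.1.1 = q.1.1 := hpq
      exact Subtype.ext (Prod.ext hpq' (by rw [← hp', ← hq', hpq'])))
  rw [Finset.card_univ, Fintype.card_fin] at h
  exact_mod_cast h

lemma card_label_le :
    (((Finset.univ : Finset (UpperIndex N)).filter fun p => Ψ p.1.1 p.1.2 = 1).card : ℝ) ≤
      (({p : Fin N × Fin N | Ψ p.1 p.2 = 1}.ncard : ℕ) : ℝ) := by
  have h : ((Finset.univ : Finset (UpperIndex N)).filter fun p => Ψ p.1.1 p.1.2 = 1).card ≤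
      {p : Fin N × Fin N | Ψ p.1 p.2 = 1}.ncard := by
    rw [← Set.ncard_coe_finset]
    exact Set.ncard_le_ncard_of_injOn Subtype.val (by intro p hp; simpa using hp)
      (Subtype.val_injective.injOn) (Set.toFinite _)
  exact_mod_cast h

include hκ hN hρν hq in
/-- With few large labels, the total error of the entries is a negative power of `N`. -/
lemma sum_entryError_le (hΨ : ∀ i j, Ψ i j = 0 ∨ Ψ i j = 1) {K ε δ : ℝ} (hK : 0 < K)
    (hV : (∫ x in smallSet ρ N, x ^ 2 ∂(entryLaw α κ N)) / (entryLaw α κ N).real (smallSet ρ N) ≤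
      K / N) (ht : tParam α ν ρ κ N ≤ K * (N : ℝ) ^ (-(ν * (2 - α))))
    (hα : 0 ≤ ν * (2 - α)) (hε : 0 ≤ ε)
    (h1 : δ ≤ ν * (4 - α) - 1) (h2 : δ ≤ ν * (2 - α)) (h3 : δ ≤ ν * (2 - α) - α * ρ)
    (hcard : (({p : Fin N × Fin N | Ψ p.1 p.2 = 1}.ncard : ℕ) : ℝ) ≤
      (N : ℝ) ^ (1 + α * ρ + ε)) :
    ∑ p, entryError α ν ρ κ N Ψ p ≤ (4 * K + 4 * K ^ 2) * (N : ℝ) ^ (-δ + ε) := by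
  have hN' : (0 : ℝ) < N := by exact_mod_cast hN
  have hN1 : (1 : ℝ) ≤ N := by exact_mod_cast hN
  have ht0 : 0 ≤ tParam α ν ρ κ N := tParam_nonneg
  have hsum := Finset.sum_le_sum fun p (_ : p ∈ (Finset.univ : Finset (UpperIndex N))) =>
    entryError_le hκ hN hρν hq Ψ hΨ hK.le hV p
  refine hsum.trans ?_
  set t := tParam α ν ρ κ N
  have htK : t ≤ K := ht.trans (mul_le_of_le_one_right hK.le
    (Real.rpow_le_one_of_one_le_of_nonpos hN1 (by linarith)))
  rw [Finset.sum_add_distrib, Finset.sum_add_distrib, Finset.sum_const, ← Finset.sum_filter,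
    ← Finset.sum_filter, Finset.sum_const, Finset.sum_const, nsmul_eq_mul, nsmul_eq_mul,
    nsmul_eq_mul, Finset.card_univ]
  have hr : ∀ e : ℝ, e ≤ -δ → (N : ℝ) ^ e ≤ (N : ℝ) ^ (-δ + ε) := fun e he =>
    Real.rpow_le_rpow_of_exponent_le hN1 (by linarith)
  set R := (N : ℝ) ^ (-δ + ε)
  have ht1 : t ≤ K * R := ht.trans (mul_le_mul_of_nonneg_left (hr _ (by linarith)) hK.le)
  have s1 : (Fintype.card (UpperIndex N) : ℝ) * ((N : ℝ) ^ (-(2 * ν)) * (t / N) +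
      2 * t / N * ((t + K) / N)) ≤ K * R + 4 * K * (K * R) := by
    refine (mul_le_mul_of_nonneg_right (card_upperIndex_le N) (by positivity)).trans ?_
    have e1 : (N : ℝ) ^ 2 * ((N : ℝ) ^ (-(2 * ν)) * (t / N) + 2 * t / N * ((t + K) / N)) =
        N * (N : ℝ) ^ (-(2 * ν)) * t + 2 * t * (t + K) := by
      field_simp
    rw [e1]
    refine add_le_add ?_ ?_
    · calc N * (N : ℝ) ^ (-(2 * ν)) * t
          ≤ N * (N : ℝ) ^ (-(2 * ν)) * (K * (N : ℝ) ^ (-(ν * (2 - α)))) := by gcongr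
        _ = K * (N : ℝ) ^ (1 + -(2 * ν) + -(ν * (2 - α))) := by
            rw [Real.rpow_add hN', Real.rpow_add hN', Real.rpow_one]; ring
        _ ≤ K * R := mul_le_mul_of_nonneg_left (hr _ (by linarith)) hK.le
    · nlinarith
  have s2 := mul_le_mul_of_nonneg_right (card_diagonal_le N) (show 0 ≤ t / N by positivity)
  have s2' : (N : ℝ) * (t / N) = t := by field_simp
  have s3 := mul_le_mul_of_nonneg_right ((card_label_le Ψ).trans hcard)
    (show 0 ≤ 2 * t / N by positivity)
  have s3' : (N : ℝ) ^ (1 + α * ρ + ε) * (2 * t / N) ≤ 2 * (K * R) := by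
    calc (N : ℝ) ^ (1 + α * ρ + ε) * (2 * t / N)
        ≤ (N : ℝ) ^ (1 + α * ρ + ε) * (2 * (K * (N : ℝ) ^ (-(ν * (2 - α)))) / N) := by gcongr
      _ = 2 * (K * (N : ℝ) ^ (α * ρ + ε + -(ν * (2 - α)))) := by
          rw [Real.rpow_add hN' (α * ρ + ε), show 1 + α * ρ + ε = 1 + (α * ρ + ε) by ring,
            Real.rpow_add hN', Real.rpow_one]
          field_simp
      _ ≤ 2 * (K * R) := by
          have : (N : ℝ) ^ (α * ρ + ε + -(ν * (2 - α))) ≤ R :=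
            Real.rpow_le_rpow_of_exponent_le hN1 (by linarith)
          gcongr
  linarith

end TotalError

/-! ### The comparison for large matrices -/

section Large

/-- The powers of `Δ` outweigh the number of words, so that the expectation of the Taylor sum is
bounded by that of single derivatives with a constant that does not depend on `n`. -/
lemma integral_taylorSum_le {Ω : Type*} [MeasurableSpace Ω] {Q : Measure Ω} {m n : ℕ}
    (hm : 0 < m) {F : (Fin m → ℝ) → ℝ} {Y : Ω → Fin m → ℝ} {Δ J : ℝ} (hΔ : 0 ≤ Δ)
    (hΔm : m * Δ ≤ 1 / 2) (hJ : 0 ≤ J)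
    (hi : ∀ k ≤ 4 + n, ∀ w : Fin k → Fin m,
      Integrable (fun x => |multiDeriv (wordCount w) F (Y x)|) Q)
    (hb : ∀ k ≤ 4 + n, ∀ w : Fin k → Fin m,
      ∫ x, |multiDeriv (wordCount w) F (Y x)| ∂Q ≤ J) :
    Integrable (fun x => taylorSum F Δ n (Y x)) Q ∧
      ∫ x, taylorSum F Δ n (Y x) ∂Q ≤ 10 * (m : ℝ) ^ 4 * J := by
  have hm1 : (1 : ℝ) ≤ m := by exact_mod_cast hm
  have hle : ∀ r ∈ Finset.range 5, ∀ l ∈ Finset.range n, r + l ≤ 4 + n := by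
    intro r hr l hl
    rw [Finset.mem_range] at hr hl
    omega
  have i1 : ∀ r ∈ Finset.range 5, ∀ l ∈ Finset.range n, Integrable (fun x => Δ ^ l *
      ∑ w : Fin (r + l) → Fin m, |multiDeriv (wordCount w) F (Y x)|) Q := fun r hr l hl =>
    (integrable_finsetSum _ fun w _ => hi _ (hle r hr l hl) w).const_mul _
  have i2 : ∀ r ∈ Finset.range 5, Integrable (fun x => ∑ l ∈ Finset.range n, Δ ^ l *
      ∑ w : Fin (r + l) → Fin m, |multiDeriv (wordCount w) F (Y x)|) Q := fun r hr =>
    integrable_finsetSum _ fun l hl => i1 r hr l hl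
  refine ⟨integrable_finsetSum _ i2, ?_⟩
  unfold taylorSum
  rw [integral_finsetSum _ i2]
  have h1 : ∀ r ∈ Finset.range 5, ∫ x, ∑ l ∈ Finset.range n, Δ ^ l *
      ∑ w : Fin (r + l) → Fin m, |multiDeriv (wordCount w) F (Y x)| ∂Q ≤
      2 * (m : ℝ) ^ 4 * J := by
    intro r hr
    rw [integral_finsetSum _ (i1 r hr)]
    have h2 : ∀ l ∈ Finset.range n, ∫ x, Δ ^ l *
        ∑ w : Fin (r + l) → Fin m, |multiDeriv (wordCount w) F (Y x)| ∂Q ≤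
        (m : ℝ) ^ 4 * J * (1 / 2) ^ l := by
      intro l hl
      rw [integral_const_mul, integral_finsetSum _ fun w _ => hi _ (hle r hr l hl) w]
      have h3 : ∑ w : Fin (r + l) → Fin m, ∫ x, |multiDeriv (wordCount w) F (Y x)| ∂Q ≤
          (m : ℝ) ^ (r + l) * J := by
        refine (Finset.sum_le_sum fun w _ => hb _ (hle r hr l hl) w).trans (le_of_eq ?_)
        simp
      have h4 : r ≤ 4 := by
        rw [Finset.mem_range] at hr
        omega
      calc Δ ^ l * _ ≤ Δ ^ l * ((m : ℝ) ^ (r + l) * J) :=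
            mul_le_mul_of_nonneg_left h3 (by positivity)
        _ = (m : ℝ) ^ r * J * (m * Δ) ^ l := by rw [pow_add, mul_pow]; ring
        _ ≤ (m : ℝ) ^ 4 * J * (1 / 2) ^ l := by gcongr
    refine (Finset.sum_le_sum h2).trans ?_
    rw [← Finset.mul_sum]
    have h5 := sum_geometric_two_le n
    have h6 : 0 ≤ (m : ℝ) ^ 4 * J := by positivity
    nlinarith
  refine (Finset.sum_le_sum h1).trans (le_of_eq ?_)
  simp
  ring

variable {α ν ρ : ℝ} {κ : Measure (ℝ × ℝ)} (hκ : IsDeformedStable α κ) {N : ℕ} (hN : 0 < N)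
  {m : ℕ} {z : Fin m → ℂ}

include hN in
lemma norm_green_le_sq {z : ℂ} (hz : (N : ℝ) ^ (-2 : ℝ) < z.im) (h : UpperIndex N → ℝ)
    (a b : Fin N) : 0 < z.im ∧ ‖green z h a b‖ ≤ (N : ℝ) ^ (2 : ℝ) := by
  have hN' : (0 : ℝ) < N := by exact_mod_cast hN
  have h0 : 0 < (N : ℝ) ^ (-2 : ℝ) := by positivity
  have hz0 := h0.trans hz
  refine ⟨hz0, (norm_green_le hz0 h a b).trans ?_⟩
  rw [show (N : ℝ) ^ (2 : ℝ) = ((N : ℝ) ^ (-2 : ℝ))⁻¹ by rw [Real.rpow_neg hN'.le, inv_inv]]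
  exact inv_anti₀ h0 hz.le

/-- The event that the resolvent at `z` has entries at most `Γ`, for fixed `γ`. -/
def goodEvent (N : ℕ) (t γ Γ : ℝ) (z : ℂ) : Set (Sample N) :=
  {ω | ∀ a b : Fin N, ‖matG t γ z ω a b‖ ≤ Γ}

lemma measurable_matG {z : ℂ} (hz : 0 < z.im) (t γ : ℝ) (a b : Fin N) :
    Measurable fun ω : Sample N => matG t γ z ω a b := by
  simp only [matG_eq_green]
  exact (contDiff_green_apply hz (n := 0) a b).continuous.measurable.comp
    (measurable_entries _ _ _)

lemma measurableSet_goodEvent {z : ℂ} (hz : 0 < z.im) (t γ Γ : ℝ) :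
    MeasurableSet (goodEvent N t γ Γ z) := by
  unfold goodEvent
  simp only [Set.ofPred_forall]
  exact MeasurableSet.iInter fun a => MeasurableSet.iInter fun b =>
    measurableSet_le (measurable_matG hz t γ a b).norm measurable_const

/-- For fixed `γ` the resolvent bound is a measurable event that contains `eventOmega`, whose own
measurability is not needed. -/
lemma measureReal_compl_goodEvent_le {Q : Measure (Sample N)} [IsProbabilityMeasure Q]
    (hz : ∀ s, 0 < (z s).im) {t γ ε : ℝ} (hγ : γ ∈ Set.Icc (0 : ℝ) 1) :
    Q.real (⋂ s, goodEvent N t γ ((N : ℝ) ^ ε) (z s))ᶜ ≤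
      ∑ s, (1 - Q.real (eventOmega N t ε (z s))) := by
  rw [Set.compl_iInter]
  refine (measureReal_iUnion_fintype_le _).trans (Finset.sum_le_sum fun s _ => ?_)
  rw [probReal_compl_eq_one_sub (measurableSet_goodEvent (hz s) _ _ _)]
  refine sub_le_sub_left (measureReal_mono fun ω hω => ?_) 1
  exact fun a b => hω γ hγ a b

lemma continuous_multiDeriv_word {F : (Fin m → ℝ) → ℝ} {k n : ℕ} (hF : ContDiff ℝ n F)
    (hk : k ≤ n) (w : Fin k → Fin m) : Continuous (multiDeriv (wordCount w) F) :=
  (contDiff_multiDeriv (r := 0) (wordCount w) hF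
    (by rw [sum_wordCount]; omega)).continuous

include hκ hN in
/-- The comparison in terms of the total error of the matrix entries: the good event contributes
a power of `Γ = N^ε` times the expected derivatives of `F`, its complement the crude bound that
follows from `‖G‖ ≤ N²`. -/
lemma abs_integral_sub_le_of_large (hρν : ρ < ν) (Ψ : Matrix (Fin N) (Fin N) ℝ)
    (hΨ : ∀ i j, Ψ i j = 0 ∨ Ψ i j = 1) (hm : 0 < m)
    (hz : ∀ s, (N : ℝ) ^ (-2 : ℝ) < (z s).im) (S : Finset (Fin m)) (i j : Fin m → Fin N)
    {F : (Fin m → ℝ) → ℝ} {n : ℕ} (hF : ContDiff ℝ (4 + n : ℕ) F) {ε B₁ B₂ J : ℝ} (hε : 0 ≤ ε)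
    (hB₁ : ∀ k ≤ 4 + n, ∀ w : Fin k → Fin m, ∀ y : Fin m → ℝ, (∀ s, |y s| ≤ 2 * (N : ℝ) ^ ε) →
      |multiDeriv (wordCount w) F y| ≤ B₁)
    (hB₂ : ∀ k ≤ 4 + n, ∀ w : Fin k → Fin m, ∀ y : Fin m → ℝ,
      (∀ s, |y s| ≤ 2 * (N : ℝ) ^ (2 : ℝ)) → |multiDeriv (wordCount w) F y| ≤ B₂)
    (hr : 4 * (2 * (N : ℝ) ^ (-ρ) * (N : ℝ) ^ ε) ≤ 1)
    (hΔm : m * (4 * (2 * (N : ℝ) ^ (-ρ)) * ((N : ℝ) ^ ε) ^ 2) ≤ 1 / 2)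
    (hrem : (m * (4 * (2 * (N : ℝ) ^ (-ρ)) * ((N : ℝ) ^ ε) ^ 2)) ^ n * B₁ ≤ 1)
    (hJ0 : 0 ≤ J)
    (hJ : ∀ k ≤ 4 + n, ∀ w : Fin k → Fin m, ∀ γ ∈ Set.Icc (0 : ℝ) 1,
      ∫ ω, |multiDeriv (wordCount w) F (entryVec (tParam α ν ρ κ N) γ z S i j ω)|
        ∂(labelPi α ν ρ κ N Ψ) ≤ J) {γ : ℝ} (hγ : γ ∈ Set.Icc (0 : ℝ) 1) :
    |∫ ω, F (entryVec (tParam α ν ρ κ N) γ z S i j ω) ∂(labelPi α ν ρ κ N Ψ) -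
      ∫ ω, F (entryVec (tParam α ν ρ κ N) 0 z S i j ω) ∂(labelPi α ν ρ κ N Ψ)| ≤
      2 * ((∑ p, entryError α ν ρ κ N Ψ p) *
        (24 * (48 * (2 * (N : ℝ) ^ ε) ^ 2) ^ 4 * (10 * (m : ℝ) ^ 4 * J + (m : ℝ) ^ 4) +
          24 * ((m : ℝ) ^ 4 * B₂) * (48 * ((N : ℝ) ^ (2 : ℝ)) ^ 2) ^ 4 *
            ∑ s, (1 - (labelPi α ν ρ κ N Ψ).real (eventOmega N (tParam α ν ρ κ N) ε (z s))))) := by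
  have hP := isProbabilityMeasure_labelPi (ν := ν) (ρ := ρ) hκ Ψ
  have hN1 : (1 : ℝ) ≤ N := by exact_mod_cast hN
  have hm1 : (1 : ℝ) ≤ m := by exact_mod_cast hm
  have hz0 : ∀ s, 0 < (z s).im := fun s =>
    lt_trans (Real.rpow_pos_of_pos (by linarith) _) (hz s)
  have hN2 : (1 : ℝ) ≤ (N : ℝ) ^ (2 : ℝ) := Real.one_le_rpow hN1 (by norm_num)
  have hΓ1 : (1 : ℝ) ≤ (N : ℝ) ^ ε := Real.one_le_rpow hN1 hε
  have hgreen : ∀ (h : UpperIndex N → ℝ) s a b, ‖green (z s) h a b‖ ≤ (N : ℝ) ^ (2 : ℝ) :=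
    fun h s a b => (norm_green_le_sq hN (hz s) h a b).2
  have hF4 : ContDiff ℝ 4 F := hF.of_le (by norm_cast; omega)
  set t := tParam α ν ρ κ N with ht
  set Q := labelPi α ν ρ κ N Ψ with hQ
  set Γ := (N : ℝ) ^ ε with hΓdef
  set f : (UpperIndex N → ℝ) → ℝ := fun h => F (obs z S i j h) with hfdef
  set Dt := 24 * ((m : ℝ) ^ 4 * B₂) * (48 * ((N : ℝ) ^ (2 : ℝ)) ^ 2) ^ 4 with hDt
  have hobs2 : ∀ h s, |obs z S i j h s| ≤ 2 * (N : ℝ) ^ (2 : ℝ) := fun h s => by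
    have h1 := norm_obs_le S i j (by linarith) (hgreen h)
    have h2 := norm_le_pi_norm (obs z S i j h) s
    rw [Real.norm_eq_abs] at h2
    linarith
  have hB₂0 : 0 ≤ B₂ := (abs_nonneg _).trans (hB₂ 0 (by omega) Fin.elim0 0 (fun s => by simp))
  have hf : ContDiff ℝ 4 f :=
    hF4.comp (by exact_mod_cast contDiff_obs hz0 S i j 4)
  have hD : ∀ k ≤ 4, ∀ p h, |(dirDeriv (Pi.single p (1 : ℝ)))^[k] f h| ≤ Dt := by
    intro k hk p h
    refine abs_dirDeriv_iterate_le hz0 S i j hF4 hN2 (hgreen h) p (fun r hr => ?_) hk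
    refine (norm_iteratedFDeriv_le_pow hF (by omega) (fun w => hB₂ r (by omega) w _
      (hobs2 h))).trans ?_
    exact mul_le_mul_of_nonneg_right (pow_le_pow_right₀ hm1 hr) hB₂0
  have hDt0 : 0 ≤ Dt := by positivity
  have hvec : ∀ θ ∈ Set.Icc 0 (Real.pi / 2), ∀ ω : Sample N,
      obs z S i j (entries t (Real.cos θ) (Real.sin θ) ω) =
        entryVec t (Real.sin θ) z S i j ω := by
    intro θ hθ ω
    rw [entryVec_eq_obs, Real.cos_eq_sqrt_one_sub_sin_sq (by linarith [hθ.1, Real.pi_pos]) hθ.2]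
  have hsin : ∀ θ ∈ Set.Icc 0 (Real.pi / 2), Real.sin θ ∈ Set.Icc (0 : ℝ) 1 := fun θ hθ =>
    ⟨Real.sin_nonneg_of_nonneg_of_le_pi hθ.1 (by linarith [hθ.2, Real.pi_pos]),
      Real.sin_le_one θ⟩
  have hM : ∀ θ ∈ Set.Icc 0 (Real.pi / 2), ∃ M : Sample N → ℝ, Integrable M Q ∧
      (∀ ω : Sample N, ∀ p, ∀ k ≤ 4, ∀ x : ℝ, |x| ≤ 2 * (N : ℝ) ^ (-ρ) →
        |(dirDeriv (Pi.single p (1 : ℝ)))^[k] f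
          (entries t (Real.cos θ) (Real.sin θ) ω + x • Pi.single p 1)| ≤ M ω) ∧
      ∫ ω, M ω ∂Q ≤ 24 * (48 * (2 * Γ) ^ 2) ^ 4 * (10 * (m : ℝ) ^ 4 * J + (m : ℝ) ^ 4) +
          Dt * ∑ s, (1 - Q.real (eventOmega N t ε (z s))) := by
    intro θ hθ
    set Δ := 4 * (2 * (N : ℝ) ^ (-ρ)) * Γ ^ 2 with hΔ
    set bad : Set (Sample N) := (⋂ s, goodEvent N t (Real.sin θ) Γ (z s))ᶜ with hbad
    have hbadm : MeasurableSet bad :=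
      (MeasurableSet.iInter fun s => measurableSet_goodEvent (hz0 s) _ _ _).compl
    have hmeas : ∀ k ≤ 4 + n, ∀ w : Fin k → Fin m, Measurable fun ω : Sample N =>
        multiDeriv (wordCount w) F (obs z S i j (entries t (Real.cos θ) (Real.sin θ) ω)) :=
      fun k hk w => (continuous_multiDeriv_word hF hk w).measurable.comp
        ((contDiff_obs hz0 S i j 0).continuous.measurable.comp (measurable_entries _ _ _))
    obtain ⟨iT, hT⟩ := integral_taylorSum_le (Q := Q) (n := n) (F := F)
      (Y := fun ω => obs z S i j (entries t (Real.cos θ) (Real.sin θ) ω)) hm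
      (show 0 ≤ Δ by positivity) hΔm hJ0
      (fun k hk w => Integrable.of_bound (hmeas k hk w).norm.aestronglyMeasurable B₂
        (Filter.Eventually.of_forall fun ω => by
          rw [Real.norm_eq_abs, abs_abs]
          exact hB₂ k hk w _ (hobs2 _)))
      (fun k hk w => by
        simp only [hvec θ hθ]
        exact hJ k hk w _ (hsin θ hθ))
    have iB : Integrable (bad.indicator fun _ => (1 : ℝ)) Q :=
      (integrable_const 1).indicator hbadm
    -- On the good event the derivatives of `F` at the unperturbed matrix dominate, elsewhere the
    -- bound that comes from `‖G‖ ≤ N²`.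
    refine ⟨fun ω => 24 * (48 * (2 * Γ) ^ 2) ^ 4 *
      (taylorSum F Δ n (obs z S i j (entries t (Real.cos θ) (Real.sin θ) ω)) + (m : ℝ) ^ 4) +
        Dt * bad.indicator (fun _ => (1 : ℝ)) ω,
      ((iT.add (integrable_const _)).const_mul _).add (iB.const_mul _), ?_, ?_⟩
    · intro ω p k hk x hx
      by_cases hω : ω ∈ bad
      · beta_reduce
        rw [Set.indicator_of_mem hω, mul_one]
        have h1 := taylorSum_nonneg F (show 0 ≤ Δ by positivity) n
          (obs z S i j (entries t (Real.cos θ) (Real.sin θ) ω))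
        have h2 : 0 ≤ 24 * (48 * (2 * Γ) ^ 2) ^ 4 *
          (taylorSum F Δ n (obs z S i j (entries t (Real.cos θ) (Real.sin θ) ω)) +
            (m : ℝ) ^ 4) := by positivity
        linarith [hD k hk p (entries t (Real.cos θ) (Real.sin θ) ω + x • Pi.single p 1)]
      · beta_reduce
        rw [Set.indicator_of_notMem hω, mul_zero, add_zero]
        have hgood : ∀ s a b,
            ‖green (z s) (entries t (Real.cos θ) (Real.sin θ) ω) a b‖ ≤ Γ := by
          intro s a b
          rw [hbad, Set.notMem_compl_iff, Set.mem_iInter] at hω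
          have h1 := hω s a b
          rwa [matG_eq_green, ← Real.cos_eq_sqrt_one_sub_sin_sq
            (by linarith [hθ.1, Real.pi_pos]) hθ.2] at h1
        exact abs_dirDeriv_iterate_perturb_le hz0 S i j hF hm hΓ1 hgood hB₁ hr hrem p hx hk
    · have iT' : Integrable (fun ω => taylorSum F Δ n
          (obs z S i j (entries t (Real.cos θ) (Real.sin θ) ω)) + (m : ℝ) ^ 4) Q :=
        iT.add (integrable_const _)
      rw [integral_add (iT'.const_mul _) (iB.const_mul _), integral_const_mul, integral_const_mul,
        integral_add iT (integrable_const _), integral_const, probReal_univ, one_smul,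
        show ∫ ω, bad.indicator (fun _ => (1 : ℝ)) ω ∂Q = Q.real bad from
          integral_indicator_one hbadm]
      have h1 := measureReal_compl_goodEvent_le (Q := Q) (t := t) (ε := ε) hz0 (hsin θ hθ)
      gcongr
  have hθ : Real.arcsin γ ∈ Set.Icc 0 (Real.pi / 2) :=
    ⟨Real.arcsin_nonneg.2 hγ.1, Real.arcsin_le_pi_div_two γ⟩
  have key := abs_integral_sub_le hκ hN hρν Ψ hf hD ht hΨ hM hθ
  have e1 : ∀ ω : Sample N, f (entries t (Real.cos (Real.arcsin γ)) (Real.sin (Real.arcsin γ)) ω) =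
      F (entryVec t γ z S i j ω) := by
    intro ω
    rw [hfdef]
    simp only
    rw [hvec _ hθ, Real.sin_arcsin (by linarith [hγ.1]) hγ.2]
  have e0 : ∀ ω : Sample N, f (entries t 1 0 ω) = F (entryVec t 0 z S i j ω) := by
    intro ω
    rw [hfdef]
    simp only
    rw [entryVec_eq_obs]
    norm_num
  simp only [e1, e0] at key
  exact key

end Large

/-! ### Choice of the exponents -/

section Exponents

/-- Once `16 m N^{-ρ/4} ≤ 1`, a resolvent bound `N^ε` with `ε ≤ ρ/18` makes the replacement of one
entry of size `2 N^{-ρ}` a small perturbation, and a Taylor expansion of length `2 C₀ ε / ρ` has a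
remainder that beats the bound `N^{C₀ ε}` on the derivatives. -/
lemma perturbation_small {N m n : ℕ} (hN : 0 < N) (hm : 0 < m) {ρ ε C₀ : ℝ} (hρ : 0 < ρ)
    (hερ : ε ≤ ρ / 18) (hlarge : 16 * m * (N : ℝ) ^ (-(ρ / 4)) ≤ 1)
    (hn : 2 * C₀ * ε / ρ ≤ n) :
    4 * (2 * (N : ℝ) ^ (-ρ) * (N : ℝ) ^ ε) ≤ 1 ∧
      m * (4 * (2 * (N : ℝ) ^ (-ρ)) * ((N : ℝ) ^ ε) ^ 2) ≤ 1 / 2 ∧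
      (m * (4 * (2 * (N : ℝ) ^ (-ρ)) * ((N : ℝ) ^ ε) ^ 2)) ^ n * (N : ℝ) ^ (C₀ * ε) ≤ 1 := by
  have hN' : (0 : ℝ) < N := by exact_mod_cast hN
  have hN1 : (1 : ℝ) ≤ N := by exact_mod_cast hN
  have hm1 : (1 : ℝ) ≤ m := by exact_mod_cast hm
  have hq0 : 0 ≤ (N : ℝ) ^ (-(ρ / 4)) := by positivity
  have h1 : (N : ℝ) ^ (-ρ) * (N : ℝ) ^ ε ≤ (N : ℝ) ^ (-(ρ / 4)) := by
    rw [← Real.rpow_add hN']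
    exact Real.rpow_le_rpow_of_exponent_le hN1 (by linarith)
  have h2 : (N : ℝ) ^ (-ρ) * ((N : ℝ) ^ ε) ^ 2 ≤
      (N : ℝ) ^ (-(ρ / 4)) * (N : ℝ) ^ (-(ρ / 2)) := by
    rw [← Real.rpow_natCast, ← Real.rpow_mul hN'.le, ← Real.rpow_add hN', ← Real.rpow_add hN']
    exact Real.rpow_le_rpow_of_exponent_le hN1 (by push_cast; linarith)
  have h3 : (N : ℝ) ^ (-(ρ / 2)) ≤ 1 := Real.rpow_le_one_of_one_le_of_nonpos hN1 (by linarith)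
  have h4 : (N : ℝ) ^ (-(ρ / 4)) ≤ m * (N : ℝ) ^ (-(ρ / 4)) := le_mul_of_one_le_left hq0 hm1
  have h5 : m * (4 * (2 * (N : ℝ) ^ (-ρ)) * ((N : ℝ) ^ ε) ^ 2) ≤
      1 / 2 * (N : ℝ) ^ (-(ρ / 2)) := by
    calc m * (4 * (2 * (N : ℝ) ^ (-ρ)) * ((N : ℝ) ^ ε) ^ 2)
        = 8 * m * ((N : ℝ) ^ (-ρ) * ((N : ℝ) ^ ε) ^ 2) := by ring
      _ ≤ 8 * m * ((N : ℝ) ^ (-(ρ / 4)) * (N : ℝ) ^ (-(ρ / 2))) := by gcongr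
      _ = (16 * m * (N : ℝ) ^ (-(ρ / 4))) * (1 / 2 * (N : ℝ) ^ (-(ρ / 2))) := by ring
      _ ≤ 1 * (1 / 2 * (N : ℝ) ^ (-(ρ / 2))) := by gcongr
      _ = _ := one_mul _
  refine ⟨by linarith, by linarith, ?_⟩
  have h6 : m * (4 * (2 * (N : ℝ) ^ (-ρ)) * ((N : ℝ) ^ ε) ^ 2) ≤ (N : ℝ) ^ (-(ρ / 2)) := by
    have : 0 ≤ (N : ℝ) ^ (-(ρ / 2)) := by positivity
    linarith
  calc _ ≤ ((N : ℝ) ^ (-(ρ / 2))) ^ n * (N : ℝ) ^ (C₀ * ε) := by gcongr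
    _ = (N : ℝ) ^ (-(ρ / 2) * n + C₀ * ε) := by
      rw [← Real.rpow_natCast, ← Real.rpow_mul hN'.le, ← Real.rpow_add hN']
    _ ≤ 1 := by
      refine Real.rpow_le_one_of_one_le_of_nonpos hN1 ?_
      rw [div_le_iff₀ hρ] at hn
      nlinarith

/-- The exponent count: each unit of entry error `A N^{-δ+ε}` costs `Γ⁸ = N^{8ε}` on the good
event, and `ε = δ/18` leaves `N^{-δ/2}`. -/
lemma total_error_le {N m : ℕ} (hN : 0 < N) (hm : 0 < m) {A E J Q δ C₀ : ℝ} (hA : 0 ≤ A)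
    (hJ : 0 ≤ J) (hQ : 0 ≤ Q) (hδ : 0 ≤ δ)
    (hE : E ≤ A * (N : ℝ) ^ (-δ + δ / 18)) :
    2 * (E * (24 * (48 * (2 * (N : ℝ) ^ (δ / 18)) ^ 2) ^ 4 * (10 * (m : ℝ) ^ 4 * J + (m : ℝ) ^ 4) +
      24 * ((m : ℝ) ^ 4 * (N : ℝ) ^ C₀) * (48 * ((N : ℝ) ^ (2 : ℝ)) ^ 2) ^ 4 * Q)) ≤
      480 * 192 ^ 4 * A * (m : ℝ) ^ 4 * ((N : ℝ) ^ (-(δ / 2)) * (J + 1)) +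
        480 * 192 ^ 4 * A * (m : ℝ) ^ 4 * (Q * (N : ℝ) ^ (16 + C₀)) := by
  have hN' : (0 : ℝ) < N := by exact_mod_cast hN
  have hN1 : (1 : ℝ) ≤ N := by exact_mod_cast hN
  have e1 : (N : ℝ) ^ (-δ + δ / 18) * ((N : ℝ) ^ (δ / 18)) ^ 8 = (N : ℝ) ^ (-(δ / 2)) := by
    rw [← Real.rpow_natCast, ← Real.rpow_mul hN'.le, ← Real.rpow_add hN']
    congr 1
    push_cast
    ring
  have e2 : (N : ℝ) ^ C₀ * ((N : ℝ) ^ (2 : ℝ)) ^ 8 = (N : ℝ) ^ (16 + C₀) := by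
    rw [← Real.rpow_natCast, ← Real.rpow_mul hN'.le, ← Real.rpow_add hN']
    congr 1
    push_cast
    ring
  have e3 : (N : ℝ) ^ (-δ + δ / 18) ≤ 1 :=
    Real.rpow_le_one_of_one_le_of_nonpos hN1 (by linarith)
  set x := (N : ℝ) ^ (-δ + δ / 18) with hx
  set Γ := (N : ℝ) ^ (δ / 18) with hΓ
  set y := (N : ℝ) ^ C₀ with hy
  set v := (N : ℝ) ^ (2 : ℝ) with hv
  have hx0 : 0 ≤ x := by positivity
  have hΓ0 : 0 ≤ Γ := by positivity
  have hy0 : 0 ≤ y := by positivity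
  have hv0 : 0 ≤ v := by positivity
  rw [← e1, ← e2]
  calc 2 * (E * (24 * (48 * (2 * Γ) ^ 2) ^ 4 * (10 * (m : ℝ) ^ 4 * J + (m : ℝ) ^ 4) +
        24 * ((m : ℝ) ^ 4 * y) * (48 * v ^ 2) ^ 4 * Q))
      ≤ 2 * ((A * x) * (24 * (48 * (2 * Γ) ^ 2) ^ 4 * (10 * (m : ℝ) ^ 4 * J + (m : ℝ) ^ 4) +
        24 * ((m : ℝ) ^ 4 * y) * (48 * v ^ 2) ^ 4 * Q)) := by gcongr
    _ = 480 * 192 ^ 4 * A * (m : ℝ) ^ 4 * (x * Γ ^ 8 * (J + 1 / 10)) +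
        48 ^ 5 * A * (m : ℝ) ^ 4 * (x * (Q * (y * v ^ 8))) := by ring
    _ ≤ 480 * 192 ^ 4 * A * (m : ℝ) ^ 4 * (x * Γ ^ 8 * (J + 1)) +
        480 * 192 ^ 4 * A * (m : ℝ) ^ 4 * (1 * (Q * (y * v ^ 8))) := by
      gcongr <;> norm_num
    _ = _ := by rw [one_mul]

end Exponents

/-! ### The comparison -/

section Final

variable {α ν ρ : ℝ} {κ : Measure (ℝ × ℝ)} (hκ : IsDeformedStable α κ) {N : ℕ} (hN : 0 < N)
  {m : ℕ} {z : Fin m → ℂ} {Ψ : Matrix (Fin N) (Fin N) ℝ}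

include hN in
lemma abs_entryVec_le (hz : ∀ s, (N : ℝ) ^ (-2 : ℝ) < (z s).im) (t γ : ℝ) (S : Finset (Fin m))
    (i j : Fin m → Fin N) (ω : Sample N) (s : Fin m) :
    |entryVec t γ z S i j ω s| ≤ 2 * (N : ℝ) ^ (2 : ℝ) := by
  rw [entryVec_eq_obs]
  have h0 : 0 ≤ (N : ℝ) ^ (2 : ℝ) := by positivity
  have h1 := norm_obs_le (z := z) S i j h0
    (fun s a b => (norm_green_le_sq hN (hz s)
      (entries t (Real.sqrt (1 - γ ^ 2)) γ ω) a b).2)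
  have h2 := norm_le_pi_norm (obs z S i j (entries t (Real.sqrt (1 - γ ^ 2)) γ ω)) s
  rw [Real.norm_eq_abs] at h2
  linarith

include hκ hN in
lemma integral_le_frakJ (hz : ∀ s, (N : ℝ) ^ (-2 : ℝ) < (z s).im) {S : Finset (Fin m)} {d B : ℝ}
    {F : (Fin m → ℝ) → ℝ}
    (hB : ∀ μ : MultiIndex m d, ∀ x : Fin m → ℝ, (∀ j, |x j| ≤ 2 * (N : ℝ) ^ (2 : ℝ)) →
      |multiDeriv μ.1 F x| ≤ B)
    (hpi : labelLaw α ν ρ κ N Ψ = labelPi α ν ρ κ N Ψ) (μ : MultiIndex m d)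
    (i j : Fin m → Fin N) {γ : ℝ} (hγ : γ ∈ Set.Icc (0 : ℝ) 1) :
    ∫ ω, |multiDeriv μ.1 F (entryVec (tParam α ν ρ κ N) γ z S i j ω)|
      ∂(labelPi α ν ρ κ N Ψ) ≤ frakJ α ν ρ κ N z S d F Ψ := by
  have hP := isProbabilityMeasure_labelPi (ν := ν) (ρ := ρ) hκ Ψ
  unfold frakJ
  rw [hpi]
  refine le_ciSup (f := fun q : MultiIndex m d × (Fin m → Fin N) × (Fin m → Fin N) ×
    Set.Icc (0 : ℝ) 1 => ∫ ω, |multiDeriv q.1.1 F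
      (entryVec (tParam α ν ρ κ N) q.2.2.2.1 z S q.2.1 q.2.2.1 ω)| ∂(labelPi α ν ρ κ N Ψ))
    ⟨B, ?_⟩ (μ, i, j, ⟨γ, hγ⟩)
  rintro _ ⟨q, rfl⟩
  have h1 := norm_integral_le_of_norm_le_const (μ := labelPi α ν ρ κ N Ψ)
    (f := fun ω => |multiDeriv q.1.1 F
      (entryVec (tParam α ν ρ κ N) q.2.2.2.1 z S q.2.1 q.2.2.1 ω)|) (C := B)
    (Filter.Eventually.of_forall fun ω => by
      rw [Real.norm_eq_abs, abs_abs]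
      exact hB _ _ (abs_entryVec_le hN hz _ _ _ _ _ ω))
  rw [probReal_univ, mul_one] at h1
  exact (le_abs_self _).trans h1

lemma frakJ_nonneg {S : Finset (Fin m)} {d : ℝ} {F : (Fin m → ℝ) → ℝ} :
    0 ≤ frakJ α ν ρ κ N z S d F Ψ :=
  Real.iSup_nonneg fun _ => integral_nonneg fun _ => abs_nonneg _

lemma probQ_nonneg {ε : ℝ} : 0 ≤ probQ α ν ρ κ N ε z Ψ :=
  Finset.sum_nonneg fun _ _ => sub_nonneg.2 (by
    unfold labelLaw
    exact measureReal_le_one)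

/-- The bound for all `N` from a threshold on. -/
lemma abs_integral_labelPi_sub_le {K δ : ℝ} (hα : 0 < α) (hρ : 0 < ρ)
    (hρν : ρ < ν) (hm : 0 < m) (hδ : 0 < δ) (h1 : δ ≤ ν * (4 - α) - 1)
    (h3 : δ ≤ ν * (2 - α) - α * ρ) (hδρ : δ ≤ ρ)
    (hκ : IsDeformedStable α κ) (hN : 0 < N) (hK : 0 < K)
    (hq : 0 < (entryLaw α κ N).real (smallSet ρ N))
    (ht : tParam α ν ρ κ N ≤ K * (N : ℝ) ^ (-(ν * (2 - α))))
    (hV : (∫ x in smallSet ρ N, x ^ 2 ∂(entryLaw α κ N)) / (entryLaw α κ N).real (smallSet ρ N) ≤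
      K / N)
    (hlarge : 16 * m * (N : ℝ) ^ (-(ρ / 4)) ≤ 1)
    (hz : ∀ s, (N : ℝ) ^ (-2 : ℝ) < (z s).im) {C₀ d : ℝ} {n : ℕ}
    (hn : 2 * C₀ * (δ / 18) / ρ ≤ n) (hd : ((4 + n : ℕ) : ℝ) ≤ d)
    {F : (Fin m → ℝ) → ℝ} (hF : ContDiff ℝ (⌊d⌋₊ : ℕ) F)
    (hB₁ : ∀ μ : MultiIndex m d, ∀ x : Fin m → ℝ, (∀ j, |x j| ≤ 2 * (N : ℝ) ^ (δ / 18)) →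
      |multiDeriv μ.1 F x| ≤ (N : ℝ) ^ (C₀ * (δ / 18)))
    (hB₂ : ∀ μ : MultiIndex m d, ∀ x : Fin m → ℝ, (∀ j, |x j| ≤ 2 * (N : ℝ) ^ (2 : ℝ)) →
      |multiDeriv μ.1 F x| ≤ (N : ℝ) ^ C₀)
    (hΨ : ∀ i j, Ψ i j = 0 ∨ Ψ i j = 1)
    (hcard : (({p : Fin N × Fin N | Ψ p.1 p.2 = 1}.ncard : ℕ) : ℝ) ≤
      (N : ℝ) ^ (1 + α * ρ + δ / 18))
    (hpi : labelLaw α ν ρ κ N Ψ = labelPi α ν ρ κ N Ψ) (S : Finset (Fin m))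
    (i j : Fin m → Fin N) {γ : ℝ} (hγ : γ ∈ Set.Icc (0 : ℝ) 1) :
    |∫ ω, F (entryVec (tParam α ν ρ κ N) γ z S i j ω) ∂(labelPi α ν ρ κ N Ψ) -
      ∫ ω, F (entryVec (tParam α ν ρ κ N) 0 z S i j ω) ∂(labelPi α ν ρ κ N Ψ)| ≤
      480 * 192 ^ 4 * (4 * K + 4 * K ^ 2) * (m : ℝ) ^ 4 *
        ((N : ℝ) ^ (-(δ / 2)) * (frakJ α ν ρ κ N z S d F Ψ + 1)) +
      480 * 192 ^ 4 * (4 * K + 4 * K ^ 2) * (m : ℝ) ^ 4 *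
        (probQ α ν ρ κ N (δ / 18) z Ψ * (N : ℝ) ^ (16 + C₀)) := by
  have hαρ : 0 < α * ρ := mul_pos hα hρ
  obtain ⟨hr, hΔm, hrem⟩ := perturbation_small (C₀ := C₀) hN hm hρ
    (by linarith : δ / 18 ≤ ρ / 18) hlarge hn
  have hmi : ∀ k ≤ 4 + n, ∀ w : Fin k → Fin m, ((∑ s, wordCount w s : ℕ) : ℝ) ≤ d := by
    intro k hk w
    rw [sum_wordCount]
    exact le_trans (by exact_mod_cast hk) hd
  have hF' : ContDiff ℝ (4 + n : ℕ) F :=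
    hF.of_le (by exact_mod_cast Nat.le_floor hd)
  refine (abs_integral_sub_le_of_large hκ hN hρν Ψ hΨ hm hz S i j hF' (ε := δ / 18)
    (by positivity)
    (fun k hk w y hy => hB₁ ⟨wordCount w, hmi k hk w⟩ y hy)
    (fun k hk w y hy => hB₂ ⟨wordCount w, hmi k hk w⟩ y hy) hr hΔm hrem frakJ_nonneg
    (fun k hk w γ hγ => integral_le_frakJ hκ hN hz hB₂ hpi ⟨wordCount w, hmi k hk w⟩ i j hγ)
    hγ).trans ?_
  have hE := sum_entryError_le hκ hN hρν hq Ψ hΨ hK hV ht (by linarith : 0 ≤ ν * (2 - α))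
    (by positivity : 0 ≤ δ / 18) h1 (by linarith) h3 hcard
  have hQ : ∑ s, (1 - (labelPi α ν ρ κ N Ψ).real
      (eventOmega N (tParam α ν ρ κ N) (δ / 18) (z s))) = probQ α ν ρ κ N (δ / 18) z Ψ := by
    unfold probQ
    rw [hpi]
  rw [hQ]
  exact total_error_le hN hm (by positivity) frakJ_nonneg probQ_nonneg hδ.le hE

include hκ hN in
/-- A bound without decay in `N`, used below the threshold. -/
lemma abs_integral_sub_le_two_mul_frakJ (hz : ∀ s, (N : ℝ) ^ (-2 : ℝ) < (z s).im)
    {S : Finset (Fin m)} {d B : ℝ} (hd : 0 ≤ d) {F : (Fin m → ℝ) → ℝ}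
    (hB : ∀ μ : MultiIndex m d, ∀ x : Fin m → ℝ, (∀ j, |x j| ≤ 2 * (N : ℝ) ^ (2 : ℝ)) →
      |multiDeriv μ.1 F x| ≤ B)
    (hpi : labelLaw α ν ρ κ N Ψ = labelPi α ν ρ κ N Ψ) (i j : Fin m → Fin N) {γ : ℝ}
    (hγ : γ ∈ Set.Icc (0 : ℝ) 1) :
    |∫ ω, F (entryVec (tParam α ν ρ κ N) γ z S i j ω) ∂(labelPi α ν ρ κ N Ψ) -
      ∫ ω, F (entryVec (tParam α ν ρ κ N) 0 z S i j ω) ∂(labelPi α ν ρ κ N Ψ)| ≤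
      2 * frakJ α ν ρ κ N z S d F Ψ := by
  have h : ∀ γ ∈ Set.Icc (0 : ℝ) 1,
      |∫ ω, F (entryVec (tParam α ν ρ κ N) γ z S i j ω) ∂(labelPi α ν ρ κ N Ψ)| ≤
        frakJ α ν ρ κ N z S d F Ψ := by
    intro γ hγ
    have h1 := integral_le_frakJ hκ hN hz (S := S) hB hpi ⟨0, by simpa using hd⟩ i j hγ
    simp only [multiDeriv_zero] at h1
    exact abs_integral_le_integral_abs.trans h1
  have h0 := h 0 ⟨le_rfl, zero_le_one⟩
  have h1 := h γ hγ
  rw [abs_le] at *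
  constructor <;> linarith [h0.1, h0.2, h1.1, h1.2]

end Final

end LevyComparison

end

theorem mainTheorem5 (α b ν ρ : ℝ) (hpar : LevyComparison.Admissible α b ν ρ)
    (m : ℕ) (hm : 0 < m) :
    ∃ ε > (0 : ℝ), ∃ ϖ > (0 : ℝ), ∃ d₀ : ℝ → ℝ,
      ∀ κ : MeasureTheory.Measure (ℝ × ℝ), LevyComparison.IsDeformedStable α κ →
      ∃ C > (0 : ℝ),
      ∀ (N : ℕ), 0 < N →
      ∀ (E η : Fin m → ℝ), (∀ j, (N : ℝ) ^ (-2 : ℝ) < η j) →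
      ∀ z : Fin m → ℂ, (∀ j, z j = (E j : ℂ) + (η j : ℂ) * Complex.I) →
      ∀ (C₀ d : ℝ), 0 < C₀ → 0 < d → d₀ C₀ < d →
      ∀ F : (Fin m → ℝ) → ℝ, ContDiff ℝ (⌊d⌋₊ : ℕ) F →
      (∀ μ : LevyComparison.MultiIndex m d, ∀ x : Fin m → ℝ,
        (∀ j, |x j| ≤ 2 * (N : ℝ) ^ ε) →
          |LevyComparison.multiDeriv μ.1 F x| ≤ (N : ℝ) ^ (C₀ * ε)) →
      (∀ μ : LevyComparison.MultiIndex m d, ∀ x : Fin m → ℝ,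
        (∀ j, |x j| ≤ 2 * (N : ℝ) ^ (2 : ℝ)) →
          |LevyComparison.multiDeriv μ.1 F x| ≤ (N : ℝ) ^ C₀) →
      ∀ Ψ : Matrix (Fin N) (Fin N) ℝ, Ψ.IsSymm → (∀ i j, Ψ i j = 0 ∨ Ψ i j = 1) →
      (({p : Fin N × Fin N | Ψ p.1 p.2 = 1}.ncard : ℕ) : ℝ) ≤ (N : ℝ) ^ (1 + α * ρ + ε) →
      ∀ (S : Finset (Fin m)) (i j : Fin m → Fin N),
        (⨆ γ : Set.Icc (0 : ℝ) 1,
          |(∫ ω, F (LevyComparison.entryVec (LevyComparison.tParam α ν ρ κ N) γ.1 z S i j ω)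
              ∂(LevyComparison.labelLaw α ν ρ κ N Ψ)) -
            (∫ ω, F (LevyComparison.entryVec (LevyComparison.tParam α ν ρ κ N) 0 z S i j ω)
              ∂(LevyComparison.labelLaw α ν ρ κ N Ψ))|) <
          C * (N : ℝ) ^ (-ϖ) * (LevyComparison.frakJ α ν ρ κ N z S d F Ψ + 1) +
            C * LevyComparison.probQ α ν ρ κ N ε z Ψ * (N : ℝ) ^ (C + C₀) := by
  have hα := hpar.alpha_pos
  have hα2 := hpar.alpha_lt_two
  have hρ := hpar.rho_pos
  have hρν := hpar.rho_lt_nu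
  have hαρ : α * ρ < 1 := by
    have h1 : α * ν = 1 - α * b := by
      rw [hpar.nu_eq]
      field_simp
    nlinarith [mul_pos hα hpar.b_pos, mul_lt_mul_of_pos_left hρν hα]
  have hν4 : 1 < ν * (4 - α) := by
    have := hpar.nu_lower
    rwa [div_lt_iff₀ (by linarith)] at this
  -- `δ` is the rate at which the total error of the entries decays, cut off at `ρ` for the
  -- perturbation of a single entry; the lower bound on `ν` and `αρ < (2-α)ν` make it positive.
  obtain ⟨δ, hδ, h1, h3, hδρ⟩ : ∃ δ > 0, δ ≤ ν * (4 - α) - 1 ∧ δ ≤ ν * (2 - α) - α * ρ ∧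
      δ ≤ ρ :=
    ⟨min (min (ν * (4 - α) - 1) (ν * (2 - α) - α * ρ)) ρ,
      lt_min (lt_min (by linarith) (by linarith [hpar.alpha_rho])) hρ,
      (min_le_left _ _).trans (min_le_left _ _), (min_le_left _ _).trans (min_le_right _ _),
      min_le_right _ _⟩
  refine ⟨δ / 18, by positivity, δ / 2, by positivity,
    fun C₀ => ((4 + ⌈2 * C₀ * (δ / 18) / ρ⌉₊ : ℕ) : ℝ), fun κ hκ => ?_⟩
  obtain ⟨K, hK, N₀, hN₀⟩ := LevyComparison.exists_moment_bounds (ν := ν) hκ hα hα2 hρ hαρ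
  obtain ⟨N₁, hN₁⟩ : ∃ N₁ : ℕ, ∀ N ≥ N₁, 16 * m * (N : ℝ) ^ (-(ρ / 4)) ≤ 1 := by
    have h2 := ((tendsto_rpow_neg_atTop (show 0 < ρ / 4 by linarith)).comp
      tendsto_natCast_atTop_atTop).const_mul (16 * (m : ℝ))
    rw [mul_zero] at h2
    exact Filter.eventually_atTop.1 (h2.eventually (ge_mem_nhds zero_lt_one))
  set C₂ := 480 * 192 ^ 4 * (4 * K + 4 * K ^ 2) * (m : ℝ) ^ 4 with hC₂
  set T : ℝ := ((max N₀ N₁ : ℕ) : ℝ) ^ (δ / 2) with hT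
  have hC₂0 : 0 ≤ C₂ := by positivity
  have hT0 : 0 ≤ T := by positivity
  refine ⟨C₂ + 2 * T + 16, by positivity, ?_⟩
  intro N hN E η hη z hz C₀ d hC₀ hd0 hd F hF hB₁ hB₂ Ψ hsymm hΨ hcard S i j
  have hN' : (0 : ℝ) < N := by exact_mod_cast hN
  have hN1 : (1 : ℝ) ≤ N := by exact_mod_cast hN
  have hzim : ∀ s, (N : ℝ) ^ (-2 : ℝ) < (z s).im := fun s => by
    rw [hz s]
    simpa using hη s
  set J := LevyComparison.frakJ α ν ρ κ N z S d F Ψ with hJdef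
  set Q := LevyComparison.probQ α ν ρ κ N (δ / 18) z Ψ with hQdef
  have hJ : 0 ≤ J := LevyComparison.frakJ_nonneg
  have hQ : 0 ≤ Q := LevyComparison.probQ_nonneg
  have hX : 0 < (N : ℝ) ^ (-(δ / 2)) * (J + 1) := by positivity
  have hY : 0 ≤ Q * (N : ℝ) ^ (C₂ + 2 * T + 16 + C₀) := by positivity
  have hYle : Q * (N : ℝ) ^ (16 + C₀) ≤ Q * (N : ℝ) ^ (C₂ + 2 * T + 16 + C₀) :=
    mul_le_mul_of_nonneg_left
      (Real.rpow_le_rpow_of_exponent_le hN1 (by linarith)) hQ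
  suffices h : ∀ γ ∈ Set.Icc (0 : ℝ) 1,
      |(∫ ω, F (LevyComparison.entryVec (LevyComparison.tParam α ν ρ κ N) γ z S i j ω)
          ∂(LevyComparison.labelLaw α ν ρ κ N Ψ)) -
        (∫ ω, F (LevyComparison.entryVec (LevyComparison.tParam α ν ρ κ N) 0 z S i j ω)
          ∂(LevyComparison.labelLaw α ν ρ κ N Ψ))| ≤
      (C₂ + 2 * T) * ((N : ℝ) ^ (-(δ / 2)) * (J + 1)) +
        C₂ * (Q * (N : ℝ) ^ (C₂ + 2 * T + 16 + C₀)) by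
    have : Nonempty (Set.Icc (0 : ℝ) 1) := ⟨⟨0, le_rfl, zero_le_one⟩⟩
    refine (ciSup_le fun γ : Set.Icc (0 : ℝ) 1 => h γ.1 γ.2).trans_lt ?_
    rw [mul_assoc, mul_assoc]
    nlinarith [mul_nonneg hT0 hY]
  intro γ hγ
  -- If the label matrix has probability zero, `labelLaw` is the zero measure.
  rcases LevyComparison.labelLaw_eq (ν := ν) (ρ := ρ) hκ Ψ hsymm with h0 | hpi
  · rw [h0]
    simp only [integral_zero_measure, sub_self, abs_zero]
    positivity
  rw [hpi]
  by_cases hlarge : max N₀ N₁ ≤ N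
  · obtain ⟨hq, ht, hV⟩ := hN₀ N ((le_max_left _ _).trans hlarge) hN
    have key := LevyComparison.abs_integral_labelPi_sub_le hα hρ hρν hm hδ h1 h3 hδρ hκ hN hK hq
      ht hV (hN₁ N ((le_max_right _ _).trans hlarge)) hzim (Nat.le_ceil _) hd.le hF hB₁ hB₂ hΨ
      hcard hpi S i j hγ
    refine key.trans (add_le_add ?_ (mul_le_mul_of_nonneg_left hYle hC₂0))
    exact mul_le_mul_of_nonneg_right (by linarith) hX.le
  · have key := LevyComparison.abs_integral_sub_le_two_mul_frakJ hκ hN hzim (S := S) hd0.le hB₂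
      hpi i j hγ
    -- Below the threshold `N^{-δ/2}` is bounded below, so no decay is needed.
    have hT1 : 1 ≤ T * (N : ℝ) ^ (-(δ / 2)) := by
      have h2 : (N : ℝ) ^ (δ / 2) ≤ T :=
        Real.rpow_le_rpow hN'.le (by exact_mod_cast (not_le.1 hlarge).le) (by positivity)
      have h3 : (N : ℝ) ^ (δ / 2) * (N : ℝ) ^ (-(δ / 2)) = 1 := by
        rw [← Real.rpow_add hN', add_neg_cancel, Real.rpow_zero]
      rw [← h3]
      gcongr
    refine key.trans ?_
    have h4 : J + 1 ≤ T * (N : ℝ) ^ (-(δ / 2)) * (J + 1) :=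
      le_mul_of_one_le_left (by positivity) hT1
    nlinarith [mul_nonneg hC₂0 hX.le, mul_nonneg hC₂0 hY]
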